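/- \textbf{Theorem (Cut Admissibility).} Graphs are finite, simple, undirected and possibly empty, and their vertices are labelled by atoms, where the set of atoms is the disjoint union of a set $\mathcal V$ of propositional variables and the set of their duals $\bar a$ ($a\in\mathcal V$), with $\bar{\bar a}=a$. For graphs $G,H$ let $G\sqcup H$ (par) be their disjoint union, $G\otimes H$ (tensor) their join, $\bar G$ the complement graph with every label replaced by its dual, and $G\multimap H=\bar G\sqcup H$. For $R\subseteq V_C$ let $C[M]_R$ be the graph obtained from the disjoint union of $C$ and $M$ by adding all edges between $R$ and $V_M$; call $C[\cdot]_R$ a context. For a graph $G$ with $n$ vertices, $G(\!|H_1,\dots,H_n|\!)$ is obtained by replacing the $i$-th vertex of $G$ by $H_i$ for each $i$, with all edges between $H_i$ and $H_j$ if the $i$-th and $j$-th vertices of $G$ are adjacent and no edges between them otherwise ($i\neq j$). A set $M\subseteq V_G$ is a module if every vertex outside $M$ is adjacent to all or to none of the vertices of $M$; a graph with at least two vertices is prime if its only modules are $\emptyset$, the singletons and the whole vertex set. Consider the following rules (premise $\Rightarrow$ conclusion): \begin{itemize} \item $\mathsf{ai}{\downarrow}$: $\emptyset\Rightarrow\bar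 a\sqcup a$; \quad $\mathsf{ai}{\uparrow}$: $a\otimes\bar a\Rightarrow\emptyset$ ($a$ an atom); \item $\mathsf{ss}{\downarrow}$: $B[A]_S\Rightarrow B\sqcup A$, for $S\subseteq V_B$, $S\ne\emptyset$, $A\neq\emptyset$; \quad $\mathsf{ss}{\uparrow}$: $B\otimes A\Rightarrow B[A]_S$, for $S\subseteq V_B$, $S\neq V_B$, $A\ne\emptyset$; \item $\mathsf p{\downarrow}$: $(M_1\sqcup N_1)\otimes\cdots\otimes(M_n\sqcup N_n)\Rightarrow \bar P(\!|M_1,\dots,M_n|\!)\sqcup P(\!|N_1,\dots,N_n|\!)$; \quad $\mathsf p{\uparrow}$: $P(\!|M_1,\dots,M_n|\!)\otimes\bar P(\!|N_1,\dots,N_n|\!)\Rightarrow(M_1\otimes N_1)\sqcup\cdots\sqcup(M_n\otimes N_n)$; in both, $P$ is a prime graph with $n\ge4$ vertices and all $M_i$ are non-empty; \item $\mathsf i{\uparrow}$ (cut): $A\otimes\bar A\Rightarrow\emptyset$ ($A$ any graph). \end{itemize} Let $\mathsf{GS}=\{\mathsf{ai}{\downarrow},\mathsf{ss}{\downarrow},\mathsf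 p{\downarrow}\}$ and $\mathsf{SGS}=\mathsf{GS}\cup\{\mathsf{ai}{\uparrow},\mathsf{ss}{\uparrow},\mathsf p{\uparrow}\}$. Derivations in a set of rules $\mathsf S$ are generated inductively: every graph $G$ is a derivation from $G$ to $G$; if there are derivations from $G_i$ to $H_i$ for $1\le i\le n$ and $G$ is a graph with $n$ vertices, there is one from $G(\!|G_1,\dots,G_n|\!)$ to $G(\!|H_1,\dots,H_n|\!)$; and a derivation from $G_1$ to $H_1$ and a derivation from $G_2$ to $H_2$ compose to one from $G_1$ to $H_2$ whenever $H_1\Rightarrow G_2$ is an instance of a rule in $\mathsf S$ or $H_1$ and $G_2$ are isomorphic as labelled graphs. Write $\vdash_{\mathsf S}G$ if there is a derivation in $\mathsf S$ from $\emptyset$ to $G$. A rule $\mathsf r$ is admissible for $\mathsf S$ if for every instance $G\Rightarrow H$ of $\mathsf r$ and every context $C[\cdot]_R$, $\vdash_{\mathsf S}C[G]_R$ implies $\vdash_{\mathsf S}C[H]_R$. Then: \begin{enumerate} \item the cut rule $\mathsf i{\uparrow}$ is admissible for $\mathsf{GS}$; \item each of the rules $\mathsf{ai}{\uparrow}$,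 $\mathsf{ss}{\uparrow}$, $\mathsf p{\uparrow}$ is admissible for $\mathsf{GS}$; \item for every graph $G$: $\vdash_{\mathsf{SGS}}G$ if and only if $\vdash_{\mathsf{GS}}G$; \item for all graphs $G,H,K$: if $\vdash_{\mathsf{GS}}G\multimap H$ and $\vdash_{\mathsf{GS}}H\multimap K$, then $\vdash_{\mathsf{GS}}G\multimap K$. \end{enumerate} -/

import Mathlib

universe u

/-- Atoms over a set `V` of propositional variables: the disjoint union of `V` and of a copy of
`V` consisting of the duals of the variables. -/
inductive Atom (V : Type u) : Type u where
  | pos : V → Atom V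
  | neg : V → Atom V

/-- The dual of an atom. -/
def Atom.dual {V : Type u} : Atom V → Atom V
  | .pos a => .neg a
  | .neg a => .pos a

/-- A finite simple undirected graph whose vertices are labelled by atoms over `V`.
The empty graph is allowed. -/
structure LGraph (V : Type u) : Type (max 1 u) where
  Vert : Type
  finite : Finite Vert
  graph : SimpleGraph Vert
  label : Vert → Atom V

attribute [instance] LGraph.finite

namespace LGraph

variable {V : Type u}

/-- Label-preserving graph isomorphism. -/
def Iso (G H : LGraph V) : Prop :=
  ∃ f : G.graph ≃g H.graph, ∀ v, H.label (f v) = G.label v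

/-- The empty graph. -/
def empty : LGraph V where
  Vert := Empty
  finite := inferInstance
  graph := ⊥
  label := Empty.elim

/-- The graph with a single vertex, labelled by the atom `a`. -/
def atom (a : Atom V) : LGraph V where
  Vert := Unit
  finite := inferInstance
  graph := ⊥
  label := fun _ => a

/-- The dual graph: complement the edges and dualise the labels. -/
def dual (G : LGraph V) : LGraph V where
  Vert := G.Vert
  finite := G.finite
  graph := G.graphᶜ
  label := fun v => (G.label v).dual

/-- Par: the disjoint union of two graphs. -/
def par (G H : LGraph V) : LGraph V where
  Vert := G.Vert ⊕ H.Vert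
  finite := inferInstance
  graph := G.graph ⊕g H.graph
  label := Sum.elim G.label H.label

/-- Substitution of a graph `M` into the context given by a graph `C` and a set `R` of its
vertices: `M` is added to `C` as a module whose set of neighbours is `R`. -/
def plug (C : LGraph V) (R : Set C.Vert) (M : LGraph V) : LGraph V where
  Vert := C.Vert ⊕ M.Vert
  finite := inferInstance
  graph :=
    { Adj := fun x y => match x, y with
        | .inl v, .inl w => C.graph.Adj v w
        | .inr v, .inr w => M.graph.Adj v w
        | .inl v, .inr _ => v ∈ R
        | .inr _, .inl w => w ∈ R
      symm := by
        constructor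
        rintro (v | v) (w | w) h
        · exact C.graph.adj_symm h
        · exact h
        · exact h
        · exact M.graph.adj_symm h
      loopless := by
        constructor
        rintro (v | v) h
        · exact C.graph.irrefl h
        · exact M.graph.irrefl h }
  label := Sum.elim C.label M.label

/-- Tensor: the join of two graphs. -/
def tensor (G H : LGraph V) : LGraph V where
  Vert := G.Vert ⊕ H.Vert
  finite := inferInstance
  graph :=
    { Adj := fun x y => match x, y with
        | .inl v, .inl w => G.graph.Adj v w
        | .inr v, .inr w => H.graph.Adj v w
        | .inl _, .inr _ => True
        | .inr _, .inl _ => True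
      symm := by
        constructor
        rintro (v | v) (w | w) h
        · exact G.graph.adj_symm h
        · trivial
        · trivial
        · exact H.graph.adj_symm h
      loopless := by
        constructor
        rintro (v | v) h
        · exact G.graph.irrefl h
        · exact H.graph.irrefl h }
  label := Sum.elim G.label H.label

/-- The composition of the graphs `H i` via the graph `P`: every vertex `i` of `P` is replaced by
the graph `H i`. Labels of `P` would play no role, so `P` is taken to be unlabelled. -/
def comp {ι : Type} [Finite ι] (P : SimpleGraph ι) (H : ι → LGraph V) : LGraph V where
  Vert := Σ i, (H i).Vert
  finite := inferInstance
  graph :=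
    { Adj := fun x y =>
        P.Adj x.1 y.1 ∨ ∃ (i : ι) (v w : (H i).Vert), (H i).graph.Adj v w ∧ x = ⟨i, v⟩ ∧ y = ⟨i, w⟩
      symm := by
        constructor
        rintro x y (h | ⟨i, v, w, h, hx, hy⟩)
        · exact Or.inl h.symm
        · exact Or.inr ⟨i, w, v, h.symm, hy, hx⟩
      loopless := by
        constructor
        rintro x (h | ⟨i, v, w, h, hx, hy⟩)
        · exact P.irrefl h
        · obtain rfl : v = w := by simpa using hx.symm.trans hy
          exact (H i).graph.irrefl h }
  label := fun x => (H x.1).label x.2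

/-- The `n`-ary tensor (join) of a finite family of graphs. -/
def bigTensor {ι : Type} [Finite ι] (H : ι → LGraph V) : LGraph V := comp ⊤ H

/-- The `n`-ary par (disjoint union) of a finite family of graphs. -/
def bigPar {ι : Type} [Finite ι] (H : ι → LGraph V) : LGraph V := comp ⊥ H

/-- Linear implication. -/
def impl (G H : LGraph V) : LGraph V := G.dual.par H

end LGraph

/-- `M` is (the vertex set of) a module of `G`. -/
def IsModule {ι : Type} (G : SimpleGraph ι) (M : Set ι) : Prop :=
  ∀ v, v ∉ M → ∀ x ∈ M, ∀ y ∈ M, (G.Adj v x ↔ G.Adj v y)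

/-- A graph is prime if it has at least two vertices and all its modules are trivial. -/
def IsPrimeGraph {ι : Type} (G : SimpleGraph ι) : Prop :=
  2 ≤ Nat.card ι ∧
    ∀ M : Set ι, IsModule G M → M = ∅ ∨ (∃ x, M = {x}) ∨ M = Set.univ

/-- An inference rule, given by its instances: `r G H` says that `G` over `H` is an instance of
`r`, with premise `G` and conclusion `H`. -/
abbrev Rule (V : Type u) := LGraph V → LGraph V → Prop

namespace Rule

variable {V : Type u}

open LGraph

/-- Identity up (cut): from `A ⊗ Aᗮ` infer the empty graph. -/
inductive IUp : Rule V
  | mk (A : LGraph V) : IUp (A.tensor A.dual) empty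

/-- Atomic identity down. -/
inductive AiDown : Rule V
  | mk (a : Atom V) : AiDown empty ((atom a.dual).par (atom a))

/-- Atomic identity up (atomic cut). -/
inductive AiUp : Rule V
  | mk (a : Atom V) : AiUp ((atom a).tensor (atom a.dual)) empty

/-- Super switch down. -/
inductive SsDown : Rule V
  | mk (A B : LGraph V) (S : Set B.Vert) (hS : S ≠ ∅) (hA : Nonempty A.Vert) :
      SsDown (B.plug S A) (B.par A)

/-- Super switch up. -/
inductive SsUp : Rule V
  | mk (A B : LGraph V) (S : Set B.Vert) (hS : S ≠ Set.univ) (hA : Nonempty A.Vert) :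
      SsUp (B.tensor A) (B.plug S A)

/-- Prime down. -/
inductive PDown : Rule V
  | mk {ι : Type} [Finite ι] (P : SimpleGraph ι) (hP : IsPrimeGraph P) (hcard : 4 ≤ Nat.card ι)
      (M N : ι → LGraph V) (hM : ∀ i, Nonempty (M i).Vert) :
      PDown (bigTensor fun i => (M i).par (N i)) ((comp Pᶜ M).par (comp P N))

/-- Prime up. -/
inductive PUp : Rule V
  | mk {ι : Type} [Finite ι] (P : SimpleGraph ι) (hP : IsPrimeGraph P) (hcard : 4 ≤ Nat.card ι)
      (M N : ι → LGraph V) (hM : ∀ i, Nonempty (M i).Vert) :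
      PUp ((comp P M).tensor (comp Pᶜ N)) (bigPar fun i => (M i).tensor (N i))

/-- The applications of a rule inside an arbitrary context (deep inference). -/
inductive InContext (r : Rule V) : Rule V
  | mk (C : LGraph V) (R : Set C.Vert) (G H : LGraph V) (h : r G H) :
      InContext r (C.plug R G) (C.plug R H)

end Rule

/-- `Derives S G H`: there is a derivation in the inference system `S` with premise `G` and
conclusion `H`. -/
inductive Derives {V : Type u} (S : Set (Rule V)) : LGraph V → LGraph V → Prop
  | refl (G : LGraph V) : Derives S G G
  | comp {ι : Type} [Finite ι] (P : SimpleGraph ι) (G H : ι → LGraph V)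
      (h : ∀ i, Derives S (G i) (H i)) : Derives S (LGraph.comp P G) (LGraph.comp P H)
  | rule {G₁ H₁ G₂ H₂ : LGraph V} (r : Rule V) (hr : r ∈ S)
      (h₁ : Derives S G₁ H₁) (h : r H₁ G₂) (h₂ : Derives S G₂ H₂) : Derives S G₁ H₂
  | iso {G₁ H₁ G₂ H₂ : LGraph V}
      (h₁ : Derives S G₁ H₁) (h : H₁.Iso G₂) (h₂ : Derives S G₂ H₂) : Derives S G₁ H₂

/-- A graph is provable in `S` if it is the conclusion of a derivation from the empty graph. -/
def Provable {V : Type u} (S : Set (Rule V)) (G : LGraph V) : Prop :=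
  Derives S LGraph.empty G

/-- A rule is admissible in `S` if provability in `S` passes from the premise to the conclusion of
each of its instances, applied in any context. -/
def Admissible {V : Type u} (S : Set (Rule V)) (r : Rule V) : Prop :=
  ∀ G H : LGraph V, Rule.InContext r G H → Provable S G → Provable S H

/-- The system `GS`, the down-fragment of `SGS`. -/
def GS (V : Type u) : Set (Rule V) := {Rule.AiDown, Rule.SsDown, Rule.PDown}

/-- The system `SGS`. -/
def SGS (V : Type u) : Set (Rule V) :=
  {Rule.AiDown, Rule.SsDown, Rule.PDown, Rule.PUp, Rule.SsUp, Rule.AiUp}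

theorem Atom.dual_dual {V : Type u} (a : Atom V) : a.dual.dual = a := by
  cases a <;> rfl

namespace LGraph

variable {V : Type u}

/-- The part `S` of `G` is layered over the graph `P`: each vertex lies over the vertex `π x` of
`P`, and is a side vertex (`k x = none`), a vertex of the `P`-part (`k x = some true`), or a vertex
of the part over the complement of `P` (`k x = some false`). -/
structure Layered (G : LGraph V) (S : Set G.Vert) {ι : Type} (P : SimpleGraph ι)
    (π : G.Vert → ι) (k : G.Vert → Option Bool) : Prop where
  kind : ∀ x ∈ S, ∀ y ∈ S, k x ≠ k y → ¬ G.graph.Adj x y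
  side : ∀ x ∈ S, ∀ y ∈ S, π x ≠ π y → k x = none → k y = none → ¬ G.graph.Adj x y
  adj : ∀ x ∈ S, ∀ y ∈ S, ∀ b, π x ≠ π y → k x = some b → k y = some b →
    (G.graph.Adj x y ↔ (P.Adj (π x) (π y) ↔ b = true))

theorem Layered.mono {G : LGraph V} {S S' : Set G.Vert} {ι : Type} {P : SimpleGraph ι}
    {π : G.Vert → ι} {k : G.Vert → Option Bool} (h : G.Layered S P π k) (hS : S' ⊆ S) :
    G.Layered S' P π k :=
  ⟨fun x hx y hy => h.kind x (hS hx) y (hS hy), fun x hx y hy => h.side x (hS hx) y (hS hy),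
    fun x hx y hy => h.adj x (hS hx) y (hS hy)⟩

/-- Shallow, cut-free provability of the induced subgraph of `G` on a set of vertices. -/
inductive Pr (G : LGraph V) : Set G.Vert → Prop
  | nil : Pr G ∅
  | ax {x y : G.Vert} (hne : x ≠ y) (hadj : ¬ G.graph.Adj x y)
      (hl : G.label y = (G.label x).dual) : Pr G {x, y}
  | weak {D E : Set G.Vert} (M : Set G.Vert) (hDE : Disjoint D E) (hD : Pr G D) (hE : Pr G E)
      (hside : ∀ x ∈ D, ∀ y ∈ E, y ∉ M → ¬ G.graph.Adj x y)
      (hmod : ∀ x ∈ D, ∀ y ∈ E, ∀ z ∈ E, y ∈ M → z ∈ M → G.graph.Adj x y → G.graph.Adj x z)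
      (hM : ∀ y ∈ E, ∀ z ∈ E, y ∈ M → z ∉ M → ¬ G.graph.Adj y z) : Pr G (D ∪ E)
  | prime {ι : Type} [Finite ι] (P : SimpleGraph ι) (hP : IsPrimeGraph P)
      (hcard : 4 ≤ Nat.card ι) (S : Set G.Vert) (π : G.Vert → ι) (k : G.Vert → Option Bool)
      (h : G.Layered S P π k) (hne : ∀ i b, ∃ x ∈ S, π x = i ∧ k x = some b)
      (hS : ∀ i, Pr G {x ∈ S | π x = i}) : Pr G S

theorem Pr.map {G G' : LGraph V} {S : Set G.Vert} (hS : Pr G S) (f : G.Vert → G'.Vert)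
    (hf : Set.InjOn f S)
    (hadj : ∀ x ∈ S, ∀ y ∈ S, (G'.graph.Adj (f x) (f y) ↔ G.graph.Adj x y))
    (hlab : ∀ x ∈ S, G'.label (f x) = G.label x) : Pr G' (f '' S) := by
  induction hS with
  | nil => simpa using Pr.nil
  | @ax x y hne h hl =>
    rw [Set.image_pair]
    refine Pr.ax (fun h => hne (hf (by simp) (by simp) h)) ?_ ?_
    · rw [hadj _ (by simp) _ (by simp)]; exact h
    · rw [hlab _ (by simp), hlab _ (by simp), hl]
  | @weak D E M hDE hD hE hside hmod hM ihD ihE =>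
    rw [Set.image_union]
    refine Pr.weak (f '' (M ∩ E)) ?_ (ihD ?_ ?_ ?_) (ihE ?_ ?_ ?_) ?_ ?_ ?_
    · rw [Set.disjoint_left] at hDE ⊢
      rintro _ ⟨x, hx, rfl⟩ ⟨y, hy, hxy⟩
      rw [hf (Or.inr hy) (Or.inl hx) hxy] at hy
      exact hDE hx hy
    · exact hf.mono Set.subset_union_left
    · exact fun x hx y hy => hadj x (Or.inl hx) y (Or.inl hy)
    · exact fun x hx => hlab x (Or.inl hx)
    · exact hf.mono Set.subset_union_right
    · exact fun x hx y hy => hadj x (Or.inr hx) y (Or.inr hy)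
    · exact fun x hx => hlab x (Or.inr hx)
    · rintro _ ⟨x, hx, rfl⟩ _ ⟨y, hy, rfl⟩ hyM
      rw [hadj x (Or.inl hx) y (Or.inr hy)]
      exact hside x hx y hy fun hm => hyM ⟨y, ⟨hm, hy⟩, rfl⟩
    · rintro _ ⟨x, hx, rfl⟩ _ - _ - ⟨y, ⟨hyM, hy⟩, rfl⟩ ⟨z, ⟨hzM, hz⟩, rfl⟩
      rw [hadj x (Or.inl hx) y (Or.inr hy), hadj x (Or.inl hx) z (Or.inr hz)]
      exact hmod x hx y hy z hz hyM hzM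
    · rintro _ - _ ⟨z, hz, rfl⟩ ⟨y, ⟨hyM, hy⟩, rfl⟩ hzM
      rw [hadj y (Or.inr hy) z (Or.inr hz)]
      exact hM y hy z hz hyM fun hm => hzM ⟨z, ⟨hm, hz⟩, rfl⟩
  | @prime ι _ P hP hcard S π k h hne hS ih =>
    have : Nonempty ι := (Nat.card_pos_iff.1 (by omega)).1
    obtain ⟨x₀, -, -⟩ := hne (Classical.arbitrary ι) true
    have : Nonempty G.Vert := ⟨x₀⟩
    have hinv : ∀ x ∈ S, Function.invFunOn f S (f x) = x := fun x hx => hf.leftInvOn_invFunOn hx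
    refine Pr.prime P hP hcard (f '' S) (π ∘ Function.invFunOn f S) (k ∘ Function.invFunOn f S)
      ⟨?_, ?_, ?_⟩ ?_ ?_
    · rintro _ ⟨x, hx, rfl⟩ _ ⟨y, hy, rfl⟩
      simp only [Function.comp, hinv x hx, hinv y hy, hadj x hx y hy]
      exact h.kind x hx y hy
    · rintro _ ⟨x, hx, rfl⟩ _ ⟨y, hy, rfl⟩
      simp only [Function.comp, hinv x hx, hinv y hy, hadj x hx y hy]
      exact h.side x hx y hy
    · rintro _ ⟨x, hx, rfl⟩ _ ⟨y, hy, rfl⟩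
      simp only [Function.comp, hinv x hx, hinv y hy, hadj x hx y hy]
      exact h.adj x hx y hy
    · intro i b
      obtain ⟨x, hx, h1, h2⟩ := hne i b
      exact ⟨f x, ⟨x, hx, rfl⟩, by simp [hinv x hx, h1], by simp [hinv x hx, h2]⟩
    · intro i
      have hsub : {x ∈ S | π x = i} ⊆ S := fun x hx => hx.1
      convert ih i (hf.mono hsub) (fun x hx y hy => hadj x hx.1 y hy.1) (fun x hx => hlab x hx.1)
      ext y
      constructor
      · rintro ⟨⟨x, hx, rfl⟩, hi⟩
        exact ⟨x, ⟨hx, by simpa [hinv x hx] using hi⟩, rfl⟩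
      · rintro ⟨x, ⟨hx, hi⟩, rfl⟩
        exact ⟨⟨x, hx, rfl⟩, by simpa [hinv x hx] using hi⟩

/-- A nonempty finite graph in which no vertex is adjacent to all or to none of the other vertices
has at least four vertices. -/
theorem four_le_ncard_of_no_uniform {ι : Type} [Finite ι] (P : SimpleGraph ι) (J : Set ι)
    (hJ : J.Nonempty)
    (h : ∀ i ∈ J, ∀ c : Bool, ∃ j ∈ J, j ≠ i ∧ ¬ (P.Adj i j ↔ c = true)) : 4 ≤ J.ncard := by
  by_contra! hlt
  have hpos : 0 < J.ncard := (Set.ncard_pos J.toFinite).2 hJ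
  have hs := fun i j => (P.adj_comm i j)
  obtain h1 | h2 | h3 : J.ncard = 1 ∨ J.ncard = 2 ∨ J.ncard = 3 := by omega
  · obtain ⟨a, rfl⟩ := Set.ncard_eq_one.1 h1
    have := h a rfl true
    simp at this
  · obtain ⟨a, b, hab, rfl⟩ := Set.ncard_eq_two.1 h2
    have h1 := h a (by simp) true
    have h2 := h a (by simp) false
    simp at h1 h2
    grind
  · obtain ⟨a, b, c, hab, hac, hbc, rfl⟩ := Set.ncard_eq_three.1 h3
    have h1 := h a (by simp) true
    have h2 := h a (by simp) false
    have h3 := h b (by simp) true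
    have h4 := h b (by simp) false
    have h5 := h c (by simp) true
    have h6 := h c (by simp) false
    simp at h1 h2 h3 h4 h5 h6
    grind

/-- The prime rule holds for arbitrary graphs, without restriction to non-empty cells. -/
theorem Pr.functor_on {G : LGraph V} {ι : Type} [Finite ι] (P : SimpleGraph ι) (n : ℕ) :
    ∀ (J : Set ι), J.ncard = n → ∀ (S : Set G.Vert) (π : G.Vert → ι) (k : G.Vert → Option Bool),
      G.Layered S P π k → (∀ x ∈ S, π x ∈ J) → (∀ i ∈ J, Pr G {x ∈ S | π x = i}) → Pr G S := by
  classical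
  induction n using Nat.strong_induction_on with
  | _ n ih =>
  intro J hJn S π k h hSJ hS
  obtain rfl | hJ := J.eq_empty_or_nonempty
  · obtain rfl : S = ∅ := Set.eq_empty_of_forall_notMem hSJ
    exact Pr.nil
  -- removing one vertex of `J`
  have step : ∀ i ∈ J, ∀ c : Bool,
      (∀ x ∈ S, ∀ y ∈ S, π x ≠ i → π y = i → k y ≠ some c → ¬ G.graph.Adj x y) → Pr G S := by
    intro i hi c hc
    have hD : Pr G {x ∈ S | π x ≠ i} := by
      refine ih _ ?_ (J \ {i}) rfl _ π k (h.mono fun x hx => hx.1)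
        (fun x hx => ⟨hSJ x hx.1, hx.2⟩) ?_
      · rw [← hJn]; exact Set.ncard_sdiff_singleton_lt_of_mem hi
      · rintro j ⟨hj, hji⟩
        convert hS j hj using 1
        ext x
        simp only [Set.mem_ofPred_eq]
        grind
    have := Pr.weak {y | k y = some c} (E := {x ∈ S | π x = i}) ?_ hD (hS i hi) ?_ ?_ ?_
    · convert this
      ext x
      simp only [Set.mem_union, Set.mem_ofPred_eq]
      tauto
    · rw [Set.disjoint_left]
      exact fun x hx hx' => hx.2 hx'.2
    · exact fun x hx y hy hyM => hc x hx.1 y hy.1 hx.2 hy.2 hyM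
    · rintro x ⟨hx, hxi⟩ y ⟨hy, hyi⟩ z ⟨hz, hzi⟩ hyc hzc hxy
      have hxc : k x = some c := by
        by_contra hne
        exact h.kind x hx y hy (fun e => hne (e.trans hyc)) hxy
      rw [h.adj x hx y hy c (by rw [hyi]; exact hxi) hxc hyc] at hxy
      rw [h.adj x hx z hz c (by rw [hzi]; exact hxi) hxc hzc]
      rwa [hzi, ← hyi]
    · rintro y ⟨hy, hyi⟩ z ⟨hz, hzi⟩ hyc hzc
      exact h.kind y hy z hz fun e => hzc (e.symm.trans hyc)
  by_cases h1 : ∃ i ∈ J, ∃ b, ∀ x ∈ S, π x = i → k x ≠ some b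
  · obtain ⟨i, hi, b, hb⟩ := h1
    refine step i hi (!b) fun x hx y hy hxi hyi hyk hxy => ?_
    have hyn : k y = none := by
      have := hb y hy hyi
      cases hk : k y with
      | none => rfl
      | some c => rw [hk] at this hyk; cases b <;> cases c <;> simp_all
    have hxn : k x = none := by
      by_contra hne
      exact h.kind x hx y hy (fun e => hne (e.trans hyn)) hxy
    exact h.side x hx y hy (by rw [hyi]; exact hxi) hxn hyn hxy
  by_cases h2 : ∃ i ∈ J, ∃ c : Bool, ∀ j ∈ J, j ≠ i → (P.Adj i j ↔ c = true)
  · obtain ⟨i, hi, c, hc⟩ := h2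
    refine step i hi c fun x hx y hy hxi hyi hyk hxy => ?_
    by_cases hk : k x = k y
    · cases hb : k y with
      | none => exact h.side x hx y hy (by rw [hyi]; exact hxi) (hk.trans hb) hb hxy
      | some b =>
        rw [h.adj x hx y hy b (by rw [hyi]; exact hxi) (hk.trans hb) hb, hyi, P.adj_comm,
          hc _ (hSJ x hx) hxi] at hxy
        rw [hb] at hyk
        cases b <;> cases c <;> simp_all
    · exact h.kind x hx y hy hk hxy
  push Not at h1 h2
  have hcard := four_le_ncard_of_no_uniform P J hJ (by
    intro i hi c
    obtain ⟨j, hj, hji, hc⟩ := h2 i hi c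
    exact ⟨j, hj, hji, by tauto⟩)
  by_cases h3 : ∃ K ⊆ J, K ≠ J ∧ (∃ a ∈ K, ∃ b ∈ K, a ≠ b) ∧
      ∀ v ∈ J, v ∉ K → ∀ x ∈ K, ∀ y ∈ K, (P.Adj v x ↔ P.Adj v y)
  · obtain ⟨K, hKJ, hne, ⟨a, ha, b, hb, hab⟩, hK⟩ := h3
    have hKS : Pr G {x ∈ S | π x ∈ K} := by
      refine ih K.ncard ?_ K rfl _ π k (h.mono fun x hx => hx.1) (fun x hx => hx.2) ?_
      · rw [← hJn]
        exact Set.ncard_lt_ncard (hKJ.ssubset_of_ne hne) J.toFinite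
      · intro i hi
        convert hS i (hKJ hi) using 1
        ext x
        simp only [Set.mem_ofPred_eq]
        grind
    refine ih _ ?_ (J \ (K \ {a})) rfl S (fun x => if π x ∈ K then a else π x) k ⟨h.kind, ?_, ?_⟩
      ?_ ?_
    · rw [← hJn]
      refine Set.ncard_lt_ncard ?_ J.toFinite
      refine Set.ssubset_iff_subset_ne.2 ⟨Set.sdiff_subset, fun e => ?_⟩
      have := hKJ hb
      rw [← e] at this
      exact this.2 ⟨hb, fun h => hab h.symm⟩
    · intro x hx y hy hxy
      refine h.side x hx y hy fun e => hxy (by rw [e])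
    · intro x hx y hy c hxy hxc hyc
      rw [h.adj x hx y hy c (fun e => hxy (by rw [e])) hxc hyc]
      have hx' := hSJ x hx
      have hy' := hSJ y hy
      have hs := fun i j => (P.adj_comm i j)
      split_ifs at hxy ⊢ with h4 h5 h5
      · exact absurd rfl hxy
      · rw [P.adj_comm, P.adj_comm a, hK _ hy' h5 _ h4 a ha]
      · rw [hK _ hx' h4 _ h5 a ha]
      · rfl
    · intro x hx
      have := hSJ x hx
      have := hKJ ha
      simp only [Set.mem_sdiff, Set.mem_singleton_iff]
      split_ifs with h4 <;> tauto
    · rintro i ⟨hi, hi'⟩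
      by_cases hia : i = a
      · convert hKS using 1
        ext x
        simp only [Set.mem_ofPred_eq]
        grind
      · have hiK : i ∉ K := fun h => hi' ⟨h, hia⟩
        convert hS i hi using 1
        ext x
        simp only [Set.mem_ofPred_eq]
        grind
  push Not at h3
  obtain ⟨j₀, hj₀⟩ := hJ
  have hval : ∀ x ∈ S, ((if hx : π x ∈ J then ⟨π x, hx⟩ else ⟨j₀, hj₀⟩ : J) : ι) = π x := by
    intro x hx
    rw [dif_pos (hSJ x hx)]
  have hval' : ∀ x ∈ S, ∀ i : J, ((if hx : π x ∈ J then ⟨π x, hx⟩ else ⟨j₀, hj₀⟩ : J) = i) ↔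
      π x = i := by
    intro x hx i
    rw [dif_pos (hSJ x hx), Subtype.ext_iff]
  refine Pr.prime (P.induce J) ⟨?_, ?_⟩ ?_ S
    (fun x => if hx : π x ∈ J then ⟨π x, hx⟩ else ⟨j₀, hj₀⟩) k ⟨h.kind, ?_, ?_⟩ ?_ ?_
  · rw [Nat.card_coe_set_eq]; omega
  · intro M hM
    by_contra! hcon
    obtain ⟨hM0, hM1, hM2⟩ := hcon
    obtain ⟨a, ha⟩ := hM0
    have hsub : Subtype.val '' M ⊆ J := by rintro _ ⟨x, -, rfl⟩; exact x.2
    have hneJ : Subtype.val '' M ≠ J := by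
      intro e
      refine hM2 (Set.eq_univ_of_forall fun x => ?_)
      obtain ⟨y, hy, hxy⟩ := e.ge x.2
      rwa [← Subtype.ext hxy]
    obtain ⟨b, hb, hab⟩ : ∃ b ∈ M, a ≠ b := by
      by_contra! hcon
      exact hM1 a (Set.eq_singleton_iff_unique_mem.2 ⟨ha, fun b hb => (hcon b hb).symm⟩)
    obtain ⟨v, hv, hvM, _, ⟨x, hx, rfl⟩, _, ⟨y, hy, rfl⟩, hxy⟩ := h3 _ hsub hneJ
      ⟨a, ⟨a, ha, rfl⟩, b, ⟨b, hb, rfl⟩, fun e => hab (Subtype.ext e)⟩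
    have := hM ⟨v, hv⟩ (fun hm => hvM ⟨_, hm, rfl⟩) x hx y hy
    simp only [SimpleGraph.comap_adj, Function.Embedding.subtype_apply] at this
    tauto
  · rwa [Nat.card_coe_set_eq]
  · intro x hx y hy hxy
    exact h.side x hx y hy fun e => hxy (Subtype.ext (by rw [hval x hx, hval y hy, e]))
  · intro x hx y hy b hxy hxb hyb
    rw [h.adj x hx y hy b (fun e => hxy (Subtype.ext (by rw [hval x hx, hval y hy, e]))) hxb hyb]
    simp only [SimpleGraph.comap_adj, Function.Embedding.subtype_apply, hval x hx, hval y hy]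
  · rintro ⟨i, hi⟩ b
    obtain ⟨x, hx, hxi, hxb⟩ := h1 i hi b
    exact ⟨x, hx, (hval' x hx _).2 hxi, hxb⟩
  · rintro ⟨i, hi⟩
    convert hS i hi using 1
    ext x
    simp only [Set.mem_ofPred_eq]
    exact and_congr_right fun hx => hval' x hx _

theorem Pr.functor {G : LGraph V} {ι : Type} [Finite ι] {P : SimpleGraph ι} {S : Set G.Vert}
    {π : G.Vert → ι} {k : G.Vert → Option Bool} (h : G.Layered S P π k)
    (hS : ∀ i, Pr G {x ∈ S | π x = i}) : Pr G S :=
  Pr.functor_on P _ Set.univ rfl S π k h (fun _ _ => trivial) fun i _ => hS i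

end LGraph

namespace LGraph

variable {V : Type u}

/-- Two sets of vertices are separated: disjoint and without edges between them. -/
def Sep (G : LGraph V) (A B : Set G.Vert) : Prop :=
  ∀ x ∈ A, ∀ y ∈ B, x ≠ y ∧ ¬ G.graph.Adj x y

theorem Sep.symm {G : LGraph V} {A B : Set G.Vert} (h : G.Sep A B) : G.Sep B A :=
  fun x hx y hy => ⟨(h y hy x hx).1.symm, fun e => (h y hy x hx).2 e.symm⟩

theorem Sep.mono {G : LGraph V} {A B A' B' : Set G.Vert} (h : G.Sep A B) (hA : A' ⊆ A)
    (hB : B' ⊆ B) : G.Sep A' B' :=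
  fun x hx y hy => h x (hA hx) y (hB hy)

theorem Sep.union_left {G : LGraph V} {A A' B : Set G.Vert} (h : G.Sep A B) (h' : G.Sep A' B) :
    G.Sep (A ∪ A') B :=
  fun x hx y hy => hx.elim (fun hx => h x hx y hy) (fun hx => h' x hx y hy)

theorem Sep.union_right {G : LGraph V} {A B B' : Set G.Vert} (h : G.Sep A B) (h' : G.Sep A B') :
    G.Sep A (B ∪ B') :=
  fun x hx y hy => hy.elim (fun hy => h x hx y hy) (fun hy => h' x hx y hy)

theorem sep_empty_right {G : LGraph V} {A : Set G.Vert} : G.Sep A ∅ :=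
  fun _ _ _ hy => hy.elim

theorem sep_empty_left {G : LGraph V} {A : Set G.Vert} : G.Sep ∅ A :=
  fun _ hx => hx.elim

/-- The set `M` is a module relative to the set `C`. -/
def IsMod (G : LGraph V) (C M : Set G.Vert) : Prop :=
  ∀ x ∈ C, ∀ y ∈ M, ∀ z ∈ M, G.graph.Adj x y → G.graph.Adj x z

theorem IsMod.mono {G : LGraph V} {C M C' M' : Set G.Vert} (h : G.IsMod C M) (hC : C' ⊆ C)
    (hM : M' ⊆ M) : G.IsMod C' M' :=
  fun x hx y hy z hz => h x (hC hx) y (hM hy) z (hM hz)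

/-- The map `e` is a duality between the subgraphs of `G` on `H` and on `H'`, with inverse `e'`. -/
structure IsDual (G : LGraph V) (H H' : Set G.Vert) (e e' : G.Vert → G.Vert) : Prop where
  map : ∀ x ∈ H, e x ∈ H'
  map' : ∀ x ∈ H', e' x ∈ H
  left : ∀ x ∈ H, e' (e x) = x
  right : ∀ x ∈ H', e (e' x) = x
  adj : ∀ x ∈ H, ∀ y ∈ H, x ≠ y → (G.graph.Adj (e x) (e y) ↔ ¬ G.graph.Adj x y)
  label : ∀ x ∈ H, G.label (e x) = (G.label x).dual

namespace IsDual

variable {G : LGraph V} {H H' : Set G.Vert} {e e' : G.Vert → G.Vert}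

theorem inj (h : G.IsDual H H' e e') : Set.InjOn e H := fun x hx y hy hxy => by
  rw [← h.left x hx, ← h.left y hy, hxy]

theorem symm (h : G.IsDual H H' e e') : G.IsDual H' H e' e where
  map := h.map'
  map' := h.map
  left := h.right
  right := h.left
  adj x hx y hy hxy := by
    have hne : e' x ≠ e' y := fun he => hxy (by rw [← h.right x hx, ← h.right y hy, he])
    have := h.adj (e' x) (h.map' x hx) (e' y) (h.map' y hy) hne
    rw [h.right x hx, h.right y hy] at this
    tauto
  label x hx := by
    have := h.label (e' x) (h.map' x hx)
    rw [h.right x hx] at this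
    rw [this, Atom.dual_dual]

theorem sub (h : G.IsDual H H' e e') {K : Set G.Vert} (hK : K ⊆ H) :
    G.IsDual K (e '' K) e e' where
  map x hx := ⟨x, hx, rfl⟩
  map' := by
    rintro _ ⟨x, hx, rfl⟩
    rwa [h.left x (hK hx)]
  left x hx := h.left x (hK hx)
  right := by
    rintro _ ⟨x, hx, rfl⟩
    rw [h.left x (hK hx)]
  adj x hx y hy := h.adj x (hK hx) y (hK hy)
  label x hx := h.label x (hK hx)

theorem image_subset (h : G.IsDual H H' e e') {K : Set G.Vert} (hK : K ⊆ H) : e '' K ⊆ H' := by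
  rintro _ ⟨x, hx, rfl⟩
  exact h.map x (hK hx)

theorem image_eq (h : G.IsDual H H' e e') : e '' H = H' :=
  (h.image_subset subset_rfl).antisymm fun x hx => ⟨e' x, h.map' x hx, h.right x hx⟩

theorem image_image (h : G.IsDual H H' e e') {K : Set G.Vert} (hK : K ⊆ H) :
    e' '' (e '' K) = K := by
  ext x
  constructor
  · rintro ⟨_, ⟨y, hy, rfl⟩, rfl⟩
    rwa [h.left y (hK hy)]
  · intro hx
    exact ⟨e x, ⟨x, hx, rfl⟩, h.left x (hK hx)⟩

theorem image_diff (h : G.IsDual H H' e e') {K : Set G.Vert} (hK : K ⊆ H) :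
    e '' (H \ K) = H' \ e '' K := by
  rw [h.inj.image_sdiff_subset hK, h.image_eq]

theorem ncard_eq (h : G.IsDual H H' e e') : H'.ncard = H.ncard := by
  rw [← h.image_eq, h.inj.ncard_image]

theorem isMod (h : G.IsDual H H' e e') {C M : Set G.Vert} (hC : C ⊆ H) (hM : M ⊆ H)
    (hd : Disjoint C M) (hm : G.IsMod C M) : G.IsMod (e '' C) (e '' M) := by
  rintro _ ⟨x, hx, rfl⟩ _ ⟨y, hy, rfl⟩ _ ⟨z, hz, rfl⟩
  have h1 : x ≠ y := fun h => Set.disjoint_left.1 hd hx (h ▸ hy)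
  have h2 : x ≠ z := fun h => Set.disjoint_left.1 hd hx (h ▸ hz)
  rw [h.adj x (hC hx) y (hM hy) h1, h.adj x (hC hx) z (hM hz) h2]
  exact fun h h' => h (hm x hx z hz y hy h')

end IsDual

/-- The configuration of a cut between `H`, in the context `Γ`, and its dual `H'`, in the
context `Δ`. -/
structure CutData (G : LGraph V) (Γ Δ H H' : Set G.Vert) (e e' : G.Vert → G.Vert) : Prop where
  dual : G.IsDual H H' e e'
  sepΓΔ : G.Sep Γ Δ
  sepΓH : G.Sep Γ H
  sepΔH' : G.Sep Δ H'
  sepΓH' : G.Sep Γ H'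
  sepΔH : G.Sep Δ H
  sepHH' : G.Sep H H'

theorem CutData.symm {G : LGraph V} {Γ Δ H H' : Set G.Vert} {e e' : G.Vert → G.Vert}
    (h : G.CutData Γ Δ H H' e e') : G.CutData Δ Γ H' H e' e :=
  ⟨h.dual.symm, h.sepΓΔ.symm, h.sepΔH', h.sepΓH, h.sepΔH, h.sepΓH', h.sepHH'.symm⟩

variable (V) in
/-- Cuts on graphs with `n` vertices are admissible. -/
def CutAt (n : ℕ) : Prop :=
  ∀ (G : LGraph V) (Γ Δ H H' : Set G.Vert) (e e' : G.Vert → G.Vert), G.CutData Γ Δ H H' e e' →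
    H.ncard = n → Pr G (Γ ∪ H) → Pr G (Δ ∪ H') → Pr G (Γ ∪ Δ)

/-- A cut inside a context: if the dual of `M` is provable beside `Z₀` and `Z₁`, then `M` can be
replaced by `Z₁`, and `Z₀` moves out of the context. -/
theorem deep_cut {n : ℕ} (hcut : ∀ m < n, CutAt V m) {G : LGraph V}
    {Δ C M M' Z₀ Z₁ : Set G.Vert} {e e' : G.Vert → G.Vert} (hd : G.IsDual M M' e e')
    (hn : (C ∪ M).ncard < n) (hCM : Disjoint C M) (hCZ : Disjoint C Z₁)
    (hmod : G.IsMod C (M ∪ Z₁))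
    (hΔC : G.Sep Δ C) (hΔM : G.Sep Δ M) (hΔZ₀ : G.Sep Δ Z₀) (hΔZ₁ : G.Sep Δ Z₁)
    (hZ₀C : G.Sep Z₀ C) (hZ : G.Sep Z₀ Z₁) (hZ₀M : G.Sep Z₀ M') (hZ₁M : G.Sep Z₁ M')
    (h₁ : Pr G (Δ ∪ (C ∪ M))) (h₂ : Pr G (Z₀ ∪ Z₁ ∪ M')) : Pr G (Δ ∪ (Z₀ ∪ (C ∪ Z₁))) := by
  classical
  let G₃ : LGraph V := (G.par G).par G.dual
  let l₀ : G.Vert → G₃.Vert := fun x => Sum.inl (Sum.inl x)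
  let l₁ : G.Vert → G₃.Vert := fun x => Sum.inl (Sum.inr x)
  let l₂ : G.Vert → G₃.Vert := fun x => Sum.inr x
  have a00 : ∀ x y, G₃.graph.Adj (l₀ x) (l₀ y) ↔ G.graph.Adj x y := fun x y => by
    simp [G₃, l₀, par]
  have a11 : ∀ x y, G₃.graph.Adj (l₁ x) (l₁ y) ↔ G.graph.Adj x y := fun x y => by
    simp [G₃, l₁, par]
  have a22 : ∀ x y, G₃.graph.Adj (l₂ x) (l₂ y) ↔ x ≠ y ∧ ¬ G.graph.Adj x y := fun x y => by
    simp [G₃, l₂, par, LGraph.dual]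
  have a01 : ∀ x y, ¬ G₃.graph.Adj (l₀ x) (l₁ y) := fun x y => by simp [G₃, l₀, l₁, par]
  have a10 : ∀ x y, ¬ G₃.graph.Adj (l₁ x) (l₀ y) := fun x y => by simp [G₃, l₀, l₁, par]
  have a02 : ∀ x y, ¬ G₃.graph.Adj (l₀ x) (l₂ y) := fun x y => by simp [G₃, l₀, l₂, par]
  have a20 : ∀ x y, ¬ G₃.graph.Adj (l₂ x) (l₀ y) := fun x y => by simp [G₃, l₀, l₂, par]
  have a12 : ∀ x y, ¬ G₃.graph.Adj (l₁ x) (l₂ y) := fun x y => by simp [G₃, l₁, l₂, par]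
  have n01 : ∀ x y, l₀ x ≠ l₁ y := fun x y h => by cases h
  have n02 : ∀ x y, l₀ x ≠ l₂ y := fun x y h => by cases h
  have n12 : ∀ x y, l₁ x ≠ l₂ y := fun x y h => by cases h
  have i0 : ∀ x y, l₀ x = l₀ y ↔ x = y := fun x y =>
    ⟨fun h => Sum.inl_injective (Sum.inl_injective h), fun h => h ▸ rfl⟩
  have i1 : ∀ x y, l₁ x = l₁ y ↔ x = y := fun x y =>
    ⟨fun h => Sum.inr_injective (Sum.inl_injective h), fun h => h ▸ rfl⟩
  have i2 : ∀ x y, l₂ x = l₂ y ↔ x = y := fun x y =>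
    ⟨fun h => Sum.inr_injective h, fun h => h ▸ rfl⟩
  have e0 : ∀ x, G₃.label (l₀ x) = G.label x := fun x => rfl
  have e1 : ∀ x, G₃.label (l₁ x) = G.label x := fun x => rfl
  have e2 : ∀ x, G₃.label (l₂ x) = (G.label x).dual := fun x => rfl
  have hirr : ∀ x, ¬ G.graph.Adj x x := fun x => G.graph.irrefl
  rw [Set.disjoint_left] at hCM hCZ
  have p₁ : Pr G₃ (l₀ '' Δ ∪ l₁ '' (C ∪ M)) := by
    have hΔ : ∀ x ∈ C ∪ M, x ∉ Δ := fun x hx hx' =>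
      hx.elim (fun hx => (hΔC x hx' x hx).1 rfl) (fun hx => (hΔM x hx' x hx).1 rfl)
    have hsep : G.Sep Δ (C ∪ M) := hΔC.union_right hΔM
    have := h₁.map (G' := G₃) (fun u => if u ∈ Δ then l₀ u else l₁ u) ?_ ?_ ?_
    · convert this using 1
      rw [Set.image_union _ Δ]
      congr 1
      · exact Set.image_congr fun x hx => by rw [if_pos hx]
      · exact Set.image_congr fun x hx => by rw [if_neg (hΔ x hx)]
    · intro x hx y hy hxy
      simp only at hxy
      grind
    · intro x hx y hy
      have := hsep.symm
      simp only [Sep] at hsep this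
      simp only [Set.mem_union] at hx hy hsep this
      split_ifs with h1 h2 h2
      · exact a00 _ _
      · simp only [a01, false_iff]; grind
      · simp only [a10, false_iff]; grind
      · exact a11 _ _
    · intro x hx
      split_ifs <;> rfl
  have p₂ : Pr G₃ (l₀ '' (Z₀ ∪ (C ∪ Z₁)) ∪ l₂ '' (C ∪ M)) := by
    let T : Set G.Vert := {x | ∃ y ∈ M ∪ Z₁, G.graph.Adj x y}
    have hT : ∀ x ∈ C, ∀ y ∈ M ∪ Z₁, (G.graph.Adj x y ↔ x ∈ T) := fun x hx y hy =>
      ⟨fun h => ⟨y, hy, h⟩, fun ⟨z, hz, h⟩ => hmod x hx z hz y hy h⟩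
    let P : SimpleGraph (Option G.Vert) := SimpleGraph.fromRel fun a b => match a, b with
      | some x, some y => G.graph.Adj x y
      | some x, none => x ∈ T
      | none, _ => False
    have P1 : ∀ x y, P.Adj (some x) (some y) ↔ G.graph.Adj x y := by
      intro x y
      simp only [P, SimpleGraph.fromRel_adj, ne_eq, Option.some.injEq]
      constructor
      · rintro ⟨-, h | h⟩
        exacts [h, h.symm]
      · exact fun h => ⟨h.ne, Or.inl h⟩
    have P2 : ∀ x, P.Adj (some x) none ↔ x ∈ T := by
      intro x
      simp [P, SimpleGraph.fromRel_adj]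
    have P3 : ∀ x, P.Adj none (some x) ↔ x ∈ T := by
      intro x
      rw [P.adj_comm, P2]
    let c : G.Vert → Option G.Vert := fun x => if x ∈ C then some x else none
    let π : G₃.Vert → Option G.Vert := Sum.elim (Sum.elim c fun _ => none) c
    let k : G₃.Vert → Option Bool :=
      Sum.elim (Sum.elim (fun x => if x ∈ Z₀ then none else some true) fun _ => none)
        (fun _ => some false)
    have π0 : ∀ x, π (l₀ x) = if x ∈ C then some x else none := fun x => rfl
    have π2 : ∀ x, π (l₂ x) = if x ∈ C then some x else none := fun x => rfl
    have k0 : ∀ x, k (l₀ x) = if x ∈ Z₀ then none else some true := fun x => rfl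
    have k2 : ∀ x, k (l₂ x) = some false := fun x => rfl
    have hs := fun x y => G.graph.adj_comm x y
    have hlay : G₃.Layered (l₀ '' (Z₀ ∪ (C ∪ Z₁)) ∪ l₂ '' (C ∪ M)) P π k := by
      refine ⟨?_, ?_, ?_⟩
      · rintro _ (⟨x, hx, rfl⟩ | ⟨x, hx, rfl⟩) _ (⟨y, hy, rfl⟩ | ⟨y, hy, rfl⟩)
        · rw [k0, k0, a00]
          have hsep := hZ₀C.union_right hZ
          have := hsep.symm
          simp only [Sep] at hsep this
          grind
        · exact fun _ => a02 x y
        · exact fun _ => a20 x y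
        · simp [k2]
      · rintro _ (⟨x, hx, rfl⟩ | ⟨x, hx, rfl⟩) _ (⟨y, hy, rfl⟩ | ⟨y, hy, rfl⟩)
        · rw [π0, π0, k0, k0]
          simp only [Sep] at hZ₀C
          grind
        · exact fun _ _ _ => a02 x y
        · exact fun _ _ _ => a20 x y
        · simp [k2]
      · rintro _ (⟨x, hx, rfl⟩ | ⟨x, hx, rfl⟩) _ (⟨y, hy, rfl⟩ | ⟨y, hy, rfl⟩) b
        · rw [π0, π0, k0, k0, a00]
          simp only [Set.mem_union] at hx hy hT
          by_cases hxC : x ∈ C <;> by_cases hyC : y ∈ C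
          · simp only [hxC, hyC, if_true, P1]; grind
          · simp only [hxC, hyC, if_true, if_false, P2]; grind
          · simp only [hxC, hyC, if_true, if_false, P3]; grind
          · simp [hxC, hyC]
        · rw [k0, k2]; grind
        · rw [k0, k2]; grind
        · rw [π2, π2, k2, a22]
          simp only [Set.mem_union] at hx hy hT
          by_cases hxC : x ∈ C <;> by_cases hyC : y ∈ C
          · simp only [hxC, hyC, if_true, P1]; grind
          · simp only [hxC, hyC, if_true, if_false, P2]; grind
          · simp only [hxC, hyC, if_true, if_false, P3]; grind
          · simp [hxC, hyC]
    have hZC := hZ₀C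
    simp only [Sep] at hZC
    refine Pr.functor hlay fun i => ?_
    cases i with
    | none =>
      have hsep : G.Sep (Z₀ ∪ Z₁) M' := hZ₀M.union_left hZ₁M
      have := h₂.map (G' := G₃) (fun u => if u ∈ M' then l₂ (e' u) else l₀ u) ?_ ?_ ?_
      · convert this using 1
        rw [Set.image_union _ (Z₀ ∪ Z₁) M']
        have s1 : (fun u => if u ∈ M' then l₂ (e' u) else l₀ u) '' (Z₀ ∪ Z₁) =
            l₀ '' (Z₀ ∪ Z₁) := Set.image_congr fun x hx => by
          rw [if_neg fun h => (hsep x hx x h).1 rfl]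
        have s2 : (fun u => if u ∈ M' then l₂ (e' u) else l₀ u) '' M' = l₂ '' M := by
          rw [← hd.symm.image_eq, Set.image_image]
          exact Set.image_congr fun x hx => by rw [if_pos hx]
        rw [s1, s2]
        ext ((x | x) | x)
        · change (l₀ x ∈ _ ∧ π (l₀ x) = none) ↔ l₀ x ∈ _
          simp only [Set.mem_union, Set.mem_image, i0, fun y => (n02 x y).symm, π0]
          grind
        · change (l₁ x ∈ _ ∧ π (l₁ x) = none) ↔ l₁ x ∈ _
          simp only [Set.mem_union, Set.mem_image, n01, fun y => (n12 x y).symm]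
          grind
        · change (l₂ x ∈ _ ∧ π (l₂ x) = none) ↔ l₂ x ∈ _
          simp only [Set.mem_union, Set.mem_image]
          grind
      · intro x hx y hy hxy
        have hl := hd.right
        simp only at hxy
        split_ifs at hxy with h1 h2 h2
        · rw [i2] at hxy
          rw [← hl x h1, ← hl y h2, hxy]
        · exact (i0 _ _).1 hxy
      · intro x hx y hy
        split_ifs with h1 h2 h2
        · rw [a22]
          by_cases hxy : x = y
          · subst hxy; simp
          · have hne : e' x ≠ e' y := fun h => hxy (by rw [← hd.right x h1, ← hd.right y h2, h])
            have := hd.symm.adj x h1 y h2 hxy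
            tauto
        · refine iff_of_false (a20 _ _) ?_
          exact (hsep.symm x h1 y (hy.resolve_right h2)).2
        · refine iff_of_false (a02 _ _) ?_
          exact (hsep x (hx.resolve_right h1) y h2).2
        · exact a00 _ _
      · intro x hx
        split_ifs with h1
        · rw [e2, hd.symm.label x h1, Atom.dual_dual]
        · rfl
    | some x =>
      by_cases hx : x ∈ C
      · convert Pr.ax (n02 x x) (a02 x x) rfl using 1
        ext ((y | y) | y)
        · change (l₀ y ∈ _ ∧ π (l₀ y) = some x) ↔ l₀ y = l₀ x ∨ l₀ y = l₂ x
          simp only [Set.mem_union, Set.mem_image, i0, n02, fun y z => (n02 y z).symm, π0]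
          grind
        · change (l₁ y ∈ _ ∧ π (l₁ y) = some x) ↔ l₁ y = l₀ x ∨ l₁ y = l₂ x
          simp only [Set.mem_union, Set.mem_image, n01, n12, fun y z => (n01 y z).symm,
            fun y z => (n12 y z).symm]
          grind
        · change (l₂ y ∈ _ ∧ π (l₂ y) = some x) ↔ l₂ y = l₀ x ∨ l₂ y = l₂ x
          simp only [Set.mem_union, Set.mem_image]
          grind
      · convert Pr.nil using 1
        refine Set.eq_empty_of_forall_notMem ?_
        rintro _ ⟨⟨y, hy, rfl⟩ | ⟨y, hy, rfl⟩, h⟩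
        · rw [π0] at h; grind
        · rw [π2] at h; grind
  have hres := hcut _ hn G₃ (l₀ '' Δ) (l₀ '' (Z₀ ∪ (C ∪ Z₁))) (l₁ '' (C ∪ M)) (l₂ '' (C ∪ M))
    (Sum.elim (Sum.elim Sum.inr Sum.inr) l₁) (Sum.elim (Sum.elim Sum.inr Sum.inr) l₁) ?_ ?_ p₁ p₂
  · let q : G₃.Vert → G.Vert := Sum.elim (Sum.elim id id) id
    have := hres.map (G' := G) q ?_ ?_ ?_
    · convert this using 1
      rw [Set.image_union _ (l₀ '' Δ), Set.image_image, Set.image_image]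
      exact congrArg₂ _ (Set.image_id' _).symm (Set.image_id' _).symm
    · rintro _ (⟨x, hx, rfl⟩ | ⟨x, hx, rfl⟩) _ (⟨y, hy, rfl⟩ | ⟨y, hy, rfl⟩) h <;>
      exact congrArg l₀ h
    · rintro _ (⟨x, hx, rfl⟩ | ⟨x, hx, rfl⟩) _ (⟨y, hy, rfl⟩ | ⟨y, hy, rfl⟩) <;>
      exact (a00 x y).symm
    · rintro _ (⟨x, hx, rfl⟩ | ⟨x, hx, rfl⟩) <;> rfl
  · refine ⟨⟨?_, ?_, ?_, ?_, ?_, ?_⟩, ?_, ?_, ?_, ?_, ?_, ?_⟩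
    · rintro _ ⟨x, hx, rfl⟩; exact ⟨x, hx, rfl⟩
    · rintro _ ⟨x, hx, rfl⟩; exact ⟨x, hx, rfl⟩
    · rintro _ ⟨x, hx, rfl⟩; rfl
    · rintro _ ⟨x, hx, rfl⟩; rfl
    · rintro _ ⟨x, hx, rfl⟩ _ ⟨y, hy, rfl⟩ hxy
      have : x ≠ y := fun h => hxy (by rw [h])
      rw [a11]
      exact (a22 x y).trans (and_iff_right this)
    · rintro _ ⟨x, hx, rfl⟩; rfl
    · rintro _ ⟨x, hx, rfl⟩ _ ⟨y, hy, rfl⟩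
      rw [a00, Ne, i0]
      exact (hΔZ₀.union_right (hΔC.union_right hΔZ₁)) x hx y hy
    · rintro _ ⟨x, hx, rfl⟩ _ ⟨y, hy, rfl⟩; exact ⟨n01 _ _, a01 _ _⟩
    · rintro _ ⟨x, hx, rfl⟩ _ ⟨y, hy, rfl⟩; exact ⟨n02 _ _, a02 _ _⟩
    · rintro _ ⟨x, hx, rfl⟩ _ ⟨y, hy, rfl⟩; exact ⟨n02 _ _, a02 _ _⟩
    · rintro _ ⟨x, hx, rfl⟩ _ ⟨y, hy, rfl⟩; exact ⟨n01 _ _, a01 _ _⟩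
    · rintro _ ⟨x, hx, rfl⟩ _ ⟨y, hy, rfl⟩; exact ⟨n12 _ _, a12 _ _⟩
  · exact Set.ncard_image_of_injective _ fun x y h => (i1 x y).1 h

end LGraph

namespace LGraph

variable {V : Type u}

/-- A set of vertices inducing a connected graph. -/
def Conn (G : LGraph V) (H : Set G.Vert) : Prop :=
  ∀ K ⊆ H, K.Nonempty → (H \ K).Nonempty → ∃ x ∈ K, ∃ y ∈ H \ K, G.graph.Adj x y

/-- In the context `Γ`, the component `H` was introduced by the weak rule, along the module `M`. -/
structure WeakIntro (G : LGraph V) (Γ H Γ₁ Γ₂ M : Set G.Vert) : Prop where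
  union : Γ = Γ₁ ∪ Γ₂
  sep : G.Sep Γ₁ Γ₂
  sub : M ⊆ H
  nonempty : M.Nonempty
  nonempty' : (H \ M).Nonempty
  isMod : G.IsMod (H \ M) M
  pr : Pr G (Γ₁ ∪ M)
  pr' : Pr G (Γ₂ ∪ (H \ M))

/-- In the context `Γ`, the component `H` was introduced by the prime rule. -/
structure PrimeIntro (G : LGraph V) (Γ H : Set G.Vert) {ι : Type} (P : SimpleGraph ι)
    (π : G.Vert → ι) (k : G.Vert → Option Bool) : Prop where
  finite : Finite ι
  isPrime : IsPrimeGraph P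
  card : 4 ≤ Nat.card ι
  layered : G.Layered (Γ ∪ H) P π k
  cells : ∀ i b, ∃ x ∈ Γ ∪ H, π x = i ∧ k x = some b
  fibres : ∀ i, Pr G {x ∈ Γ ∪ H | π x = i}
  mem_iff : ∀ x ∈ Γ ∪ H, x ∈ H ↔ k x = some true

/-- The component `H` was introduced, in the context `Γ`, by the last rule of a derivation. -/
inductive Intro (G : LGraph V) (Γ H : Set G.Vert) : Prop
  | ax {x y : G.Vert} (hΓ : Γ = {x}) (hH : H = {y}) (hl : G.label y = (G.label x).dual)
  | weak {Γ₁ Γ₂ M : Set G.Vert} (h : G.WeakIntro Γ H Γ₁ Γ₂ M)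
  | prime {ι : Type} {P : SimpleGraph ι} {π : G.Vert → ι} {k : G.Vert → Option Bool}
      (h : G.PrimeIntro Γ H P π k)

end LGraph

theorem IsPrimeGraph.connected {ι : Type} {P : SimpleGraph ι} [Finite ι] (hP : IsPrimeGraph P)
    (hcard : 4 ≤ Nat.card ι) (J : Set ι) (hJ : J.Nonempty) (hJ' : Jᶜ.Nonempty) :
    ∃ i ∈ J, ∃ j ∉ J, P.Adj i j := by
  by_contra! hcon
  have h1 : IsModule P J := fun v hv x hx y hy =>
    iff_of_false (fun h => hcon x hx v hv h.symm) (fun h => hcon y hy v hv h.symm)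
  have h2 : IsModule P Jᶜ := fun v hv x hx y hy => by
    rw [Set.notMem_compl_iff] at hv
    exact iff_of_false (hcon v hv x hx) (hcon v hv y hy)
  have key : ∀ K : Set ι, IsModule P K → K.Nonempty → Kᶜ.Nonempty → K.ncard = 1 := by
    intro K hK hne hne'
    obtain rfl | ⟨x, rfl⟩ | rfl := hP.2 K hK
    · exact absurd hne Set.not_nonempty_empty
    · exact Set.ncard_singleton x
    · simp at hne'
  have h3 := key J h1 hJ hJ'
  have h4 := key Jᶜ h2 hJ' (by rwa [compl_compl])
  have := Set.ncard_add_ncard_compl J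
  omega

theorem IsPrimeGraph.compl {ι : Type} {P : SimpleGraph ι} (hP : IsPrimeGraph P) :
    IsPrimeGraph Pᶜ := by
  refine ⟨hP.1, fun M hM => hP.2 M fun v hv x hx y hy => ?_⟩
  have := hM v hv x hx y hy
  have h1 : v ≠ x := fun h => hv (h ▸ hx)
  have h2 : v ≠ y := fun h => hv (h ▸ hy)
  simp only [SimpleGraph.compl_adj, ne_eq, h1, h2, not_false_eq_true, true_and] at this
  tauto

namespace LGraph

variable {V : Type u}

/-- Exchanging the graph and its complement in a layering. -/
theorem Layered.compl {G : LGraph V} {S : Set G.Vert} {ι : Type} {P : SimpleGraph ι}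
    {π : G.Vert → ι} {k : G.Vert → Option Bool} (h : G.Layered S P π k) :
    G.Layered S Pᶜ π (fun x => (k x).map not) := by
  have hinj : ∀ a b : Option Bool, a.map not = b.map not ↔ a = b := by
    rintro (_ | _ | _) (_ | _ | _) <;> simp
  have hsome : ∀ (a : Option Bool) b, a.map not = some b ↔ a = some (!b) := by
    rintro (_ | _ | _) (_ | _) <;> simp
  refine ⟨fun x hx y hy hxy => h.kind x hx y hy fun e => hxy (by rw [e]), ?_, ?_⟩
  · intro x hx y hy hxy hkx hky
    exact h.side x hx y hy hxy (by simpa using hkx) (by simpa using hky)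
  · intro x hx y hy b hxy hkx hky
    rw [h.adj x hx y hy (!b) hxy ((hsome _ _).1 hkx) ((hsome _ _).1 hky)]
    cases b <;> simp [hxy]

/-- Permuting a cut on a connected component `H` above all rules which do not introduce `H`. -/
theorem Pr.reduce {G : LGraph V} {H Δ W : Set G.Vert} (hne : H.Nonempty) (hH : G.Conn H)
    (hΔW : Δ ⊆ W)
    (goal : ∀ Γ, G.Sep Γ H → G.Sep Γ W → Intro G Γ H → Pr G (Γ ∪ Δ)) {S : Set G.Vert}
    (hS : Pr G S) : ∀ Γ, S = Γ ∪ H → G.Sep Γ H → G.Sep Γ W → Pr G (Γ ∪ Δ) := by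
  classical
  have hirr : ∀ x, ¬ G.graph.Adj x x := fun x => G.graph.irrefl
  have hsymm := fun x y => G.graph.adj_comm x y
  induction hS with
  | nil =>
    intro Γ hΓ
    obtain ⟨x, hx⟩ := hne
    have : x ∈ (∅ : Set G.Vert) := hΓ ▸ Or.inr hx
    exact this.elim
  | @ax x y hxy hadj hl =>
    intro Γ hΓ hΓH hΓW
    have hmem : ∀ z, z ∈ Γ ∪ H ↔ z = x ∨ z = y := fun z => by rw [← hΓ]; rfl
    simp only [Set.mem_union] at hmem
    have hl' : G.label x = (G.label y).dual := by rw [hl, Atom.dual_dual]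
    by_cases hx : x ∈ H
    · have hyH : y ∉ H := fun hy => by
        obtain ⟨a, rfl, b, ⟨hb, hb'⟩, hab⟩ := hH {x} (by simpa) (by simp)
          ⟨y, hy, fun e => hxy e.symm⟩
        obtain rfl | rfl := (hmem b).1 (Or.inr hb)
        · exact hb' rfl
        · exact hadj hab
      refine goal Γ hΓH hΓW (.ax (x := y) (y := x) ?_ ?_ hl')
      · ext z
        have := hmem z; have := hmem y
        have : z ∈ Γ → z ≠ x := fun hz => (hΓH z hz x hx).1
        simp only [Set.mem_singleton_iff]; grind
      · ext z
        have := hmem z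
        simp only [Set.mem_singleton_iff]; grind
    · have hy : y ∈ H := by
        obtain ⟨z, hz⟩ := hne
        obtain rfl | rfl := (hmem z).1 (Or.inr hz)
        · exact absurd hz hx
        · exact hz
      refine goal Γ hΓH hΓW (.ax (x := x) (y := y) ?_ ?_ hl)
      · ext z
        have := hmem z; have := hmem x
        have : z ∈ Γ → z ≠ y := fun hz => (hΓH z hz y hy).1
        simp only [Set.mem_singleton_iff]; grind
      · ext z
        have := hmem z
        simp only [Set.mem_singleton_iff]; grind
  | @weak D E M hDE hD hE hside hmod hM ihD ihE =>
    intro Γ hΓ hΓH hΓW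
    have hmem : ∀ z, (z ∈ Γ ∨ z ∈ H) ↔ (z ∈ D ∨ z ∈ E) := fun z => by
      rw [← Set.mem_union, ← Set.mem_union, hΓ]
    rw [Set.disjoint_left] at hDE
    have hΓΔ : G.Sep Γ Δ := hΓW.mono subset_rfl hΔW
    have hΔΓ := hΓΔ.symm
    have hHΓ := hΓH.symm
    by_cases hHD : H ⊆ D
    · have h1 : Pr G (D \ H ∪ Δ) := ihD (D \ H) (by rw [Set.sdiff_union_of_subset hHD])
        (hΓH.mono (fun x hx => by have := hmem x; grind) subset_rfl)
        (hΓW.mono (fun x hx => by have := hmem x; grind) subset_rfl)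
      convert Pr.weak M ?_ h1 hE ?_ ?_ ?_ using 1
      · ext x; have := hmem x; have := hΓH x; simp only [Set.mem_union, Set.mem_sdiff]; grind
      · rw [Set.disjoint_left]
        simp only [Sep] at hΓΔ hΔΓ
        rintro x (hx | hx) hxE
        · exact hDE hx.1 hxE
        · exact (hΔΓ x hx x (by have := hmem x; grind)).1 rfl
      · rintro x (hx | hx) y hy hyM
        · exact hside x hx.1 y hy hyM
        · exact (hΔΓ x hx y (by have := hmem y; grind)).2
      · rintro x (hx | hx) y hy z hz hyM hzM hxy
        · exact hmod x hx.1 y hy z hz hyM hzM hxy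
        · exact absurd hxy (hΔΓ x hx y (by have := hmem y; grind)).2
      · exact hM
    by_cases hHE : H ⊆ E
    · have h1 : Pr G (E \ H ∪ Δ) := ihE (E \ H) (by rw [Set.sdiff_union_of_subset hHE])
        (hΓH.mono (fun x hx => by have := hmem x; grind) subset_rfl)
        (hΓW.mono (fun x hx => by have := hmem x; grind) subset_rfl)
      have hDΓ : ∀ x ∈ D, x ∈ Γ := fun x hx => by have := hmem x; grind
      have hEΓ : ∀ x ∈ E \ H, x ∈ Γ := fun x hx => by have := hmem x; grind
      convert Pr.weak (M ∩ (E \ H)) ?_ hD h1 ?_ ?_ ?_ using 1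
      · ext x; have := hmem x; have := hΓH x; simp only [Set.mem_union, Set.mem_sdiff]; grind
      · rw [Set.disjoint_left]
        rintro x hx (hxE | hxE)
        · exact hDE hx hxE.1
        · exact (hΓΔ x (hDΓ x hx) x hxE).1 rfl
      · rintro x hx y (hy | hy) hyM
        · exact hside x hx y hy.1 fun h => hyM ⟨h, hy⟩
        · exact (hΓΔ x (hDΓ x hx) y hy).2
      · rintro x hx y - z - ⟨hyM, hy⟩ ⟨hzM, hz⟩ hxy
        exact hmod x hx y hy.1 z hz.1 hyM hzM hxy
      · rintro y - z (hz | hz) ⟨hyM, hy⟩ hzM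
        · exact hM y hy.1 z hz.1 hyM fun h => hzM ⟨h, hz⟩
        · exact (hΓΔ y (hEΓ y hy) z hz).2
    have hnD : (H ∩ D).Nonempty := by
      obtain ⟨x, hx, hxE⟩ := Set.not_subset.1 hHE
      exact ⟨x, hx, ((hmem x).1 (Or.inr hx)).resolve_right hxE⟩
    have hnE : (H \ (H ∩ D)).Nonempty := by
      obtain ⟨x, hx, hxE⟩ := Set.not_subset.1 hHD
      exact ⟨x, hx, fun h => hxE h.2⟩
    obtain ⟨x, ⟨hxH, hxD⟩, y, ⟨hyH, hyD'⟩, hxy⟩ := hH (H ∩ D) Set.inter_subset_left hnD hnE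
    have hyD : y ∉ D := fun h => hyD' ⟨hyH, h⟩
    have hyE : y ∈ E := ((hmem y).1 (Or.inr hyH)).resolve_left hyD
    have hyM : y ∈ M := by
      by_contra h
      exact hside x hxD y hyE h hxy
    have hMH : ∀ z ∈ E, z ∈ M → z ∈ H := fun z hz hzM => by
      have := hmod x hxD y hyE z hz hyM hzM hxy
      by_contra hzH
      exact (hΓH z (((hmem z).2 (Or.inr hz)).resolve_right hzH) x hxH).2 this.symm
    have hHM : ∀ z ∈ H, z ∈ E → z ∈ M := by
      intro z hzH hzE
      by_contra hzM
      obtain ⟨a, ⟨haH, haE, haM⟩, b, ⟨hbH, hb⟩, hab⟩ := hH {w | w ∈ H ∧ w ∈ E ∧ w ∉ M}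
        (fun w hw => hw.1) ⟨z, hzH, hzE, hzM⟩ ⟨y, hyH, fun h => h.2.2 hyM⟩
      by_cases hbE : b ∈ E
      · have hbM : b ∈ M := by
          by_contra h
          exact hb ⟨hbH, hbE, h⟩
        exact hM b hbE a haE hbM haM hab.symm
      · exact hside b (((hmem b).1 (Or.inr hbH)).resolve_right hbE) a haE haM hab.symm
    refine goal Γ hΓH hΓW (.weak (Γ₁ := E \ H) (Γ₂ := D \ H) (M := H ∩ E)
      ⟨?_, ?_, Set.inter_subset_left, ⟨y, hyH, hyE⟩, ⟨x, hxH, fun h => hDE hxD h.2⟩, ?_, ?_, ?_⟩)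
    · ext z; have := hmem z; have := hΓH z; simp only [Set.mem_union, Set.mem_sdiff]; grind
    · rintro a ⟨haE, haH⟩ b ⟨hbD, hbH⟩
      refine ⟨fun h => hDE hbD (h ▸ haE), fun h => ?_⟩
      exact hside b hbD a haE (fun h' => haH (hMH a haE h')) h.symm
    · rintro a ⟨haH, haE⟩ b ⟨hbH, hbE⟩ c ⟨hcH, hcE⟩
      exact hmod a (((hmem a).1 (Or.inr haH)).resolve_right fun h => haE ⟨haH, h⟩) b hbE c hcE
        (hHM b hbH hbE) (hHM c hcH hcE)
    · convert hE using 1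
      ext z; simp only [Set.mem_union, Set.mem_sdiff, Set.mem_inter_iff]; tauto
    · convert hD using 1
      ext z
      have := hmem z; have := @hDE z
      simp only [Set.mem_union, Set.mem_sdiff, Set.mem_inter_iff]; tauto
  | @prime ι _ P hP hcard S π k h hcell hS ih =>
    rintro Γ rfl hΓH hΓW
    have hΓΔ : G.Sep Γ Δ := hΓW.mono subset_rfl hΔW
    obtain ⟨x₀, hx₀⟩ := hne
    have hk : ∀ x ∈ H, k x = k x₀ := by
      intro x hx
      by_contra hne
      obtain ⟨a, ⟨ha, hak⟩, b, ⟨hb, hbk⟩, hab⟩ := hH {y | y ∈ H ∧ k y = k x₀} (fun y hy => hy.1)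
        ⟨x₀, hx₀, rfl⟩ ⟨x, hx, fun h => hne h.2⟩
      exact h.kind a (Or.inr ha) b (Or.inr hb) (fun e => hbk ⟨hb, e ▸ hak⟩) hab
    cases hb : k x₀ with
    | none =>
      rw [hb] at hk
      have hπ : ∀ x ∈ H, π x = π x₀ := by
        intro x hx
        by_contra hne
        obtain ⟨a, ⟨ha, hak⟩, c, ⟨hc, hck⟩, hac⟩ := hH {y | y ∈ H ∧ π y = π x₀}
          (fun y hy => hy.1) ⟨x₀, hx₀, rfl⟩ ⟨x, hx, fun h => hne h.2⟩
        exact h.side a (Or.inr ha) c (Or.inr hc) (fun e => hck ⟨hc, e ▸ hak⟩) (hk a ha) (hk c hc)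
          hac
      have hD : ∀ x ∈ Γ, x ∉ Δ := fun x hx hx' => (hΓΔ x hx x hx').1 rfl
      have hfib := ih (π x₀) {x ∈ Γ | π x = π x₀} (by
          ext x
          have := hπ x
          simp only [Set.mem_union, Set.mem_ofPred_eq]
          tauto) (hΓH.mono (fun x hx => hx.1) subset_rfl)
        (hΓW.mono (fun x hx => hx.1) subset_rfl)
      refine Pr.prime P hP hcard (Γ ∪ Δ) (fun x => if x ∈ Δ then π x₀ else π x)
        (fun x => if x ∈ Δ then none else k x) ⟨?_, ?_, ?_⟩ ?_ ?_
      · rintro x (hx | hx) y (hy | hy) hxy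
        · rw [if_neg (hD x hx), if_neg (hD y hy)] at hxy
          exact h.kind x (Or.inl hx) y (Or.inl hy) hxy
        · exact (hΓΔ x hx y hy).2
        · exact (hΓΔ.symm x hx y hy).2
        · rw [if_pos hx, if_pos hy] at hxy
          exact absurd rfl hxy
      · rintro x (hx | hx) y (hy | hy) hxy
        · rw [if_neg (hD x hx), if_neg (hD y hy)] at hxy ⊢
          exact h.side x (Or.inl hx) y (Or.inl hy) hxy
        · exact fun _ _ => (hΓΔ x hx y hy).2
        · exact fun _ _ => (hΓΔ.symm x hx y hy).2
        · rw [if_pos hx, if_pos hy] at hxy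
          exact absurd rfl hxy
      · rintro x (hx | hx) y (hy | hy) b hxy hxb hyb
        · rw [if_neg (hD x hx), if_neg (hD y hy)] at hxy ⊢
          rw [if_neg (hD x hx)] at hxb
          rw [if_neg (hD y hy)] at hyb
          exact h.adj x (Or.inl hx) y (Or.inl hy) b hxy hxb hyb
        · simp [hy] at hyb
        · simp [hx] at hxb
        · simp [hx] at hxb
      · intro i b
        obtain ⟨x, hx, hxi, hxb⟩ := hcell i b
        have hxΓ : x ∈ Γ := hx.resolve_right fun h => by simp [hk x h] at hxb
        exact ⟨x, Or.inl hxΓ, by rw [if_neg (hD x hxΓ), hxi], by rw [if_neg (hD x hxΓ), hxb]⟩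
      · intro i
        by_cases hi : i = π x₀
        · convert hfib using 1
          ext x
          have := hD x
          simp only [Set.mem_union, Set.mem_ofPred_eq]
          grind
        · convert hS i using 1
          ext x
          have := hD x; have := hπ x
          simp only [Set.mem_union, Set.mem_ofPred_eq]
          grind
    | some b =>
      rw [hb] at hk
      have h' : ∃ P' : SimpleGraph ι, ∃ k' : G.Vert → Option Bool, IsPrimeGraph P' ∧
          G.Layered (Γ ∪ H) P' π k' ∧ (∀ i b, ∃ x ∈ Γ ∪ H, π x = i ∧ k' x = some b) ∧
          (∀ x ∈ H, k' x = some true) := by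
        cases b with
        | true => exact ⟨P, k, hP, h, hcell, hk⟩
        | false =>
          refine ⟨Pᶜ, _, hP.compl, h.compl, fun i b => ?_, fun x hx => ?_⟩
          · obtain ⟨x, hx, hxi, hxb⟩ := hcell i (!b)
            exact ⟨x, hx, hxi, by simp [hxb]⟩
          · simp [hk x hx]
      obtain ⟨P', k', hP', h, hcell, hk⟩ := h'
      refine goal Γ hΓH hΓW (.prime (P := P') (π := π) (k := k')
        ⟨inferInstance, hP', hcard, h, hcell, hS, fun x hx => ⟨hk x, fun hxk => ?_⟩⟩)
      have hstep : ∀ a ∈ H, ∀ b ∈ Γ ∪ H, k' b = some true → P'.Adj (π a) (π b) → b ∈ H := by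
        intro a ha b hb hkb hab
        by_contra hbH
        have := (h.adj a (Or.inr ha) b hb true hab.ne (hk a ha) hkb).2 (by simpa using hab)
        exact (hΓH b (hb.resolve_right hbH) a ha).2 this.symm
      have hall : ∀ i, ∃ a ∈ H, π a = i := by
        by_contra! hcon
        obtain ⟨i, hi⟩ := hcon
        obtain ⟨_, ⟨a, ha, rfl⟩, j, hj, hij⟩ := hP'.connected hcard (π '' H) ⟨_, x₀, hx₀, rfl⟩
          ⟨i, fun ⟨a, ha, hai⟩ => hi a ha hai⟩
        obtain ⟨b, hb, hbj, hbk⟩ := hcell j true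
        exact hj ⟨b, hstep a ha b hb hbk (by rwa [hbj]), hbj⟩
      have : Nontrivial ι := Finite.one_lt_card_iff_nontrivial.1 (by omega)
      obtain ⟨i, hi⟩ := exists_ne (π x)
      obtain ⟨_, rfl, j, hj, hij⟩ := hP'.connected hcard {π x} (by simp) ⟨i, hi⟩
      obtain ⟨a, ha, rfl⟩ := hall j
      exact hstep a ha x hx hxk hij.symm

end LGraph

namespace LGraph

variable {V : Type u} {n : ℕ} {G : LGraph V} {Γ Δ H H' : Set G.Vert} {e e' : G.Vert → G.Vert}

theorem IsDual.disjoint_image (h : G.IsDual H H' e e') {A B : Set G.Vert} (hA : A ⊆ H)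
    (hB : B ⊆ H) (hAB : Disjoint A B) : Disjoint (e '' A) (e '' B) := by
  rw [Set.disjoint_left] at hAB ⊢
  rintro _ ⟨x, hx, rfl⟩ ⟨y, hy, hyx⟩
  exact hAB hx (h.inj (hB hy) (hA hx) hyx ▸ hy)

/-- A cut on a part `K` of `H`. -/
theorem CutData.cut_sub (hcut : ∀ m < n, CutAt V m) (cd : G.CutData Γ Δ H H' e e')
    {K A B : Set G.Vert} (hK : K ⊆ H) (hn : K.ncard < n) (hAB : G.Sep A B)
    (hAH : G.Sep A H) (hBH' : G.Sep B H') (hAH' : G.Sep A H') (hBH : G.Sep B H)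
    (h₁ : Pr G (A ∪ K)) (h₂ : Pr G (B ∪ e '' K)) : Pr G (A ∪ B) :=
  have hK' := cd.dual.image_subset hK
  hcut _ hn G A B K (e '' K) e e'
    ⟨cd.dual.sub hK, hAB, hAH.mono subset_rfl hK, hBH'.mono subset_rfl hK',
      hAH'.mono subset_rfl hK', hBH.mono subset_rfl hK, cd.sepHH'.mono hK hK'⟩ rfl h₁ h₂

theorem WeakIntro.subset_left {G : LGraph V} {Γ H Γ₁ Γ₂ M : Set G.Vert}
    (h : G.WeakIntro Γ H Γ₁ Γ₂ M) : Γ₁ ⊆ Γ := by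
  rw [h.union]; exact Set.subset_union_left

theorem WeakIntro.subset_right {G : LGraph V} {Γ H Γ₁ Γ₂ M : Set G.Vert}
    (h : G.WeakIntro Γ H Γ₁ Γ₂ M) : Γ₂ ⊆ Γ := by
  rw [h.union]; exact Set.subset_union_right

theorem ncard_lt_of_sdiff {A B : Set G.Vert} (h : A ⊆ B) (h' : (B \ A).Nonempty) :
    A.ncard < B.ncard := by
  obtain ⟨x, hx, hxA⟩ := h'
  exact Set.ncard_lt_ncard (h.ssubset_of_ne fun e => hxA (e ▸ hx)) B.toFinite

theorem ncard_image_lt (cd : G.CutData Γ Δ H H' e e') {K : Set G.Vert} (hK : K ⊆ H)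
    (hn : K.ncard < n) : (e '' K).ncard < n := by
  rwa [(cd.dual.inj.mono hK).ncard_image]

theorem weak_weak_disjoint (hcut : ∀ m < n, CutAt V m) (cd : G.CutData Γ Δ H H' e e')
    (hn : H.ncard = n) {Γ₁ Γ₂ Δ₁ Δ₂ M N : Set G.Vert} (h : G.WeakIntro Γ H Γ₁ Γ₂ M)
    (h' : G.WeakIntro Δ H' Δ₁ Δ₂ (e '' N)) (hN : N ⊆ H) (hNmod : G.IsMod (H \ N) N)
    (hMN : Disjoint M N) : Pr G (Γ ∪ Δ) := by
  have hΓ₁ := h.subset_left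
  have hΓ₂ := h.subset_right
  have hΔ₁ := h'.subset_left
  have hΔ₂ := h'.subset_right
  have hM := h.sub
  rw [Set.disjoint_left] at hMN
  have hF : H \ (M ∪ N) ⊆ H := Set.sdiff_subset
  have hMH' := cd.dual.image_subset hM
  have hNH' := cd.dual.image_subset hN
  have hFH' := cd.dual.image_subset hF
  have hlt : (H \ M).ncard < n := by
    rw [← hn]
    obtain ⟨x, hx⟩ := h.nonempty
    exact ncard_lt_of_sdiff Set.sdiff_subset ⟨x, hM hx, fun h => h.2 hx⟩
  have hlt' : (H \ N).ncard < n := by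
    rw [← hn]
    obtain ⟨_, x, hx, rfl⟩ := h'.nonempty
    exact ncard_lt_of_sdiff Set.sdiff_subset ⟨x, hN hx, fun h => h.2 hx⟩
  have e1 : H \ (M ∪ N) ∪ N = H \ M := by
    ext x; have := @hMN x; have := @hN x
    simp only [Set.mem_union, Set.mem_sdiff]; tauto
  have e2 : H \ (M ∪ N) ∪ M = H \ N := by
    ext x; have := @hMN x; have := @hM x
    simp only [Set.mem_union, Set.mem_sdiff]; tauto
  have s1 : Pr G (Γ₂ ∪ (Δ₁ ∪ (H \ (M ∪ N) ∪ ∅))) := by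
    refine deep_cut hcut (cd.dual.sub hN) (by rwa [e1]) ?_ (Set.disjoint_empty _) ?_
      (cd.sepΓH.mono hΓ₂ hF) (cd.sepΓH.mono hΓ₂ hN) (cd.sepΓΔ.mono hΓ₂ hΔ₁) sep_empty_right
      (cd.sepΔH.mono hΔ₁ hF) sep_empty_right (cd.sepΔH'.mono hΔ₁ hNH') sep_empty_left
      (by rw [e1]; exact h.pr') (by rw [Set.union_empty]; exact h'.pr)
    · exact Set.disjoint_left.2 fun x hx hx' => hx.2 (Or.inr hx')
    · rw [Set.union_empty]
      exact hNmod.mono (fun x hx => ⟨hx.1, fun h => hx.2 (Or.inr h)⟩) subset_rfl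
  have s2 : Pr G (Δ₂ ∪ (Γ₁ ∪ (e '' (H \ (M ∪ N)) ∪ ∅))) := by
    refine deep_cut hcut (cd.dual.sub hM).symm ?_ ?_ (Set.disjoint_empty _) ?_
      (cd.sepΔH'.mono hΔ₂ hFH') (cd.sepΔH'.mono hΔ₂ hMH') (cd.sepΓΔ.symm.mono hΔ₂ hΓ₁)
      sep_empty_right (cd.sepΓH'.mono hΓ₁ hFH') sep_empty_right (cd.sepΓH.mono hΓ₁ hM)
      sep_empty_left ?_ (by rw [Set.union_empty]; exact h.pr)
    · rw [← Set.image_union, e2]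
      exact ncard_image_lt cd Set.sdiff_subset hlt'
    · refine cd.dual.disjoint_image hF hM ?_
      exact Set.disjoint_left.2 fun x hx hx' => hx.2 (Or.inl hx')
    · rw [Set.union_empty]
      refine cd.dual.isMod hF hM (Set.disjoint_left.2 fun x hx hx' => hx.2 (Or.inl hx')) ?_
      exact h.isMod.mono (fun x hx => ⟨hx.1, fun h => hx.2 (Or.inl h)⟩) subset_rfl
    · rw [← Set.image_union, e2, cd.dual.image_diff hN]
      exact h'.pr'
  have := cd.cut_sub hcut (A := Γ₂ ∪ Δ₁) (B := Δ₂ ∪ Γ₁) hF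
    ((Set.ncard_le_ncard (by rw [← e1]; exact Set.subset_union_left)
      (Set.toFinite _)).trans_lt hlt)
    (((cd.sepΓΔ.mono hΓ₂ hΔ₂).union_right (h.sep.symm)).union_left
      (h'.sep.union_right (cd.sepΓΔ.symm.mono hΔ₁ hΓ₁)))
    ((cd.sepΓH.mono hΓ₂ subset_rfl).union_left (cd.sepΔH.mono hΔ₁ subset_rfl))
    ((cd.sepΔH'.mono hΔ₂ subset_rfl).union_left (cd.sepΓH'.mono hΓ₁ subset_rfl))
    ((cd.sepΓH'.mono hΓ₂ subset_rfl).union_left (cd.sepΔH'.mono hΔ₁ subset_rfl))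
    ((cd.sepΔH.mono hΔ₂ subset_rfl).union_left (cd.sepΓH.mono hΓ₁ subset_rfl))
    (by rwa [Set.union_empty, ← Set.union_assoc] at s1)
    (by rwa [Set.union_empty, ← Set.union_assoc] at s2)
  convert this using 1
  rw [h.union, h'.union]
  ext x; simp only [Set.mem_union]; tauto

theorem weak_weak_nested (hcut : ∀ m < n, CutAt V m) (cd : G.CutData Γ Δ H H' e e')
    (hn : H.ncard = n) {Γ₁ Γ₂ Δ₁ Δ₂ M N : Set G.Vert} (h : G.WeakIntro Γ H Γ₁ Γ₂ M)
    (h' : G.WeakIntro Δ H' Δ₁ Δ₂ (e '' N)) (hNmod : G.IsMod (H \ N) N)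
    (hNM : N ⊆ M) : Pr G (Γ ∪ Δ) := by
  have hΓ₁ := h.subset_left
  have hΓ₂ := h.subset_right
  have hΔ₁ := h'.subset_left
  have hΔ₂ := h'.subset_right
  have hM := h.sub
  have hN := hNM.trans hM
  have hA : M \ N ⊆ H := Set.sdiff_subset.trans hM
  have hF : H \ M ⊆ H := Set.sdiff_subset
  have hNH' := cd.dual.image_subset hN
  have hAH' := cd.dual.image_subset hA
  have hFH' := cd.dual.image_subset hF
  have hlt : M.ncard < n := by
    rw [← hn]
    exact ncard_lt_of_sdiff hM h.nonempty'
  have hlt' : (H \ N).ncard < n := by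
    rw [← hn]
    obtain ⟨_, x, hx, rfl⟩ := h'.nonempty
    exact ncard_lt_of_sdiff Set.sdiff_subset ⟨x, hN hx, fun h => h.2 hx⟩
  have e1 : M \ N ∪ N = M := Set.sdiff_union_of_subset hNM
  have e2 : H \ M ∪ M \ N = H \ N := by
    ext x; have := @hNM x; have := @hM x
    simp only [Set.mem_union, Set.mem_sdiff]; tauto
  have s1 : Pr G (Γ₁ ∪ (Δ₁ ∪ (M \ N ∪ ∅))) := by
    refine deep_cut hcut (cd.dual.sub hN) (by rwa [e1]) Set.disjoint_sdiff_left
      (Set.disjoint_empty _) ?_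
      (cd.sepΓH.mono hΓ₁ hA) (cd.sepΓH.mono hΓ₁ hN) (cd.sepΓΔ.mono hΓ₁ hΔ₁) sep_empty_right
      (cd.sepΔH.mono hΔ₁ hA) sep_empty_right (cd.sepΔH'.mono hΔ₁ hNH') sep_empty_left
      (by rw [e1]; exact h.pr) (by rw [Set.union_empty]; exact h'.pr)
    rw [Set.union_empty]
    exact hNmod.mono (fun x hx => ⟨hM hx.1, hx.2⟩) subset_rfl
  have s2 : Pr G (Δ₂ ∪ ((Γ₁ ∪ Δ₁) ∪ (e '' (H \ M) ∪ ∅))) := by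
    refine deep_cut hcut (cd.dual.sub hA).symm ?_ ?_ (Set.disjoint_empty _) ?_
      (cd.sepΔH'.mono hΔ₂ hFH') (cd.sepΔH'.mono hΔ₂ hAH')
      ((cd.sepΓΔ.symm.mono hΔ₂ hΓ₁).union_right h'.sep.symm)
      sep_empty_right ((cd.sepΓH'.mono hΓ₁ hFH').union_left (cd.sepΔH'.mono hΔ₁ hFH'))
      sep_empty_right ((cd.sepΓH.mono hΓ₁ hA).union_left (cd.sepΔH.mono hΔ₁ hA))
      sep_empty_left ?_ (by
        rw [Set.union_empty] at s1 ⊢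
        rwa [Set.union_assoc])
    · rw [← Set.image_union, e2]
      exact ncard_image_lt cd Set.sdiff_subset hlt'
    · refine cd.dual.disjoint_image hF hA ?_
      exact Set.disjoint_left.2 fun x hx hx' => hx.2 hx'.1
    · rw [Set.union_empty]
      refine cd.dual.isMod hF hA (Set.disjoint_left.2 fun x hx hx' => hx.2 hx'.1) ?_
      exact h.isMod.mono subset_rfl Set.sdiff_subset
    · rw [← Set.image_union, e2, cd.dual.image_diff hN]
      exact h'.pr'
  have := cd.cut_sub hcut (A := Γ₂) (B := Δ₂ ∪ (Γ₁ ∪ Δ₁)) hF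
    ((Set.ncard_le_ncard (by rw [← e2]; exact Set.subset_union_left)
      (Set.toFinite _)).trans_lt hlt')
    ((cd.sepΓΔ.mono hΓ₂ hΔ₂).union_right (h.sep.symm.union_right (cd.sepΓΔ.mono hΓ₂ hΔ₁)))
    (cd.sepΓH.mono hΓ₂ subset_rfl)
    ((cd.sepΔH'.mono hΔ₂ subset_rfl).union_left
      ((cd.sepΓH'.mono hΓ₁ subset_rfl).union_left (cd.sepΔH'.mono hΔ₁ subset_rfl)))
    (cd.sepΓH'.mono hΓ₂ subset_rfl)
    ((cd.sepΔH.mono hΔ₂ subset_rfl).union_left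
      ((cd.sepΓH.mono hΓ₁ subset_rfl).union_left (cd.sepΔH.mono hΔ₁ subset_rfl)))
    h.pr' (by rwa [Set.union_empty, ← Set.union_assoc] at s2)
  convert this using 1
  rw [h.union, h'.union]
  ext x; simp only [Set.mem_union]; tauto

theorem weak_weak_overlap (hcut : ∀ m < n, CutAt V m) (cd : G.CutData Γ Δ H H' e e')
    (hn : H.ncard = n) {Γ₁ Γ₂ Δ₁ Δ₂ M N : Set G.Vert} (h : G.WeakIntro Γ H Γ₁ Γ₂ M)
    (h' : G.WeakIntro Δ H' Δ₁ Δ₂ (e '' N)) (hN : N ⊆ H) (hNmod : G.IsMod (H \ N) N)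
    (hne : (M ∩ N).Nonempty)
    (hsep : ∀ x ∈ M \ N, ∀ y ∈ M ∩ N, ¬ G.graph.Adj x y) : Pr G (Γ ∪ Δ) := by
  have hΓ₁ := h.subset_left
  have hΓ₂ := h.subset_right
  have hΔ₁ := h'.subset_left
  have hΔ₂ := h'.subset_right
  have hM := h.sub
  have hA : M \ N ⊆ H := Set.sdiff_subset.trans hM
  have hB : M ∩ N ⊆ H := Set.inter_subset_left.trans hM
  have hD : N \ M ⊆ H := Set.sdiff_subset.trans hN
  have hF : H \ (M ∪ N) ⊆ H := Set.sdiff_subset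
  have hBH' := cd.dual.image_subset hB
  have hDH' := cd.dual.image_subset hD
  have hAH' := cd.dual.image_subset hA
  have hFH' := cd.dual.image_subset hF
  have hlt : (H \ M).ncard < n := by
    rw [← hn]
    obtain ⟨x, hx⟩ := h.nonempty
    exact ncard_lt_of_sdiff Set.sdiff_subset ⟨x, hM hx, fun h => h.2 hx⟩
  have hlt' : (H \ N).ncard < n := by
    rw [← hn]
    obtain ⟨_, x, hx, rfl⟩ := h'.nonempty
    exact ncard_lt_of_sdiff Set.sdiff_subset ⟨x, hN hx, fun h => h.2 hx⟩
  have hltN : (e '' N).ncard < n := by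
    rw [← hn, ← cd.dual.ncard_eq]
    exact ncard_lt_of_sdiff h'.sub h'.nonempty'
  have e1 : N \ M ∪ M ∩ N = N := by
    ext x; simp only [Set.mem_union, Set.mem_sdiff, Set.mem_inter_iff]; tauto
  have e2 : M \ N ∪ M ∩ N = M := by
    ext x; simp only [Set.mem_union, Set.mem_sdiff, Set.mem_inter_iff]; tauto
  have e3 : H \ (M ∪ N) ∪ N \ M = H \ M := by
    ext x; have := @hN x; simp only [Set.mem_union, Set.mem_sdiff]; tauto
  have e4 : H \ (M ∪ N) ∪ M \ N = H \ N := by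
    ext x; have := @hM x; simp only [Set.mem_union, Set.mem_sdiff]; tauto
  have s1 : Pr G (Δ₁ ∪ ((Γ₁ ∪ M \ N) ∪ (e '' (N \ M) ∪ ∅))) := by
    refine deep_cut hcut (cd.dual.sub hB).symm ?_ ?_ (Set.disjoint_empty _) ?_
      (cd.sepΔH'.mono hΔ₁ hDH') (cd.sepΔH'.mono hΔ₁ hBH')
      ((cd.sepΓΔ.symm.mono hΔ₁ hΓ₁).union_right (cd.sepΔH.mono hΔ₁ hA)) sep_empty_right
      ((cd.sepΓH'.mono hΓ₁ hDH').union_left (cd.sepHH'.mono hA hDH')) sep_empty_right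
      ((cd.sepΓH.mono hΓ₁ hB).union_left ?_) sep_empty_left ?_ ?_
    · rwa [← Set.image_union, e1]
    · refine cd.dual.disjoint_image hD hB ?_
      exact Set.disjoint_left.2 fun x hx hx' => hx.2 hx'.1
    · rw [Set.union_empty]
      refine cd.dual.isMod hD hB (Set.disjoint_left.2 fun x hx hx' => hx.2 hx'.1) ?_
      exact h.isMod.mono (fun x hx => ⟨hN hx.1, hx.2⟩) Set.inter_subset_left
    · exact fun x hx y hy => ⟨fun e => hx.2 (e ▸ hy.2), hsep x hx y hy⟩
    · rw [← Set.image_union, e1]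
      exact h'.pr
    · rw [Set.union_empty, Set.union_assoc, e2]
      exact h.pr
  have s2 : Pr G (Γ₂ ∪ ((Δ₁ ∪ Γ₁) ∪ (H \ (M ∪ N) ∪ M \ N))) := by
    refine deep_cut hcut (cd.dual.sub hD) (by rwa [e3]) ?_ ?_ ?_
      (cd.sepΓH.mono hΓ₂ hF) (cd.sepΓH.mono hΓ₂ hD)
      ((cd.sepΓΔ.mono hΓ₂ hΔ₁).union_right h.sep.symm) (cd.sepΓH.mono hΓ₂ hA)
      ((cd.sepΔH.mono hΔ₁ hF).union_left (cd.sepΓH.mono hΓ₁ hF))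
      ((cd.sepΔH.mono hΔ₁ hA).union_left (cd.sepΓH.mono hΓ₁ hA))
      ((cd.sepΔH'.mono hΔ₁ hDH').union_left (cd.sepΓH'.mono hΓ₁ hDH'))
      (cd.sepHH'.mono hA hDH') (by rw [e3]; exact h.pr') ?_
    · exact Set.disjoint_left.2 fun x hx hx' => hx.2 (Or.inr hx'.1)
    · exact Set.disjoint_left.2 fun x hx hx' => hx.2 (Or.inl hx'.1)
    · obtain ⟨b, hbM, hbN⟩ := hne
      rintro x ⟨hx, hxMN⟩
      have hxM : x ∈ H \ M := ⟨hx, fun h => hxMN (Or.inl h)⟩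
      have hxN : x ∈ H \ N := ⟨hx, fun h => hxMN (Or.inr h)⟩
      have key : ∀ y ∈ N \ M ∪ M \ N, G.graph.Adj x y ↔ G.graph.Adj x b := by
        rintro y (hy | hy)
        · exact ⟨hNmod x hxN y hy.1 b hbN, hNmod x hxN b hbN y hy.1⟩
        · exact ⟨h.isMod x hxM y hy.1 b hbM, h.isMod x hxM b hbM y hy.1⟩
      intro y hy z hz
      rw [key y hy, key z hz]
      exact id
    · convert s1 using 1
      rw [Set.union_empty]
      ext x; simp only [Set.mem_union]; tauto
  have := cd.cut_sub hcut (A := Γ₂ ∪ (Δ₁ ∪ Γ₁)) (B := Δ₂) (K := H \ N) Set.sdiff_subset hlt'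
    ((cd.sepΓΔ.mono hΓ₂ hΔ₂).union_left (h'.sep.union_left (cd.sepΓΔ.mono hΓ₁ hΔ₂)))
    ((cd.sepΓH.mono hΓ₂ subset_rfl).union_left
      ((cd.sepΔH.mono hΔ₁ subset_rfl).union_left (cd.sepΓH.mono hΓ₁ subset_rfl)))
    (cd.sepΔH'.mono hΔ₂ subset_rfl)
    ((cd.sepΓH'.mono hΓ₂ subset_rfl).union_left
      ((cd.sepΔH'.mono hΔ₁ subset_rfl).union_left (cd.sepΓH'.mono hΓ₁ subset_rfl)))
    (cd.sepΔH.mono hΔ₂ subset_rfl)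
    (by rwa [e4, ← Set.union_assoc] at s2) (by rw [cd.dual.image_diff hN]; exact h'.pr')
  convert this using 1
  rw [h.union, h'.union]
  ext x; simp only [Set.mem_union]; tauto

theorem weak_weak (hcut : ∀ m < n, CutAt V m) (cd : G.CutData Γ Δ H H' e e')
    (hn : H.ncard = n) {Γ₁ Γ₂ Δ₁ Δ₂ M M' : Set G.Vert} (h : G.WeakIntro Γ H Γ₁ Γ₂ M)
    (h' : G.WeakIntro Δ H' Δ₁ Δ₂ M') : Pr G (Γ ∪ Δ) := by
  obtain ⟨N, hN, rfl⟩ : ∃ N ⊆ H, M' = e '' N :=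
    ⟨e' '' M', cd.symm.dual.image_subset h'.sub, (cd.dual.symm.image_image h'.sub).symm⟩
  have hNmod : G.IsMod (H \ N) N := by
    have := cd.dual.symm.isMod Set.sdiff_subset h'.sub Set.disjoint_sdiff_left h'.isMod
    rwa [← cd.dual.image_diff hN, cd.dual.image_image hN,
      cd.dual.image_image Set.sdiff_subset] at this
  have hM := h.sub
  have hn' : H'.ncard = n := by rw [cd.dual.ncard_eq, hn]
  have h₂ : G.WeakIntro Γ H Γ₁ Γ₂ (e' '' (e '' M)) := by
    rwa [cd.dual.image_image hM]
  have hMmod' : G.IsMod (H' \ e '' M) (e '' M) := by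
    rw [← cd.dual.image_diff hM]
    exact cd.dual.isMod Set.sdiff_subset hM Set.disjoint_sdiff_left h.isMod
  rcases Set.eq_empty_or_nonempty (M ∩ N) with hdisj | hB
  · exact weak_weak_disjoint hcut cd hn h h' hN hNmod (Set.disjoint_iff_inter_eq_empty.2 hdisj)
  rcases Set.eq_empty_or_nonempty (M \ N) with hA | hA
  · rw [Set.union_comm]
    refine weak_weak_nested hcut cd.symm hn' h' h₂ hMmod' ?_
    exact Set.image_mono (Set.sdiff_eq_empty.1 hA)
  rcases Set.eq_empty_or_nonempty (N \ M) with hD | hD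
  · exact weak_weak_nested hcut cd hn h h' hNmod (Set.sdiff_eq_empty.1 hD)
  by_cases hsep : ∀ x ∈ M \ N, ∀ y ∈ M ∩ N, ¬ G.graph.Adj x y
  · exact weak_weak_overlap hcut cd hn h h' hN hNmod hB hsep
  push Not at hsep
  obtain ⟨a, ⟨haM, haN⟩, b, ⟨hbM, hbN⟩, hab⟩ := hsep
  rw [Set.union_comm]
  refine weak_weak_overlap hcut cd.symm hn' h' h₂ (cd.dual.image_subset hM) hMmod' ?_ ?_
  · exact ⟨e b, ⟨b, hbN, rfl⟩, ⟨b, hbM, rfl⟩⟩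
  · rintro _ ⟨⟨x, hx, rfl⟩, hxM⟩ _ ⟨⟨y, hy, rfl⟩, hyM⟩
    have hxM' : x ∉ M := fun h => hxM ⟨x, h, rfl⟩
    have hyM' : y ∈ M := by
      obtain ⟨z, hz, hzy⟩ := hyM
      rwa [← cd.dual.inj (hM hz) (hN hy) hzy]
    rw [cd.dual.adj x (hN hx) y (hN hy) (fun h => hxM' (h ▸ hyM')), not_not]
    have hax := hNmod a ⟨hM haM, haN⟩ b hbN x hx hab
    exact h.isMod x ⟨hN hx, hxM'⟩ a haM y hyM' hax.symm

end LGraph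

namespace LGraph

variable {V : Type u} {n : ℕ} {G : LGraph V} {Γ Δ H H' : Set G.Vert} {e e' : G.Vert → G.Vert}

/-- A nonempty proper module of a component introduced by the prime rule lies in a single fibre. -/
theorem PrimeIntro.module_sub_fibre {ι : Type} {P : SimpleGraph ι} {π : G.Vert → ι}
    {k : G.Vert → Option Bool} (h : G.PrimeIntro Γ H P π k) {N : Set G.Vert} (hN : N ⊆ H)
    (hne : N.Nonempty) (hne' : (H \ N).Nonempty) (hmod : G.IsMod (H \ N) N) :
    ∃ i, ∀ x ∈ N, π x = i := by
  have := h.finite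
  have hcard := h.card
  have hH : ∀ x ∈ H, x ∈ Γ ∪ H ∧ k x = some true := fun x hx =>
    ⟨Or.inr hx, (h.mem_iff x (Or.inr hx)).1 hx⟩
  have hcell : ∀ i, ∃ x ∈ H, π x = i := fun i => by
    obtain ⟨x, hx, hxi, hxk⟩ := h.cells i true
    exact ⟨x, (h.mem_iff x hx).2 hxk, hxi⟩
  have hadj : ∀ x ∈ H, ∀ y ∈ H, π x ≠ π y → (G.graph.Adj x y ↔ P.Adj (π x) (π y)) := by
    intro x hx y hy hxy
    rw [h.layered.adj x (hH x hx).1 y (hH y hy).1 true hxy (hH x hx).2 (hH y hy).2]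
    simp
  have hJ : IsModule P (π '' N) := by
    rintro v hv _ ⟨x, hx, rfl⟩ _ ⟨y, hy, rfl⟩
    obtain ⟨w, hw, rfl⟩ := hcell v
    have hwN : w ∉ N := fun h => hv ⟨w, h, rfl⟩
    rw [← hadj w hw x (hN hx) fun e => hv ⟨x, hx, e.symm⟩,
      ← hadj w hw y (hN hy) fun e => hv ⟨y, hy, e.symm⟩]
    exact ⟨hmod w ⟨hw, hwN⟩ x hx y hy, hmod w ⟨hw, hwN⟩ y hy x hx⟩
  rcases h.isPrime.2 _ hJ with h1 | ⟨i, hi⟩ | h1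
  · exact absurd (Set.image_eq_empty.1 h1) hne.ne_empty
  · exact ⟨i, fun x hx => Set.mem_singleton_iff.1 (hi ▸ ⟨x, hx, rfl⟩)⟩
  · exfalso
    obtain ⟨x, hxH, hxN⟩ := hne'
    have hJ' : IsModule P {π x}ᶜ := by
      intro v hv a ha b hb
      obtain rfl : v = π x := by simpa using hv
      obtain ⟨y, hy, rfl⟩ : a ∈ π '' N := h1 ▸ trivial
      obtain ⟨z, hz, rfl⟩ : b ∈ π '' N := h1 ▸ trivial
      rw [← hadj x hxH y (hN hy) fun e => ha e.symm, ← hadj x hxH z (hN hz) fun e => hb e.symm]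
      exact ⟨hmod x ⟨hxH, hxN⟩ y hy z hz, hmod x ⟨hxH, hxN⟩ z hz y hy⟩
    have hc := Set.ncard_add_ncard_compl {π x}
    rw [Set.ncard_singleton] at hc
    rcases h.isPrime.2 _ hJ' with h2 | ⟨i, hi⟩ | h2
    · rw [h2, Set.ncard_empty] at hc; omega
    · rw [hi, Set.ncard_singleton] at hc; omega
    · rw [h2, Set.ncard_univ] at hc; omega

theorem PrimeIntro.exists_cell {ι : Type} {P : SimpleGraph ι} {π : G.Vert → ι}
    {k : G.Vert → Option Bool} (h : G.PrimeIntro Γ H P π k) (i : ι) : ∃ x ∈ H, π x = i := by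
  obtain ⟨x, hx, hxi, hxk⟩ := h.cells i true
  exact ⟨x, (h.mem_iff x hx).2 hxk, hxi⟩

theorem PrimeIntro.exists_ne {ι : Type} {P : SimpleGraph ι} {π : G.Vert → ι}
    {k : G.Vert → Option Bool} (h : G.PrimeIntro Γ H P π k) (i j : ι) :
    ∃ x ∈ H, π x ≠ i ∧ π x ≠ j := by
  have := h.finite
  obtain ⟨l, hl⟩ : ∃ l, l ∉ ({i, j} : Set ι) := by
    by_contra! hcon
    have h1 : (Set.univ : Set ι).ncard ≤ 2 :=
      (Set.ncard_le_ncard (fun x _ => hcon x) (Set.toFinite _)).trans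
        ((Set.ncard_insert_le i {j}).trans (by simp))
    rw [Set.ncard_univ] at h1
    have := h.card
    omega
  obtain ⟨x, hx, rfl⟩ := h.exists_cell l
  exact ⟨x, hx, fun e => hl (Or.inl e), fun e => hl (Or.inr e)⟩

/-- The dual of a component introduced by the prime rule is connected. -/
theorem PrimeIntro.conn_dual {ι : Type} {P : SimpleGraph ι} {π : G.Vert → ι}
    {k : G.Vert → Option Bool} (h : G.PrimeIntro Γ H P π k) (hd : G.IsDual H H' e e') :
    G.Conn H' := by
  intro K' hK' hne hne'
  obtain ⟨K, hK, rfl⟩ : ∃ K ⊆ H, K' = e '' K :=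
    ⟨e' '' K', hd.symm.image_subset hK', (hd.symm.image_image hK').symm⟩
  rw [← hd.image_diff hK] at hne' ⊢
  by_contra! hcon
  have hadj : ∀ x ∈ K, ∀ y ∈ H \ K, G.graph.Adj x y := by
    intro x hx y hy
    have hxy : x ≠ y := fun h => hy.2 (h ▸ hx)
    by_contra h
    exact hcon (e x) ⟨x, hx, rfl⟩ (e y) ⟨y, hy, rfl⟩ ((hd.adj x (hK hx) y hy.1 hxy).2 h)
  have hKK : H \ (H \ K) = K := Set.sdiff_sdiff_cancel_left hK
  obtain ⟨i, hi⟩ := h.module_sub_fibre hK (Set.image_nonempty.1 hne) (Set.image_nonempty.1 hne')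
    fun x hx y _ z hz _ => (hadj z hz x hx).symm
  obtain ⟨j, hj⟩ := h.module_sub_fibre (N := H \ K) Set.sdiff_subset (Set.image_nonempty.1 hne')
    (by rw [hKK]; exact Set.image_nonempty.1 hne)
    (by rw [hKK]; exact fun x hx y _ z hz _ => hadj x hx z hz)
  obtain ⟨x, hx, hxi, hxj⟩ := h.exists_ne i j
  by_cases hxK : x ∈ K
  · exact hxi (hi x hxK)
  · exact hxj (hj x ⟨hx, hxK⟩)

/-- A cut on a component introduced by the weak rule whose dual is disconnected. -/
theorem weak_disconnected (hcut : ∀ m < n, CutAt V m) (cd : G.CutData Γ Δ H H' e e')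
    (hn : H.ncard = n) {Γ₁ Γ₂ M : Set G.Vert} (h : G.WeakIntro Γ H Γ₁ Γ₂ M)
    (hH' : ¬ G.Conn H') (hΔ : Pr G (Δ ∪ H')) : Pr G (Γ ∪ Δ) := by
  have hΓ₁ := h.subset_left
  have hΓ₂ := h.subset_right
  have hM := h.sub
  have hC : H \ M ⊆ H := Set.sdiff_subset
  have hCH' := cd.dual.image_subset hC
  have hMH' := cd.dual.image_subset hM
  have hltM : M.ncard < n := by
    rw [← hn]; exact ncard_lt_of_sdiff hM h.nonempty'
  have hltC : (H \ M).ncard < n := by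
    rw [← hn]
    obtain ⟨x, hx⟩ := h.nonempty
    exact ncard_lt_of_sdiff Set.sdiff_subset ⟨x, hM hx, fun h => h.2 hx⟩
  have e1 : H \ M ∪ M = H := Set.sdiff_union_of_subset hM
  have hH'eq : H' = e '' (H \ M) ∪ e '' M := by
    rw [← Set.image_union, e1, cd.dual.image_eq]
  -- it suffices to cut `M` against its dual
  have key : Pr G (Δ ∪ Γ₁ ∪ e '' (H \ M)) → Pr G (Γ ∪ Δ) := by
    intro hp
    have := cd.cut_sub hcut (A := Γ₂) (B := Δ ∪ Γ₁) hC hltC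
      ((cd.sepΓΔ.mono hΓ₂ subset_rfl).union_right h.sep.symm) (cd.sepΓH.mono hΓ₂ subset_rfl)
      (cd.sepΔH'.union_left (cd.sepΓH'.mono hΓ₁ subset_rfl)) (cd.sepΓH'.mono hΓ₂ subset_rfl)
      (cd.sepΔH.union_left (cd.sepΓH.mono hΓ₁ subset_rfl)) h.pr' hp
    convert this using 1
    rw [h.union]
    ext x; simp only [Set.mem_union]; tauto
  by_cases hfull : ∀ x ∈ H \ M, ∀ y ∈ M, G.graph.Adj x y
  · apply key
    have hsep : G.Sep (e '' (H \ M)) (e '' M) := by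
      rintro _ ⟨x, hx, rfl⟩ _ ⟨y, hy, rfl⟩
      have hxy : x ≠ y := fun h => hx.2 (h ▸ hy)
      refine ⟨fun h => hxy (cd.dual.inj hx.1 (hM hy) h), ?_⟩
      rw [cd.dual.adj x hx.1 y (hM hy) hxy, not_not]
      exact hfull x hx y hy
    have := hcut _ hltM G Γ₁ (Δ ∪ e '' (H \ M)) M (e '' M) e e'
      ⟨cd.dual.sub hM, (cd.sepΓΔ.mono hΓ₁ subset_rfl).union_right (cd.sepΓH'.mono hΓ₁ hCH'),
        cd.sepΓH.mono hΓ₁ hM, (cd.sepΔH'.mono subset_rfl hMH').union_left hsep,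
        cd.sepΓH'.mono hΓ₁ hMH',
        (cd.sepΔH.mono subset_rfl hM).union_left (cd.sepHH'.symm.mono hCH' hM),
        cd.sepHH'.mono hM hMH'⟩ rfl h.pr (by rwa [Set.union_assoc, ← hH'eq])
    convert this using 1
    ext x; simp only [Set.mem_union]; tauto
  -- a separation of `H'`
  simp only [Conn] at hH'
  push Not at hH'
  obtain ⟨K', hK', hne, hne', hKadj⟩ := hH'
  obtain ⟨K, hK, rfl⟩ : ∃ K ⊆ H, K' = e '' K :=
    ⟨e' '' K', cd.dual.symm.image_subset hK', (cd.dual.symm.image_image hK').symm⟩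
  rw [← cd.dual.image_diff hK] at hne' hKadj
  have hadj : ∀ x ∈ K, ∀ y ∈ H \ K, G.graph.Adj x y := by
    intro x hx y hy
    have hxy : x ≠ y := fun h => hy.2 (h ▸ hx)
    by_contra h
    exact hKadj (e x) ⟨x, hx, rfl⟩ (e y) ⟨y, hy, rfl⟩ ((cd.dual.adj x (hK hx) y hy.1 hxy).2 h)
  have hside : ∃ L ⊆ H, M ⊆ L ∧ (H \ L).Nonempty ∧ ∀ x ∈ L, ∀ y ∈ H \ L, G.graph.Adj x y := by
    push Not at hfull
    obtain ⟨x, ⟨hx, hxM⟩, y, hy, hxy⟩ := hfull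
    by_cases hMK : M ⊆ K
    · exact ⟨K, hK, hMK, Set.image_nonempty.1 hne', hadj⟩
    refine ⟨H \ K, Set.sdiff_subset, ?_, ?_, ?_⟩
    · obtain ⟨z, hz, hzK⟩ := Set.not_subset.1 hMK
      by_contra hMK'
      obtain ⟨w, hw, hwK⟩ := Set.not_subset.1 hMK'
      have hwK : w ∈ K := by
        by_contra h
        exact hwK ⟨hM hw, h⟩
      apply hxy
      by_cases hxK : x ∈ K
      · exact h.isMod x ⟨hx, hxM⟩ z hz y hy (hadj x hxK z ⟨hM hz, hzK⟩)
      · exact h.isMod x ⟨hx, hxM⟩ w hw y hy (hadj w hwK x ⟨hx, hxK⟩).symm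
    · rw [Set.sdiff_sdiff_cancel_left hK]
      exact Set.image_nonempty.1 hne
    · rw [Set.sdiff_sdiff_cancel_left hK]
      exact fun x hx y hy => (hadj y hy x hx).symm
  clear! K
  obtain ⟨L, hL, hML, hLne, hadj⟩ := hside
  apply key
  have hLM : L \ M ⊆ H := Set.sdiff_subset.trans hL
  have hR : H \ L ⊆ H := Set.sdiff_subset
  have hRH' := cd.dual.image_subset hR
  have hLMH' := cd.dual.image_subset hLM
  have hsep : ∀ A ⊆ L, G.Sep (e '' (H \ L)) (e '' A) := by
    rintro A hA _ ⟨x, hx, rfl⟩ _ ⟨y, hy, rfl⟩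
    have hxy : x ≠ y := fun h => hx.2 (h ▸ hA hy)
    refine ⟨fun h => hxy (cd.dual.inj hx.1 (hL (hA hy)) h), ?_⟩
    rw [cd.dual.adj x hx.1 y (hL (hA hy)) hxy, not_not]
    exact (hadj y (hA hy) x hx).symm
  have e2 : L \ M ∪ M = L := Set.sdiff_union_of_subset hML
  have e3 : H \ L ∪ L \ M = H \ M := by
    ext x; have := @hML x; have := @hL x
    simp only [Set.mem_union, Set.mem_sdiff]; tauto
  have s1 : Pr G ((Δ ∪ e '' (H \ L)) ∪ (Γ₁ ∪ (e '' (L \ M) ∪ ∅))) := by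
    refine deep_cut hcut (cd.dual.sub hM).symm ?_ ?_ (Set.disjoint_empty _) ?_
      ((cd.sepΔH'.mono subset_rfl hLMH').union_left (hsep _ Set.sdiff_subset))
      ((cd.sepΔH'.mono subset_rfl hMH').union_left (hsep _ hML))
      ((cd.sepΓΔ.symm.mono subset_rfl hΓ₁).union_left (cd.sepΓH'.symm.mono hRH' hΓ₁))
      sep_empty_right (cd.sepΓH'.mono hΓ₁ hLMH') sep_empty_right (cd.sepΓH.mono hΓ₁ hM)
      sep_empty_left ?_ (by rw [Set.union_empty]; exact h.pr)
    · rw [← Set.image_union, e2]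
      exact ncard_image_lt cd hL (by rw [← hn]; exact ncard_lt_of_sdiff hL hLne)
    · refine cd.dual.disjoint_image hLM hM ?_
      exact Set.disjoint_sdiff_left
    · rw [Set.union_empty]
      refine cd.dual.isMod hLM hM Set.disjoint_sdiff_left ?_
      exact h.isMod.mono (fun x hx => ⟨hL hx.1, hx.2⟩) subset_rfl
    · rw [Set.union_assoc, ← Set.image_union, ← Set.image_union, e2,
        Set.sdiff_union_of_subset hL, cd.dual.image_eq]
      exact hΔ
  rw [Set.union_empty] at s1
  rw [← e3, Set.image_union]
  convert s1 using 1
  ext x; simp only [Set.mem_union]; tauto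

/-- A cut between a component introduced by the prime rule and one introduced by the weak rule. -/
theorem prime_weak (hcut : ∀ m < n, CutAt V m) (cd : G.CutData Γ Δ H H' e e')
    (hn : H.ncard = n) {ι : Type} {P : SimpleGraph ι} {π : G.Vert → ι} {k : G.Vert → Option Bool}
    (h : G.PrimeIntro Γ H P π k) {Δ₁ Δ₂ M' : Set G.Vert} (h' : G.WeakIntro Δ H' Δ₁ Δ₂ M') :
    Pr G (Γ ∪ Δ) := by
  classical
  have := h.finite
  obtain ⟨N, hN, rfl⟩ : ∃ N ⊆ H, M' = e '' N :=
    ⟨e' '' M', cd.symm.dual.image_subset h'.sub, (cd.dual.symm.image_image h'.sub).symm⟩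
  have hNmod : G.IsMod (H \ N) N := by
    have := cd.dual.symm.isMod Set.sdiff_subset h'.sub Set.disjoint_sdiff_left h'.isMod
    rwa [← cd.dual.image_diff hN, cd.dual.image_image hN,
      cd.dual.image_image Set.sdiff_subset] at this
  have hne : N.Nonempty := Set.image_nonempty.1 h'.nonempty
  have hne' : (H \ N).Nonempty := by
    have := h'.nonempty'
    rw [← cd.dual.image_diff hN] at this
    exact Set.image_nonempty.1 this
  have hΔ₁ := h'.subset_left
  have hΔ₂ := h'.subset_right
  obtain ⟨i, hi⟩ := h.module_sub_fibre hN hne hne' hNmod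
  have hNH' := cd.dual.image_subset hN
  have hlt : (H \ N).ncard < n := by
    rw [← hn]
    obtain ⟨x, hx⟩ := hne
    exact ncard_lt_of_sdiff Set.sdiff_subset ⟨x, hN hx, fun h => h.2 hx⟩
  have hΔΓ : ∀ x ∈ Δ₁, ∀ y ∈ Γ ∪ H, x ≠ y ∧ ¬ G.graph.Adj x y := by
    rintro x hx y (hy | hy)
    · exact cd.sepΓΔ.symm x (hΔ₁ hx) y hy
    · exact cd.sepΔH x (hΔ₁ hx) y hy
  -- the dual of `N` is cut inside the fibre of `i`
  let F : Set G.Vert := {x ∈ H | π x = i} \ N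
  have hF : F ⊆ H := fun x hx => hx.1.1
  have hFN : F ∪ N = {x ∈ H | π x = i} := by
    refine Set.sdiff_union_of_subset fun x hx => ⟨hN hx, hi x hx⟩
  have s1 : Pr G ({x ∈ Γ | π x = i} ∪ (Δ₁ ∪ (F ∪ ∅))) := by
    have hsub : {x ∈ Γ | π x = i} ⊆ Γ := fun x hx => hx.1
    refine deep_cut hcut (cd.dual.sub hN) ?_ Set.disjoint_sdiff_left (Set.disjoint_empty _) ?_
      (cd.sepΓH.mono hsub hF) (cd.sepΓH.mono hsub hN) (cd.sepΓΔ.mono hsub hΔ₁) sep_empty_right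
      (cd.sepΔH.mono hΔ₁ hF) sep_empty_right (cd.sepΔH'.mono hΔ₁ hNH') sep_empty_left ?_
      (by rw [Set.union_empty]; exact h'.pr)
    · rw [hFN, ← hn]
      obtain ⟨x, hx, hxi, -⟩ := h.exists_ne i i
      exact ncard_lt_of_sdiff (fun x hx => hx.1) ⟨x, hx, fun h => hxi h.2⟩
    · rw [Set.union_empty]
      exact hNmod.mono (fun x hx => ⟨hx.1.1, hx.2⟩) subset_rfl
    · rw [hFN]
      convert h.fibres i using 1
      ext x; simp only [Set.mem_union, Set.mem_ofPred_eq]; tauto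
  have hD : ∀ x ∈ Γ ∪ H, x ∉ Δ₁ := fun x hx hx' => (hΔΓ x hx' x hx).1 rfl
  have s2 : Pr G ((Γ ∪ H \ N) ∪ Δ₁) := by
    have hsub : Γ ∪ H \ N ⊆ Γ ∪ H := Set.union_subset_union_right _ Set.sdiff_subset
    refine Pr.functor (P := P) (π := fun x => if x ∈ Δ₁ then i else π x)
      (k := fun x => if x ∈ Δ₁ then none else k x) ⟨?_, ?_, ?_⟩ ?_
    · rintro x (hx | hx) y (hy | hy) hxy
      · rw [if_neg (hD x (hsub hx)), if_neg (hD y (hsub hy))] at hxy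
        exact h.layered.kind x (hsub hx) y (hsub hy) hxy
      · exact fun hadj => (hΔΓ y hy x (hsub hx)).2 hadj.symm
      · exact (hΔΓ x hx y (hsub hy)).2
      · rw [if_pos hx, if_pos hy] at hxy
        exact absurd rfl hxy
    · rintro x (hx | hx) y (hy | hy) hxy
      · rw [if_neg (hD x (hsub hx)), if_neg (hD y (hsub hy))] at hxy ⊢
        exact h.layered.side x (hsub hx) y (hsub hy) hxy
      · exact fun _ _ hadj => (hΔΓ y hy x (hsub hx)).2 hadj.symm
      · exact fun _ _ => (hΔΓ x hx y (hsub hy)).2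
      · rw [if_pos hx, if_pos hy] at hxy
        exact absurd rfl hxy
    · rintro x (hx | hx) y (hy | hy) b hxy hxb hyb
      · rw [if_neg (hD x (hsub hx)), if_neg (hD y (hsub hy))] at hxy ⊢
        rw [if_neg (hD x (hsub hx))] at hxb
        rw [if_neg (hD y (hsub hy))] at hyb
        exact h.layered.adj x (hsub hx) y (hsub hy) b hxy hxb hyb
      · simp [hy] at hyb
      · simp [hx] at hxb
      · simp [hx] at hxb
    · intro j
      by_cases hj : j = i
      · subst hj
        convert s1 using 1
        ext x
        have := hD x
        simp only [Set.mem_union, Set.mem_ofPred_eq, F, Set.mem_sdiff, Set.mem_empty_iff_false]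
        simp only [Set.mem_union] at this
        grind
      · convert h.fibres j using 1
        ext x
        have hDx := hD x
        have := hi x
        simp only [Set.mem_union, Set.mem_ofPred_eq, Set.mem_sdiff]
        simp only [Set.mem_union] at hDx
        grind
  have := cd.cut_sub hcut (A := Γ ∪ Δ₁) (B := Δ₂) (K := H \ N) Set.sdiff_subset hlt
    ((cd.sepΓΔ.mono subset_rfl hΔ₂).union_left h'.sep)
    (cd.sepΓH.union_left (cd.sepΔH.mono hΔ₁ subset_rfl)) (cd.sepΔH'.mono hΔ₂ subset_rfl)
    (cd.sepΓH'.union_left (cd.sepΔH'.mono hΔ₁ subset_rfl)) (cd.sepΔH.mono hΔ₂ subset_rfl)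
    (by
      convert s2 using 1
      ext x; simp only [Set.mem_union]; tauto)
    (by rw [cd.dual.image_diff hN]; exact h'.pr')
  convert this using 1
  rw [h'.union]
  ext x; simp only [Set.mem_union]; tauto

theorem PrimeIntro.adj_iff {ι : Type} {P : SimpleGraph ι} {π : G.Vert → ι}
    {k : G.Vert → Option Bool} (h : G.PrimeIntro Γ H P π k) {x y : G.Vert} (hx : x ∈ H)
    (hy : y ∈ H) (hxy : π x ≠ π y) : G.graph.Adj x y ↔ P.Adj (π x) (π y) := by
  rw [h.layered.adj x (Or.inr hx) y (Or.inr hy) true hxy ((h.mem_iff x (Or.inr hx)).1 hx)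
    ((h.mem_iff y (Or.inr hy)).1 hy)]
  simp

/-- Fibres of a component introduced by the prime rule go to fibres of its dual, if that was also
introduced by the prime rule. -/
theorem PrimeIntro.map_fibre {ι ι' : Type} {P : SimpleGraph ι} {π : G.Vert → ι}
    {k : G.Vert → Option Bool} (h : G.PrimeIntro Γ H P π k) {P' : SimpleGraph ι'}
    {π' : G.Vert → ι'} {k' : G.Vert → Option Bool} (h' : G.PrimeIntro Δ H' P' π' k')
    (hd : G.IsDual H H' e e') (i : ι) : ∃ j, ∀ x ∈ H, π x = i → π' (e x) = j := by
  have hsub : {x ∈ H | π x = i} ⊆ H := fun x hx => hx.1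
  have hne : (H \ {x ∈ H | π x = i}).Nonempty := by
    obtain ⟨x, hx, hxi, -⟩ := h.exists_ne i i
    exact ⟨x, hx, fun h => hxi h.2⟩
  obtain ⟨x, hx, hxi⟩ := h.exists_cell i
  obtain ⟨j, hj⟩ := h'.module_sub_fibre (hd.image_subset hsub) (Set.Nonempty.image e ⟨x, hx, hxi⟩)
    (by rw [← hd.image_diff hsub]; exact hne.image e) (by
      rw [← hd.image_diff hsub]
      refine hd.isMod Set.sdiff_subset hsub Set.disjoint_sdiff_left ?_
      rintro a ⟨ha, hai⟩ b ⟨hb, hbi⟩ c ⟨hc, hci⟩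
      have hai : π a ≠ i := fun h => hai ⟨ha, h⟩
      rw [h.adj_iff ha hb (by rwa [hbi]), h.adj_iff ha hc (by rwa [hci]), hbi, hci]
      exact id)
  exact ⟨j, fun y hy hyi => hj _ ⟨y, ⟨hy, hyi⟩, rfl⟩⟩

/-- A cut between two components introduced by the prime rule. -/
theorem prime_prime (hcut : ∀ m < n, CutAt V m) (cd : G.CutData Γ Δ H H' e e')
    (hn : H.ncard = n) {ι ι' : Type} {P : SimpleGraph ι} {π : G.Vert → ι}
    {k : G.Vert → Option Bool} (h : G.PrimeIntro Γ H P π k) {P' : SimpleGraph ι'}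
    {π' : G.Vert → ι'} {k' : G.Vert → Option Bool} (h' : G.PrimeIntro Δ H' P' π' k') :
    Pr G (Γ ∪ Δ) := by
  classical
  have := h.finite
  choose f hf using h.map_fibre h' cd.dual
  choose g hg using h'.map_fibre h cd.symm.dual
  have hgf : ∀ i, g (f i) = i := by
    intro i
    obtain ⟨x, hx, hxi⟩ := h.exists_cell i
    rw [← hg (f i) (e x) (cd.dual.map x hx) (hf i x hx hxi), cd.dual.left x hx, hxi]
  have hfg : ∀ j, f (g j) = j := by
    intro j
    obtain ⟨x, hx, hxj⟩ := h'.exists_cell j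
    rw [← hf (g j) (e' x) (cd.dual.map' x hx) (hg j x hx hxj), cd.dual.right x hx, hxj]
  have hfinj : ∀ i j, f i = f j → i = j := fun i j hij => by rw [← hgf i, ← hgf j, hij]
  have hginj : ∀ i j, g i = g j → i = j := fun i j hij => by rw [← hfg i, ← hfg j, hij]
  have hPP : ∀ i j, i ≠ j → (P'.Adj (f i) (f j) ↔ ¬ P.Adj i j) := by
    intro i j hij
    obtain ⟨x, hx, rfl⟩ := h.exists_cell i
    obtain ⟨y, hy, rfl⟩ := h.exists_cell j
    rw [← h.adj_iff hx hy hij, ← cd.dual.adj x hx y hy (fun e => hij (e ▸ rfl)),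
      h'.adj_iff (cd.dual.map x hx) (cd.dual.map y hy), hf _ x hx rfl, hf _ y hy rfl]
    rw [hf _ x hx rfl, hf _ y hy rfl]
    exact fun e => hij (hfinj _ _ e)
  have hPP' : ∀ i j, i ≠ j → (P'.Adj i j ↔ ¬ P.Adj (g i) (g j)) := by
    intro i j hij
    rw [← hPP _ _ fun h => hij (hginj _ _ h), hfg, hfg]
  have hD : ∀ x ∈ Γ, x ∉ Δ := fun x hx hx' => (cd.sepΓΔ x hx x hx').1 rfl
  have hkΓ : ∀ x ∈ Γ, k x ≠ some true := fun x hx hk =>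
    (cd.sepΓH x hx x ((h.mem_iff x (Or.inl hx)).2 hk)).1 rfl
  have hkΔ : ∀ x ∈ Δ, k' x ≠ some true := fun x hx hk =>
    (cd.sepΔH' x hx x ((h'.mem_iff x (Or.inl hx)).2 hk)).1 rfl
  have hmap : ∀ (a : Option Bool) b, a.map not = some b ↔ a = some (!b) := by
    rintro (_ | _ | _) (_ | _) <;> simp
  refine Pr.functor (P := P) (π := fun x => if x ∈ Δ then g (π' x) else π x)
    (k := fun x => if x ∈ Δ then (k' x).map not else k x) ⟨?_, ?_, ?_⟩ ?_
  · rintro x (hx | hx) y (hy | hy) hxy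
    · rw [if_neg (hD x hx), if_neg (hD y hy)] at hxy
      exact h.layered.kind x (Or.inl hx) y (Or.inl hy) hxy
    · exact (cd.sepΓΔ x hx y hy).2
    · exact (cd.sepΓΔ.symm x hx y hy).2
    · rw [if_pos hx, if_pos hy] at hxy
      exact h'.layered.kind x (Or.inl hx) y (Or.inl hy) fun e => hxy (by rw [e])
  · rintro x (hx | hx) y (hy | hy) hxy
    · rw [if_neg (hD x hx), if_neg (hD y hy)] at hxy ⊢
      exact h.layered.side x (Or.inl hx) y (Or.inl hy) hxy
    · exact fun _ _ => (cd.sepΓΔ x hx y hy).2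
    · exact fun _ _ => (cd.sepΓΔ.symm x hx y hy).2
    · rw [if_pos hx, if_pos hy] at hxy ⊢
      intro hxk hyk
      exact h'.layered.side x (Or.inl hx) y (Or.inl hy) (fun e => hxy (by rw [e]))
        (by simpa using hxk) (by simpa [hy] using hyk)
  · rintro x (hx | hx) y (hy | hy) b hxy hxb hyb
    · rw [if_neg (hD x hx), if_neg (hD y hy)] at hxy ⊢
      rw [if_neg (hD x hx)] at hxb
      rw [if_neg (hD y hy)] at hyb
      exact h.layered.adj x (Or.inl hx) y (Or.inl hy) b hxy hxb hyb
    · rw [if_neg (hD x hx)] at hxb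
      rw [if_pos hy, hmap] at hyb
      have := hkΓ x hx; have := hkΔ y hy
      cases b <;> simp_all
    · rw [if_pos hx, hmap] at hxb
      rw [if_neg (hD y hy)] at hyb
      have := hkΓ y hy; have := hkΔ x hx
      cases b <;> simp_all
    · rw [if_pos hx, if_pos hy] at hxy ⊢
      rw [if_pos hx, hmap] at hxb
      rw [if_pos hy, hmap] at hyb
      have hne : π' x ≠ π' y := fun e => hxy (by rw [e])
      rw [h'.layered.adj x (Or.inl hx) y (Or.inl hy) _ hne hxb hyb, hPP' _ _ hne]
      cases b <;> simp
  · intro i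
    have hsubH : {x ∈ H | π x = i} ⊆ H := fun x hx => hx.1
    have hsubΓ : {x ∈ Γ | π x = i} ⊆ Γ := fun x hx => hx.1
    have hsubΔ : {x ∈ Δ | π' x = f i} ⊆ Δ := fun x hx => hx.1
    have := cd.cut_sub hcut hsubH ?_ (cd.sepΓΔ.mono hsubΓ hsubΔ)
      (cd.sepΓH.mono hsubΓ subset_rfl) (cd.sepΔH'.mono hsubΔ subset_rfl)
      (cd.sepΓH'.mono hsubΓ subset_rfl) (cd.sepΔH.mono hsubΔ subset_rfl) ?_ ?_
    · convert this using 1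
      ext x
      have := hD x
      have hgi : g (π' x) = i ↔ π' x = f i :=
        ⟨fun h => by rw [← h, hfg], fun h => by rw [h, hgf]⟩
      simp only [Set.mem_union, Set.mem_ofPred_eq]
      split_ifs <;> tauto
    · rw [← hn]
      obtain ⟨x, hx, hxi, -⟩ := h.exists_ne i i
      exact ncard_lt_of_sdiff hsubH ⟨x, hx, fun h => hxi h.2⟩
    · convert h.fibres i using 1
      ext x; simp only [Set.mem_union, Set.mem_ofPred_eq]; tauto
    · convert h'.fibres (f i) using 1
      have : e '' {x ∈ H | π x = i} = {x ∈ H' | π' x = f i} := by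
        ext y
        constructor
        · rintro ⟨x, ⟨hx, hxi⟩, rfl⟩
          exact ⟨cd.dual.map x hx, hf i x hx hxi⟩
        · rintro ⟨hy, hyi⟩
          refine ⟨e' y, ⟨cd.dual.map' y hy, ?_⟩, cd.dual.right y hy⟩
          rw [hg _ y hy hyi, hgf]
      rw [this]
      ext x; simp only [Set.mem_union, Set.mem_ofPred_eq]; tauto

theorem conn_or_conn_dual (hd : G.IsDual H H' e e') : G.Conn H ∨ G.Conn H' := by
  by_contra! hcon
  obtain ⟨h1, h2⟩ := hcon
  simp only [Conn] at h1 h2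
  push Not at h1 h2
  obtain ⟨K, hK, ⟨a, ha⟩, ⟨b, hb⟩, hKadj⟩ := h1
  obtain ⟨L', hL', hne, hne', hLadj⟩ := h2
  obtain ⟨L, hL, rfl⟩ : ∃ L ⊆ H, L' = e '' L :=
    ⟨e' '' L', hd.symm.image_subset hL', (hd.symm.image_image hL').symm⟩
  rw [← hd.image_diff hL] at hne' hLadj
  have hadj : ∀ x ∈ L, ∀ y ∈ H \ L, G.graph.Adj x y := by
    intro x hx y hy
    have hxy : x ≠ y := fun h => hy.2 (h ▸ hx)
    by_contra h
    exact hLadj (e x) ⟨x, hx, rfl⟩ (e y) ⟨y, hy, rfl⟩ ((hd.adj x (hL hx) y hy.1 hxy).2 h)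
  obtain ⟨c, hc⟩ := Set.image_nonempty.1 hne
  obtain ⟨d, hd⟩ := Set.image_nonempty.1 hne'
  have key : ∀ x ∈ K, ∀ y ∈ H \ K, (x ∈ L ↔ y ∈ L) := by
    refine fun x hx y hy => ⟨fun hxL => ?_, fun hyL => ?_⟩ <;> by_contra h
    · exact hKadj x hx y hy (hadj x hxL y ⟨hy.1, h⟩)
    · exact hKadj x hx y hy (hadj y hyL x ⟨hK hx, h⟩).symm
  have hall : ∀ x ∈ H, (x ∈ L ↔ a ∈ L) := by
    intro x hx
    by_cases hxK : x ∈ K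
    · rw [key x hxK b hb, key a ha b hb]
    · exact (key a ha x ⟨hx, hxK⟩).symm
  exact hd.2 ((hall d hd.1).2 ((hall c (hL hc)).1 hc))

theorem Intro.exists_pair_of_weak {Γ₁ Γ₂ M : Set G.Vert} (h : G.WeakIntro Γ H Γ₁ Γ₂ M) :
    ∃ x ∈ H, ∃ y ∈ H, x ≠ y := by
  obtain ⟨x, hx⟩ := h.nonempty
  obtain ⟨y, hy, hyM⟩ := h.nonempty'
  exact ⟨x, h.sub hx, y, hy, fun e => hyM (e ▸ hx)⟩

theorem Intro.exists_pair_of_prime {ι : Type} {P : SimpleGraph ι} {π : G.Vert → ι}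
    {k : G.Vert → Option Bool} (h : G.PrimeIntro Γ H P π k) :
    ∃ x ∈ H, ∃ y ∈ H, x ≠ y := by
  have := h.card
  have : Nonempty ι := (Nat.card_pos_iff.1 (by omega)).1
  obtain ⟨x, hx, -⟩ := h.exists_cell (Classical.arbitrary ι)
  obtain ⟨y, hy, hyi, -⟩ := h.exists_ne (π x) (π x)
  exact ⟨x, hx, y, hy, fun e => hyi (e ▸ rfl)⟩

/-- The case of a cut where both sides are introduced by the last rules. -/
theorem cut_of_intro (hcut : ∀ m < n, CutAt V m) (cd : G.CutData Γ Δ H H' e e')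
    (hn : H.ncard = n) (h : G.Intro Γ H) (h' : G.Intro Δ H') : Pr G (Γ ∪ Δ) := by
  have hn' : H'.ncard = n := by rw [cd.dual.ncard_eq, hn]
  have hsing : ∀ y, H = {y} → ¬ ∃ a ∈ H', ∃ b ∈ H', a ≠ b := by
    rintro y rfl ⟨a, ha, b, hb, hab⟩
    have h1 := cd.dual.map' a ha
    have h2 := cd.dual.map' b hb
    exact hab (by rw [← cd.dual.right a ha, ← cd.dual.right b hb, h1, h2])
  have hsing' : ∀ y, H' = {y} → ¬ ∃ a ∈ H, ∃ b ∈ H, a ≠ b := by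
    rintro y rfl ⟨a, ha, b, hb, hab⟩
    have h1 := cd.dual.map a ha
    have h2 := cd.dual.map b hb
    exact hab (by rw [← cd.dual.left a ha, ← cd.dual.left b hb, h1, h2])
  cases h with
  | @ax x y hΓ hH hl =>
    cases h' with
    | @ax x' y' hΔ hH' hl' =>
      subst hΓ hH hΔ hH'
      obtain rfl : e y = y' := cd.dual.map y rfl
      have hs := cd.sepΓΔ x rfl x' rfl
      refine Pr.ax hs.1 hs.2 ?_
      rw [cd.dual.label y rfl, hl, Atom.dual_dual] at hl'
      rw [hl', Atom.dual_dual]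
    | weak h' => exact absurd (Intro.exists_pair_of_weak h') (hsing y hH)
    | prime h' => exact absurd (Intro.exists_pair_of_prime h') (hsing y hH)
  | weak h =>
    cases h' with
    | @ax x' y' hΔ hH' hl' => exact absurd (Intro.exists_pair_of_weak h) (hsing' y' hH')
    | weak h' => exact weak_weak hcut cd hn h h'
    | prime h' =>
      rw [Set.union_comm]
      exact prime_weak hcut cd.symm hn' h' h
  | prime h =>
    cases h' with
    | @ax x' y' hΔ hH' hl' => exact absurd (Intro.exists_pair_of_prime h) (hsing' y' hH')
    | weak h' => exact prime_weak hcut cd hn h h'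
    | prime h' => exact prime_prime hcut cd hn h h'

theorem cut_of_conn (hcut : ∀ m < n, CutAt V m) (cd : G.CutData Γ Δ H H' e e')
    (hn : H.ncard = n) (hne : H.Nonempty) (hH : G.Conn H) (h₁ : Pr G (Γ ∪ H))
    (h₂ : Pr G (Δ ∪ H')) : Pr G (Γ ∪ Δ) := by
  refine Pr.reduce (W := Δ ∪ H') hne hH Set.subset_union_left ?_ h₁ Γ rfl cd.sepΓH
    (cd.sepΓΔ.union_right cd.sepΓH')
  intro Γ' hΓ'H hΓ'W hΓ'
  have cd' : G.CutData Γ' Δ H H' e e' :=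
    ⟨cd.dual, hΓ'W.mono subset_rfl Set.subset_union_left, hΓ'H, cd.sepΔH',
      hΓ'W.mono subset_rfl Set.subset_union_right, cd.sepΔH, cd.sepHH'⟩
  by_cases hH' : G.Conn H'
  · have hne' : H'.Nonempty := by
      rw [← cd.dual.image_eq]
      exact hne.image e
    rw [Set.union_comm]
    refine Pr.reduce (W := Γ' ∪ H) hne' hH' Set.subset_union_left ?_ h₂ Δ rfl cd.sepΔH'
      (cd'.sepΓΔ.symm.union_right cd.sepΔH)
    intro Δ' hΔ'H hΔ'W hΔ'
    rw [Set.union_comm]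
    refine cut_of_intro hcut ⟨cd.dual, ?_, hΓ'H, hΔ'H, cd'.sepΓH', ?_, cd.sepHH'⟩ hn hΓ' hΔ'
    · exact hΔ'W.symm.mono Set.subset_union_left subset_rfl
    · exact hΔ'W.mono subset_rfl Set.subset_union_right
  · cases hΓ' with
    | @ax x y hΓ hHy hl =>
      refine absurd ?_ hH'
      subst hHy
      rw [← cd.dual.image_eq, Set.image_singleton]
      rintro K hK ⟨a, ha⟩ ⟨b, hb, hbK⟩
      have := hK ha
      simp only [Set.mem_singleton_iff] at this hb
      exact absurd (hb ▸ this ▸ ha) hbK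
    | weak h => exact weak_disconnected hcut cd' hn h hH' h₂
    | prime h => exact absurd (h.conn_dual cd.dual) hH'

theorem cutAt (n : ℕ) : CutAt V n := by
  induction n using Nat.strong_induction_on with
  | _ n hcut =>
  intro G Γ Δ H H' e e' cd hn h₁ h₂
  obtain rfl | hne := H.eq_empty_or_nonempty
  · obtain rfl : H' = ∅ := by rw [← cd.dual.image_eq, Set.image_empty]
    rw [Set.union_empty] at h₁ h₂
    exact Pr.weak ∅ (Set.disjoint_left.2 fun x hx hx' => (cd.sepΓΔ x hx x hx').1 rfl) h₁ h₂
      (fun x hx y hy _ => (cd.sepΓΔ x hx y hy).2) (fun _ _ _ _ _ _ h => h.elim)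
      (fun _ _ _ _ h => h.elim)
  have hne' : H'.Nonempty := by
    rw [← cd.dual.image_eq]
    exact hne.image e
  rcases conn_or_conn_dual cd.dual with hH | hH
  · exact cut_of_conn hcut cd hn hne hH h₁ h₂
  · rw [Set.union_comm]
    exact cut_of_conn hcut cd.symm (by rw [cd.dual.ncard_eq, hn]) hne' hH h₂ h₁

/-- Cut admissibility. -/
theorem Pr.cut (cd : G.CutData Γ Δ H H' e e') (h₁ : Pr G (Γ ∪ H)) (h₂ : Pr G (Δ ∪ H')) :
    Pr G (Γ ∪ Δ) :=
  cutAt _ G Γ Δ H H' e e' cd rfl h₁ h₂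

end LGraph

namespace LGraph

variable {V : Type u}

/-- The vertices of `G.par H` coming from `G`. -/
def par.inl (G H : LGraph V) (x : G.Vert) : (G.par H).Vert := Sum.inl x

/-- The vertices of `G.par H` coming from `H`. -/
def par.inr (G H : LGraph V) (x : H.Vert) : (G.par H).Vert := Sum.inr x

/-- Functions on the vertices of `G.par H`. -/
def par.elim {α : Type*} (G H : LGraph V) (f : G.Vert → α) (g : H.Vert → α) :
    (G.par H).Vert → α :=
  Sum.elim f g

section

variable {G H : LGraph V}

@[simp]
theorem par.elim_inl {α : Type*} (f : G.Vert → α) (g : H.Vert → α) (x : G.Vert) :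
    par.elim G H f g (par.inl G H x) = f x := rfl

@[simp]
theorem par.elim_inr {α : Type*} (f : G.Vert → α) (g : H.Vert → α) (x : H.Vert) :
    par.elim G H f g (par.inr G H x) = g x := rfl

theorem par.cases (z : (G.par H).Vert) :
    (∃ x, par.inl G H x = z) ∨ ∃ x, par.inr G H x = z := by
  rcases z with x | x
  exacts [Or.inl ⟨x, rfl⟩, Or.inr ⟨x, rfl⟩]

@[simp]
theorem par.inl_inj {x y : G.Vert} : par.inl G H x = par.inl G H y ↔ x = y :=
  Sum.inl_injective.eq_iff

@[simp]
theorem par.inr_inj {x y : H.Vert} : par.inr G H x = par.inr G H y ↔ x = y :=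
  Sum.inr_injective.eq_iff

@[simp]
theorem par.inl_ne_inr {x : G.Vert} {y : H.Vert} : par.inl G H x ≠ par.inr G H y :=
  Sum.inl_ne_inr

@[simp]
theorem par.inr_ne_inl {x : H.Vert} {y : G.Vert} : par.inr G H x ≠ par.inl G H y :=
  Sum.inr_ne_inl

@[simp]
theorem par.adj_inl_inl {x y : G.Vert} :
    (G.par H).graph.Adj (par.inl G H x) (par.inl G H y) ↔ G.graph.Adj x y := Iff.rfl

@[simp]
theorem par.adj_inl_inr {x : G.Vert} {y : H.Vert} :
    (G.par H).graph.Adj (par.inl G H x) (par.inr G H y) ↔ False := iff_false_intro nofun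

@[simp]
theorem par.adj_inr_inl {x : H.Vert} {y : G.Vert} :
    (G.par H).graph.Adj (par.inr G H x) (par.inl G H y) ↔ False := iff_false_intro nofun

@[simp]
theorem par.adj_inr_inr {x y : H.Vert} :
    (G.par H).graph.Adj (par.inr G H x) (par.inr G H y) ↔ H.graph.Adj x y := Iff.rfl

@[simp]
theorem par.label_inl {x : G.Vert} : (G.par H).label (par.inl G H x) = G.label x := rfl

@[simp]
theorem par.label_inr {x : H.Vert} : (G.par H).label (par.inr G H x) = H.label x := rfl

theorem par.elim_injective {α : Type*} {f : G.Vert → α} {g : H.Vert → α}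
    (hf : Function.Injective f) (hg : Function.Injective g) (hfg : ∀ x y, f x ≠ g y) :
    Function.Injective (par.elim G H f g) :=
  hf.sumElim hg hfg

end

/-- The vertices of `G.tensor H` coming from `G`. -/
def tensor.inl (G H : LGraph V) (x : G.Vert) : (G.tensor H).Vert := Sum.inl x

/-- The vertices of `G.tensor H` coming from `H`. -/
def tensor.inr (G H : LGraph V) (x : H.Vert) : (G.tensor H).Vert := Sum.inr x

/-- Functions on the vertices of `G.tensor H`. -/
def tensor.elim {α : Type*} (G H : LGraph V) (f : G.Vert → α) (g : H.Vert → α) :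
    (G.tensor H).Vert → α :=
  Sum.elim f g

section

variable {G H : LGraph V}

@[simp]
theorem tensor.elim_inl {α : Type*} (f : G.Vert → α) (g : H.Vert → α) (x : G.Vert) :
    tensor.elim G H f g (tensor.inl G H x) = f x := rfl

@[simp]
theorem tensor.elim_inr {α : Type*} (f : G.Vert → α) (g : H.Vert → α) (x : H.Vert) :
    tensor.elim G H f g (tensor.inr G H x) = g x := rfl

theorem tensor.cases (z : (G.tensor H).Vert) :
    (∃ x, tensor.inl G H x = z) ∨ ∃ x, tensor.inr G H x = z := by
  rcases z with x | x
  exacts [Or.inl ⟨x, rfl⟩, Or.inr ⟨x, rfl⟩]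

@[simp]
theorem tensor.inl_inj {x y : G.Vert} : tensor.inl G H x = tensor.inl G H y ↔ x = y :=
  Sum.inl_injective.eq_iff

@[simp]
theorem tensor.inr_inj {x y : H.Vert} : tensor.inr G H x = tensor.inr G H y ↔ x = y :=
  Sum.inr_injective.eq_iff

@[simp]
theorem tensor.inl_ne_inr {x : G.Vert} {y : H.Vert} : tensor.inl G H x ≠ tensor.inr G H y :=
  Sum.inl_ne_inr

@[simp]
theorem tensor.inr_ne_inl {x : H.Vert} {y : G.Vert} : tensor.inr G H x ≠ tensor.inl G H y :=
  Sum.inr_ne_inl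

@[simp]
theorem tensor.adj_inl_inl {x y : G.Vert} :
    (G.tensor H).graph.Adj (tensor.inl G H x) (tensor.inl G H y) ↔ G.graph.Adj x y := Iff.rfl

@[simp]
theorem tensor.adj_inl_inr {x : G.Vert} {y : H.Vert} :
    (G.tensor H).graph.Adj (tensor.inl G H x) (tensor.inr G H y) ↔ True := Iff.rfl

@[simp]
theorem tensor.adj_inr_inl {x : H.Vert} {y : G.Vert} :
    (G.tensor H).graph.Adj (tensor.inr G H x) (tensor.inl G H y) ↔ True := Iff.rfl

@[simp]
theorem tensor.adj_inr_inr {x y : H.Vert} :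
    (G.tensor H).graph.Adj (tensor.inr G H x) (tensor.inr G H y) ↔ H.graph.Adj x y := Iff.rfl

@[simp]
theorem tensor.label_inl {x : G.Vert} : (G.tensor H).label (tensor.inl G H x) = G.label x := rfl

@[simp]
theorem tensor.label_inr {x : H.Vert} : (G.tensor H).label (tensor.inr G H x) = H.label x := rfl

theorem tensor.elim_injective {α : Type*} {f : G.Vert → α} {g : H.Vert → α}
    (hf : Function.Injective f) (hg : Function.Injective g) (hfg : ∀ x y, f x ≠ g y) :
    Function.Injective (tensor.elim G H f g) :=
  hf.sumElim hg hfg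

end

/-- The vertices of `G.plug R H` coming from `G`. -/
def plug.inl (G : LGraph V) (R : Set G.Vert) (H : LGraph V) (x : G.Vert) :
    (G.plug R H).Vert := Sum.inl x

/-- The vertices of `G.plug R H` coming from `H`. -/
def plug.inr (G : LGraph V) (R : Set G.Vert) (H : LGraph V) (x : H.Vert) :
    (G.plug R H).Vert := Sum.inr x

/-- Functions on the vertices of `G.plug R H`. -/
def plug.elim {α : Type*} (G : LGraph V) (R : Set G.Vert) (H : LGraph V)
    (f : G.Vert → α) (g : H.Vert → α) : (G.plug R H).Vert → α :=
  Sum.elim f g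

section

variable {G : LGraph V} {R : Set G.Vert} {H : LGraph V}

@[simp]
theorem plug.elim_inl {α : Type*} (f : G.Vert → α) (g : H.Vert → α) (x : G.Vert) :
    plug.elim G R H f g (plug.inl G R H x) = f x := rfl

@[simp]
theorem plug.elim_inr {α : Type*} (f : G.Vert → α) (g : H.Vert → α) (x : H.Vert) :
    plug.elim G R H f g (plug.inr G R H x) = g x := rfl

theorem plug.cases (z : (G.plug R H).Vert) :
    (∃ x, plug.inl G R H x = z) ∨ ∃ x, plug.inr G R H x = z := by
  rcases z with x | x
  exacts [Or.inl ⟨x, rfl⟩, Or.inr ⟨x, rfl⟩]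

@[simp]
theorem plug.inl_inj {x y : G.Vert} : plug.inl G R H x = plug.inl G R H y ↔ x = y :=
  Sum.inl_injective.eq_iff

@[simp]
theorem plug.inr_inj {x y : H.Vert} : plug.inr G R H x = plug.inr G R H y ↔ x = y :=
  Sum.inr_injective.eq_iff

@[simp]
theorem plug.inl_ne_inr {x : G.Vert} {y : H.Vert} : plug.inl G R H x ≠ plug.inr G R H y :=
  Sum.inl_ne_inr

@[simp]
theorem plug.inr_ne_inl {x : H.Vert} {y : G.Vert} : plug.inr G R H x ≠ plug.inl G R H y :=
  Sum.inr_ne_inl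

@[simp]
theorem plug.adj_inl_inl {x y : G.Vert} :
    (G.plug R H).graph.Adj (plug.inl G R H x) (plug.inl G R H y) ↔ G.graph.Adj x y := Iff.rfl

@[simp]
theorem plug.adj_inl_inr {x : G.Vert} {y : H.Vert} :
    (G.plug R H).graph.Adj (plug.inl G R H x) (plug.inr G R H y) ↔ x ∈ R := Iff.rfl

@[simp]
theorem plug.adj_inr_inl {x : H.Vert} {y : G.Vert} :
    (G.plug R H).graph.Adj (plug.inr G R H x) (plug.inl G R H y) ↔ y ∈ R := Iff.rfl

@[simp]
theorem plug.adj_inr_inr {x y : H.Vert} :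
    (G.plug R H).graph.Adj (plug.inr G R H x) (plug.inr G R H y) ↔ H.graph.Adj x y := Iff.rfl

@[simp]
theorem plug.label_inl {x : G.Vert} : (G.plug R H).label (plug.inl G R H x) = G.label x := rfl

@[simp]
theorem plug.label_inr {x : H.Vert} : (G.plug R H).label (plug.inr G R H x) = H.label x := rfl

theorem plug.elim_injective {α : Type*} {f : G.Vert → α} {g : H.Vert → α}
    (hf : Function.Injective f) (hg : Function.Injective g) (hfg : ∀ x y, f x ≠ g y) :
    Function.Injective (plug.elim G R H f g) :=
  hf.sumElim hg hfg

end

/-- The vertices of `G.impl H` coming from `G`. -/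
def impl.inl (G H : LGraph V) (x : G.Vert) : (G.impl H).Vert := Sum.inl x

/-- The vertices of `G.impl H` coming from `H`. -/
def impl.inr (G H : LGraph V) (x : H.Vert) : (G.impl H).Vert := Sum.inr x

/-- Functions on the vertices of `G.impl H`. -/
def impl.elim {α : Type*} (G H : LGraph V) (f : G.Vert → α) (g : H.Vert → α) :
    (G.impl H).Vert → α :=
  Sum.elim f g

section

variable {G H : LGraph V}

@[simp]
theorem impl.elim_inl {α : Type*} (f : G.Vert → α) (g : H.Vert → α) (x : G.Vert) :
    impl.elim G H f g (impl.inl G H x) = f x := rfl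

@[simp]
theorem impl.elim_inr {α : Type*} (f : G.Vert → α) (g : H.Vert → α) (x : H.Vert) :
    impl.elim G H f g (impl.inr G H x) = g x := rfl

theorem impl.cases (z : (G.impl H).Vert) :
    (∃ x, impl.inl G H x = z) ∨ ∃ x, impl.inr G H x = z := by
  rcases z with x | x
  exacts [Or.inl ⟨x, rfl⟩, Or.inr ⟨x, rfl⟩]

@[simp]
theorem impl.inl_inj {x y : G.Vert} : impl.inl G H x = impl.inl G H y ↔ x = y :=
  Sum.inl_injective.eq_iff

@[simp]
theorem impl.inr_inj {x y : H.Vert} : impl.inr G H x = impl.inr G H y ↔ x = y :=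
  Sum.inr_injective.eq_iff

@[simp]
theorem impl.inl_ne_inr {x : G.Vert} {y : H.Vert} : impl.inl G H x ≠ impl.inr G H y :=
  Sum.inl_ne_inr

@[simp]
theorem impl.inr_ne_inl {x : H.Vert} {y : G.Vert} : impl.inr G H x ≠ impl.inl G H y :=
  Sum.inr_ne_inl

@[simp]
theorem impl.adj_inl_inl {x y : G.Vert} :
    (G.impl H).graph.Adj (impl.inl G H x) (impl.inl G H y) ↔ x ≠ y ∧ ¬ G.graph.Adj x y := Iff.rfl

@[simp]
theorem impl.adj_inl_inr {x : G.Vert} {y : H.Vert} :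
    (G.impl H).graph.Adj (impl.inl G H x) (impl.inr G H y) ↔ False := iff_false_intro nofun

@[simp]
theorem impl.adj_inr_inl {x : H.Vert} {y : G.Vert} :
    (G.impl H).graph.Adj (impl.inr G H x) (impl.inl G H y) ↔ False := iff_false_intro nofun

@[simp]
theorem impl.adj_inr_inr {x y : H.Vert} :
    (G.impl H).graph.Adj (impl.inr G H x) (impl.inr G H y) ↔ H.graph.Adj x y := Iff.rfl

@[simp]
theorem impl.label_inl {x : G.Vert} : (G.impl H).label (impl.inl G H x) = (G.label x).dual := rfl

@[simp]
theorem impl.label_inr {x : H.Vert} : (G.impl H).label (impl.inr G H x) = H.label x := rfl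

theorem impl.elim_injective {α : Type*} {f : G.Vert → α} {g : H.Vert → α}
    (hf : Function.Injective f) (hg : Function.Injective g) (hfg : ∀ x y, f x ≠ g y) :
    Function.Injective (impl.elim G H f g) :=
  hf.sumElim hg hfg

end

/-- The vertices of the dual graph. -/
def toDual (G : LGraph V) (x : G.Vert) : G.dual.Vert := x

theorem toDual_surjective (G : LGraph V) (x : G.dual.Vert) : ∃ y, G.toDual y = x := ⟨x, rfl⟩

@[simp]
theorem toDual_inj {G : LGraph V} {x y : G.Vert} : G.toDual x = G.toDual y ↔ x = y := Iff.rfl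

@[simp]
theorem dual_adj {G : LGraph V} {x y : G.Vert} :
    G.dual.graph.Adj (G.toDual x) (G.toDual y) ↔ x ≠ y ∧ ¬ G.graph.Adj x y := Iff.rfl

@[simp]
theorem dual_label {G : LGraph V} {x : G.Vert} :
    G.dual.label (G.toDual x) = (G.label x).dual := rfl

/-- The vertices of a composition. -/
def comp.mk {ι : Type} [Finite ι] (P : SimpleGraph ι) (H : ι → LGraph V) (i : ι)
    (x : (H i).Vert) : (comp P H).Vert := ⟨i, x⟩

/-- The index of a vertex of a composition. -/
def comp.idx {ι : Type} [Finite ι] (P : SimpleGraph ι) (H : ι → LGraph V) :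
    (comp P H).Vert → ι := Sigma.fst

section

variable {ι : Type} [Finite ι] {P : SimpleGraph ι} {H : ι → LGraph V} {i j : ι}

@[simp]
theorem comp.idx_mk {x : (H i).Vert} : comp.idx P H (comp.mk P H i x) = i := rfl

theorem comp.cases (z : (comp P H).Vert) : ∃ i x, comp.mk P H i x = z := ⟨z.1, z.2, rfl⟩

@[simp]
theorem comp.mk_inj {x y : (H i).Vert} : comp.mk P H i x = comp.mk P H i y ↔ x = y :=
  sigma_mk_injective.eq_iff

theorem comp.mk_ne {x : (H i).Vert} {y : (H j).Vert} (h : i ≠ j) :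
    comp.mk P H i x ≠ comp.mk P H j y := fun e => h (congrArg (comp.idx P H) e)

theorem comp.adj_of_ne {x : (H i).Vert} {y : (H j).Vert} (h : i ≠ j) :
    (comp P H).graph.Adj (comp.mk P H i x) (comp.mk P H j y) ↔ P.Adj i j := by
  constructor
  · rintro (h' | ⟨k, v, w, -, hx, hy⟩)
    · exact h'
    · exact absurd ((congrArg Sigma.fst hx).trans (congrArg Sigma.fst hy).symm) h
  · exact Or.inl

@[simp]
theorem comp.adj_mk {x y : (H i).Vert} :
    (comp P H).graph.Adj (comp.mk P H i x) (comp.mk P H i y) ↔ (H i).graph.Adj x y := by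
  constructor
  · rintro (h' | ⟨k, v, w, h, hx, hy⟩)
    · exact absurd h' P.irrefl
    · cases hx; cases hy; exact h
  · exact fun h => Or.inr ⟨i, x, y, h, rfl, rfl⟩

@[simp]
theorem comp.label_mk {x : (H i).Vert} :
    (comp P H).label (comp.mk P H i x) = (H i).label x := rfl

end

instance : IsEmpty (empty : LGraph V).Vert := inferInstanceAs (IsEmpty Empty)

instance (a : Atom V) : Unique (atom a).Vert := inferInstanceAs (Unique Unit)

@[simp]
theorem atom_label (a : Atom V) (x : (atom a).Vert) : (atom a).label x = a := rfl

end LGraph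

namespace LGraph

variable {V : Type u}

theorem Pr.of_embedding {K G : LGraph V} (h : Pr K Set.univ) (f : K.Vert → G.Vert)
    (hf : Function.Injective f) (hadj : ∀ x y, G.graph.Adj (f x) (f y) ↔ K.graph.Adj x y)
    (hlab : ∀ x, G.label (f x) = K.label x) {S : Set G.Vert} (hS : ∀ y, y ∈ S ↔ ∃ x, f x = y) :
    Pr G S := by
  convert h.map f hf.injOn (fun x _ y _ => hadj x y) (fun x _ => hlab x) using 1
  ext y
  simp [hS]

/-- `G ⊸ H` is provable in the shallow calculus. -/
def Entails (G H : LGraph V) : Prop := Pr (G.impl H) Set.univ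

theorem Entails.embed {G H K : LGraph V} (h : Entails G H) (f : G.Vert → K.Vert)
    (g : H.Vert → K.Vert) (hf : Function.Injective f) (hg : Function.Injective g)
    (hfg : ∀ x y, f x ≠ g y)
    (hfadj : ∀ x y, x ≠ y → (K.graph.Adj (f x) (f y) ↔ ¬ G.graph.Adj x y))
    (hgadj : ∀ x y, K.graph.Adj (g x) (g y) ↔ H.graph.Adj x y)
    (hfgadj : ∀ x y, ¬ K.graph.Adj (f x) (g y))
    (hflab : ∀ x, K.label (f x) = (G.label x).dual) (hglab : ∀ x, K.label (g x) = H.label x)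
    {S : Set K.Vert} (hS : ∀ z, z ∈ S ↔ (∃ x, f x = z) ∨ ∃ x, g x = z) : Pr K S := by
  refine Pr.of_embedding h (impl.elim G H f g) (impl.elim_injective hf hg hfg) ?_ ?_ ?_
  · intro x y
    obtain ⟨x, rfl⟩ | ⟨x, rfl⟩ := impl.cases x <;> obtain ⟨y, rfl⟩ | ⟨y, rfl⟩ := impl.cases y
    · by_cases hxy : x = y
      · subst hxy; simp
      · simp [hfadj x y hxy, hxy]
    · simpa using hfgadj x y
    · simpa using fun h => hfgadj y x (K.graph.adj_symm h)
    · simpa using hgadj x y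
  · intro x
    obtain ⟨x, rfl⟩ | ⟨x, rfl⟩ := impl.cases x
    · simpa using hflab x
    · simpa using hglab x
  · intro z
    rw [hS]
    constructor
    · rintro (⟨x, rfl⟩ | ⟨x, rfl⟩)
      exacts [⟨impl.inl G H x, rfl⟩, ⟨impl.inr G H x, rfl⟩]
    · rintro ⟨x, rfl⟩
      obtain ⟨x, rfl⟩ | ⟨x, rfl⟩ := impl.cases x
      exacts [Or.inl ⟨x, rfl⟩, Or.inr ⟨x, rfl⟩]

theorem entails_of_iso {G H : LGraph V} (h : G.Iso H) : Entails G H := by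
  obtain ⟨f, hf⟩ := h
  have hadj : ∀ x y, H.graph.Adj (f x) (f y) ↔ G.graph.Adj x y := fun x y => f.map_rel_iff
  refine Pr.functor (ι := H.Vert) (P := H.graph) (π := impl.elim G H f id)
    (k := impl.elim G H (fun _ => some false) fun _ => some true) ⟨?_, ?_, ?_⟩ fun i => ?_
  · intro x _ y _ h
    obtain ⟨x, rfl⟩ | ⟨x, rfl⟩ := impl.cases x <;> obtain ⟨y, rfl⟩ | ⟨y, rfl⟩ := impl.cases y <;>
      simp_all
  · intro x _ y _ h
    obtain ⟨x, rfl⟩ | ⟨x, rfl⟩ := impl.cases x <;> simp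
  · intro x _ y _ b h hx hy
    obtain ⟨x, rfl⟩ | ⟨x, rfl⟩ := impl.cases x <;> obtain ⟨y, rfl⟩ | ⟨y, rfl⟩ := impl.cases y <;>
      cases b <;> simp_all
  · convert Pr.ax (G := G.impl H) (x := impl.inl G H (f.symm i)) (y := impl.inr G H i) ?_ ?_ ?_
      using 1
    · ext x
      obtain ⟨x, rfl⟩ | ⟨x, rfl⟩ := impl.cases x
      · simp [← f.symm_apply_eq, eq_comm]
      · simp
    · simp
    · simp
    · simp [Atom.dual_dual, ← hf]

theorem entails_refl (G : LGraph V) : Entails G G :=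
  entails_of_iso ⟨SimpleGraph.Iso.refl, fun _ => rfl⟩

theorem Entails.trans {G H K : LGraph V} (h₁ : Entails G H) (h₂ : Entails H K) :
    Entails G K := by
  let A : LGraph V := (G.impl K).par (H.impl H)
  let g : G.Vert → A.Vert := fun x => par.inl _ _ (impl.inl _ _ x)
  let k : K.Vert → A.Vert := fun x => par.inl _ _ (impl.inr _ _ x)
  let h' : H.Vert → A.Vert := fun x => par.inr _ _ (impl.inl _ _ x)
  let h : H.Vert → A.Vert := fun x => par.inr _ _ (impl.inr _ _ x)
  have p₁ : Pr A (Set.range g ∪ Set.range h) := by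
    refine h₁.embed g h ?_ ?_ ?_ ?_ ?_ ?_ ?_ ?_ (fun z => Iff.rfl)
    · exact fun x y h => impl.inl_inj.1 (par.inl_inj.1 h)
    · exact fun x y h => impl.inr_inj.1 (par.inr_inj.1 h)
    · exact fun x y => par.inl_ne_inr
    · intro x y hxy; simp [A, g, hxy]
    · intro x y; simp [A, h]
    · intro x y; simp [A, g, h]
    · intro x; simp [A, g]
    · intro x; simp [A, h]
  have p₂ : Pr A (Set.range k ∪ Set.range h') := by
    rw [Set.union_comm]
    refine h₂.embed h' k ?_ ?_ ?_ ?_ ?_ ?_ ?_ ?_ (fun z => Iff.rfl)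
    · exact fun x y h => impl.inl_inj.1 (par.inr_inj.1 h)
    · exact fun x y h => impl.inr_inj.1 (par.inl_inj.1 h)
    · exact fun x y => par.inr_ne_inl
    · intro x y hxy; simp [A, h', hxy]
    · intro x y; simp [A, k]
    · intro x y; simp [A, h', k]
    · intro x; simp [A, h']
    · intro x; simp [A, k]
  let s : A.Vert → A.Vert := par.elim _ _ (par.inl _ _) (impl.elim _ _ h h')
  have cd : A.CutData (Set.range g) (Set.range k) (Set.range h) (Set.range h') s s := by
    refine ⟨⟨?_, ?_, ?_, ?_, ?_, ?_⟩, ?_, ?_, ?_, ?_, ?_, ?_⟩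
    · rintro _ ⟨x, rfl⟩; exact ⟨x, rfl⟩
    · rintro _ ⟨x, rfl⟩; exact ⟨x, rfl⟩
    · rintro _ ⟨x, rfl⟩; rfl
    · rintro _ ⟨x, rfl⟩; rfl
    · rintro _ ⟨x, rfl⟩ _ ⟨y, rfl⟩ hxy
      have hxy : x ≠ y := fun h => hxy (by rw [h])
      simp [A, s, h, h', hxy]
    · rintro _ ⟨x, rfl⟩; rfl
    all_goals
      rintro _ ⟨x, rfl⟩ _ ⟨y, rfl⟩
      simp [A, g, h, h', k]
  have p := Pr.cut cd p₁ p₂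
  rcases isEmpty_or_nonempty (G.impl K).Vert with hem | ⟨⟨x₀⟩⟩
  · rw [Entails, Set.eq_empty_of_isEmpty Set.univ]
    exact Pr.nil
  have p' := p.map (G' := G.impl K) (par.elim _ _ id fun _ => x₀) ?_ ?_ ?_
  · unfold Entails
    convert p' using 1
    symm
    rw [Set.eq_univ_iff_forall]
    intro x
    obtain ⟨x, rfl⟩ | ⟨x, rfl⟩ := impl.cases x
    · exact ⟨g x, Or.inl ⟨x, rfl⟩, rfl⟩
    · exact ⟨k x, Or.inr ⟨x, rfl⟩, rfl⟩
  · rintro _ (⟨x, rfl⟩ | ⟨x, rfl⟩) _ (⟨y, rfl⟩ | ⟨y, rfl⟩) h <;>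
      simp only [g, k, par.elim_inl, id, impl.inl_inj, impl.inr_inj, impl.inl_ne_inr,
        impl.inr_ne_inl] at h <;> rw [h]
  · rintro _ (⟨x, rfl⟩ | ⟨x, rfl⟩) _ (⟨y, rfl⟩ | ⟨y, rfl⟩) <;> simp [A, g, k]
  · rintro _ (⟨x, rfl⟩ | ⟨x, rfl⟩) <;> rfl

theorem entails_empty_left {G : LGraph V} : Entails empty G ↔ Pr G Set.univ := by
  constructor
  · intro h
    exact h.embed isEmptyElim id (fun x => isEmptyElim x) Function.injective_id
      (fun x => isEmptyElim x) (fun x => isEmptyElim x) (fun _ _ => Iff.rfl)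
      (fun x => isEmptyElim x) (fun x => isEmptyElim x) (fun _ => rfl)
      (fun z => iff_of_true trivial (Or.inr ⟨z, rfl⟩))
  · intro h
    refine Pr.of_embedding h (impl.inr empty G) (fun x y => by simp) (by simp) (by simp)
      fun z => ?_
    obtain ⟨x, rfl⟩ | ⟨x, rfl⟩ := impl.cases z
    · exact isEmptyElim x
    · simp

theorem entails_comp {ι : Type} [Finite ι] (P : SimpleGraph ι) (G H : ι → LGraph V)
    (h : ∀ i, Entails (G i) (H i)) : Entails (comp P G) (comp P H) := by
  refine Pr.functor (ι := ι) (P := P)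
    (π := impl.elim _ _ (comp.idx P G) (comp.idx P H))
    (k := impl.elim _ _ (fun _ => some false) fun _ => some true) ⟨?_, ?_, ?_⟩ fun i => ?_
  · intro x _ y _ h
    obtain ⟨x, rfl⟩ | ⟨x, rfl⟩ := impl.cases x <;> obtain ⟨y, rfl⟩ | ⟨y, rfl⟩ := impl.cases y <;>
      simp_all
  · intro x _ y _ h
    obtain ⟨x, rfl⟩ | ⟨x, rfl⟩ := impl.cases x <;> simp
  · intro x _ y _ b h hx hy
    obtain ⟨x, rfl⟩ | ⟨x, rfl⟩ := impl.cases x <;> obtain ⟨y, rfl⟩ | ⟨y, rfl⟩ := impl.cases y <;>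
      obtain ⟨i, x, rfl⟩ := comp.cases x <;> obtain ⟨j, y, rfl⟩ := comp.cases y <;>
      simp only [impl.elim_inl, impl.elim_inr, comp.idx_mk] at h hx hy <;> cases hx <;> cases hy
    · simp [comp.adj_of_ne h, comp.mk_ne h]
    · simp [comp.adj_of_ne h]
  · refine (h i).embed (fun x => impl.inl _ _ (comp.mk P G i x))
      (fun x => impl.inr _ _ (comp.mk P H i x)) (fun x y h => by simpa using h)
      (fun x y h => by simpa using h) (by simp) ?_ (by simp) (by simp) (by simp) (by simp) ?_
    · intro x y hxy; simp [hxy]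
    · intro z
      obtain ⟨z, rfl⟩ | ⟨z, rfl⟩ := impl.cases z <;> obtain ⟨j, z, rfl⟩ := comp.cases z
      · constructor
        · rintro ⟨-, h⟩
          obtain rfl : j = i := by simpa using h
          exact Or.inl ⟨z, rfl⟩
        · rintro (⟨x, hx⟩ | ⟨x, hx⟩)
          · exact ⟨trivial, by rw [← hx]; simp⟩
          · simp at hx
      · constructor
        · rintro ⟨-, h⟩
          obtain rfl : j = i := by simpa using h
          exact Or.inr ⟨z, rfl⟩
        · rintro (⟨x, hx⟩ | ⟨x, hx⟩)
          · simp at hx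
          · exact ⟨trivial, by rw [← hx]; simp⟩

/-- The graph of a context `C[·]_R`, with the hole as an additional vertex. -/
def contextGraph (C : LGraph V) (R : Set C.Vert) : SimpleGraph (Option C.Vert) where
  Adj x y := match x, y with
    | some v, some w => C.graph.Adj v w
    | some v, none => v ∈ R
    | none, some w => w ∈ R
    | none, none => False
  symm := by
    constructor
    rintro (_ | v) (_ | w) h
    exacts [h, h, h, C.graph.adj_symm h]
  loopless := by
    constructor
    rintro (_ | v) h
    exacts [h, C.graph.irrefl h]

/-- The graphs at the vertices of a context: single vertices, and `M` in the hole. -/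
def contextFamily (C M : LGraph V) : Option C.Vert → LGraph V
  | some v => atom (C.label v)
  | none => M

theorem iso_of_bijective {G H : LGraph V} (f : G.Vert → H.Vert) (hf : Function.Bijective f)
    (hadj : ∀ x y, H.graph.Adj (f x) (f y) ↔ G.graph.Adj x y)
    (hlab : ∀ x, H.label (f x) = G.label x) : G.Iso H :=
  ⟨⟨Equiv.ofBijective f hf, fun {x y} => hadj x y⟩, hlab⟩

theorem Iso.symm {G H : LGraph V} (h : G.Iso H) : H.Iso G := by
  obtain ⟨f, hf⟩ := h
  exact ⟨f.symm, fun v => by rw [← hf, f.apply_symm_apply]⟩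

theorem plug_iso_comp (C : LGraph V) (R : Set C.Vert) (M : LGraph V) :
    (C.plug R M).Iso (comp (contextGraph C R) (contextFamily C M)) := by
  let F := contextFamily C M
  let a : C.Vert → (comp (contextGraph C R) F).Vert := fun v => comp.mk _ F (some v) ()
  let b : M.Vert → (comp (contextGraph C R) F).Vert := fun m => comp.mk _ F none m
  have ha : Function.Injective a := fun x y h =>
    Option.some_injective _ (congrArg (comp.idx _ F) h)
  have hb : Function.Injective b := fun x y h => comp.mk_inj.1 h
  refine iso_of_bijective (plug.elim C R M a b) ⟨plug.elim_injective ha hb ?_, ?_⟩ ?_ ?_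
  · exact fun x y => comp.mk_ne (by simp)
  · intro z
    obtain ⟨_ | v, x, rfl⟩ := comp.cases z
    · exact ⟨plug.inr C R M x, rfl⟩
    · exact ⟨plug.inl C R M v, rfl⟩
  · intro x y
    obtain ⟨x, rfl⟩ | ⟨x, rfl⟩ := plug.cases x <;> obtain ⟨y, rfl⟩ | ⟨y, rfl⟩ := plug.cases y
    · by_cases hxy : x = y
      · subst hxy; simp
      · exact comp.adj_of_ne (fun h => hxy (Option.some_injective _ h))
    · exact comp.adj_of_ne (by simp)
    · exact comp.adj_of_ne (by simp)
    · exact comp.adj_mk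
  · intro x
    obtain ⟨x, rfl⟩ | ⟨x, rfl⟩ := plug.cases x <;> rfl

theorem entails_plug (C : LGraph V) (R : Set C.Vert) {G H : LGraph V} (h : Entails G H) :
    Entails (C.plug R G) (C.plug R H) := by
  refine ((entails_of_iso (plug_iso_comp C R G)).trans (entails_comp _ _ _ ?_)).trans
    (entails_of_iso (plug_iso_comp C R H).symm)
  rintro (_ | v)
  · exact h
  · exact entails_refl _

theorem entails_of_iUp {G H : LGraph V} (h : Rule.IUp G H) : Entails G H := by
  obtain ⟨A⟩ := h
  refine (entails_refl A).embed (fun x => impl.inl _ _ (tensor.inl _ _ x))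
    (fun x => impl.inl _ _ (tensor.inr _ _ (toDual A x))) (fun x y h => by simpa using h)
    (fun x y h => by simpa using h) (by simp) ?_ ?_ (by simp) (by simp)
    (by simp [Atom.dual_dual]) ?_
  · intro x y hxy; simp [hxy]
  · intro x y
    have := fun h : A.graph.Adj x y => h.ne
    simp only [impl.adj_inl_inl, tensor.adj_inr_inr, dual_adj, ne_eq, tensor.inr_inj, toDual_inj]
    tauto
  · intro z
    obtain ⟨z, rfl⟩ | ⟨z, rfl⟩ := impl.cases z
    · obtain ⟨z, rfl⟩ | ⟨z, rfl⟩ := tensor.cases z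
      · simp
      · obtain ⟨z, rfl⟩ := toDual_surjective A z
        simp
    · exact isEmptyElim z

theorem entails_of_aiDown {G H : LGraph V} (h : Rule.AiDown G H) : Entails G H := by
  obtain ⟨a⟩ := h
  rw [entails_empty_left]
  convert Pr.ax (G := (atom a.dual).par (atom a)) (x := par.inl _ _ default)
    (y := par.inr _ _ default) ?_ ?_ ?_ using 1
  · ext z
    obtain ⟨z, rfl⟩ | ⟨z, rfl⟩ := par.cases z <;> simp [Unique.eq_default z]
  · simp
  · simp
  · simp [Atom.dual_dual]

theorem entails_of_aiUp {G H : LGraph V} (h : Rule.AiUp G H) : Entails G H := by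
  obtain ⟨a⟩ := h
  unfold Entails
  convert Pr.ax (G := ((atom a).tensor (atom a.dual)).impl empty)
    (x := impl.inl _ _ (tensor.inl _ _ default)) (y := impl.inl _ _ (tensor.inr _ _ default))
    ?_ ?_ ?_ using 1
  · ext z
    obtain ⟨z, rfl⟩ | ⟨z, rfl⟩ := impl.cases z
    · obtain ⟨z, rfl⟩ | ⟨z, rfl⟩ := tensor.cases z <;> simp [Unique.eq_default z]
    · exact isEmptyElim z
  · simp
  · simp
  · simp

theorem entails_of_ssDown {G H : LGraph V} (h : Rule.SsDown G H) : Entails G H := by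
  obtain ⟨A, B, S, -, -⟩ := h
  let b₁ : B.Vert → ((B.plug S A).impl (B.par A)).Vert :=
    fun x => impl.inl _ _ (plug.inl _ _ _ x)
  let a₁ : A.Vert → ((B.plug S A).impl (B.par A)).Vert :=
    fun x => impl.inl _ _ (plug.inr _ _ _ x)
  let b₂ : B.Vert → ((B.plug S A).impl (B.par A)).Vert :=
    fun x => impl.inr _ _ (par.inl _ _ x)
  let a₂ : A.Vert → ((B.plug S A).impl (B.par A)).Vert :=
    fun x => impl.inr _ _ (par.inr _ _ x)
  have hB : Pr ((B.plug S A).impl (B.par A)) (Set.range b₁ ∪ Set.range b₂) := by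
    refine (entails_refl B).embed b₁ b₂ (fun x y h => by simpa [b₁] using h)
      (fun x y h => by simpa [b₂] using h) (by simp [b₁, b₂]) ?_ (by simp [b₂])
      (by simp [b₁, b₂]) (by simp [b₁]) (by simp [b₂]) (fun z => Iff.rfl)
    intro x y hxy; simp [b₁, hxy]
  have hA : Pr ((B.plug S A).impl (B.par A)) (Set.range a₁ ∪ Set.range a₂) := by
    refine (entails_refl A).embed a₁ a₂ (fun x y h => by simpa [a₁] using h)
      (fun x y h => by simpa [a₂] using h) (by simp [a₁, a₂]) ?_ (by simp [a₂])
      (by simp [a₁, a₂]) (by simp [a₁]) (by simp [a₂]) (fun z => Iff.rfl)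
    intro x y hxy; simp [a₁, hxy]
  unfold Entails
  convert Pr.weak (Set.range a₁) ?_ hB hA ?_ ?_ ?_ using 1
  · ext z
    obtain ⟨z, rfl⟩ | ⟨z, rfl⟩ := impl.cases z
    · obtain ⟨z, rfl⟩ | ⟨z, rfl⟩ := plug.cases z <;> simp [a₁, a₂, b₁, b₂]
    · obtain ⟨z, rfl⟩ | ⟨z, rfl⟩ := par.cases z <;> simp [a₁, a₂, b₁, b₂]
  · rw [Set.disjoint_left]
    rintro _ (⟨x, rfl⟩ | ⟨x, rfl⟩) (⟨y, h⟩ | ⟨y, h⟩) <;> simp [a₁, a₂, b₁, b₂] at h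
  · rintro _ (⟨x, rfl⟩ | ⟨x, rfl⟩) _ (⟨y, rfl⟩ | ⟨y, rfl⟩) <;> simp [a₁, a₂, b₁, b₂]
  · rintro _ (⟨x, rfl⟩ | ⟨x, rfl⟩) _ - _ - ⟨y, rfl⟩ ⟨z, rfl⟩ <;> simp [a₁, b₁, b₂]
  · rintro _ - _ (⟨z, rfl⟩ | ⟨z, rfl⟩) ⟨y, rfl⟩ <;> simp [a₁, a₂]

theorem entails_of_ssUp {G H : LGraph V} (h : Rule.SsUp G H) : Entails G H := by
  obtain ⟨A, B, S, -, -⟩ := h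
  let b₁ : B.Vert → ((B.tensor A).impl (B.plug S A)).Vert :=
    fun x => impl.inl _ _ (tensor.inl _ _ x)
  let a₁ : A.Vert → ((B.tensor A).impl (B.plug S A)).Vert :=
    fun x => impl.inl _ _ (tensor.inr _ _ x)
  let b₂ : B.Vert → ((B.tensor A).impl (B.plug S A)).Vert :=
    fun x => impl.inr _ _ (plug.inl _ _ _ x)
  let a₂ : A.Vert → ((B.tensor A).impl (B.plug S A)).Vert :=
    fun x => impl.inr _ _ (plug.inr _ _ _ x)
  have hB : Pr ((B.tensor A).impl (B.plug S A)) (Set.range b₁ ∪ Set.range b₂) := by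
    refine (entails_refl B).embed b₁ b₂ (fun x y h => by simpa [b₁] using h)
      (fun x y h => by simpa [b₂] using h) (by simp [b₁, b₂]) ?_ (by simp [b₂])
      (by simp [b₁, b₂]) (by simp [b₁]) (by simp [b₂]) (fun z => Iff.rfl)
    intro x y hxy; simp [b₁, hxy]
  have hA : Pr ((B.tensor A).impl (B.plug S A)) (Set.range a₁ ∪ Set.range a₂) := by
    refine (entails_refl A).embed a₁ a₂ (fun x y h => by simpa [a₁] using h)
      (fun x y h => by simpa [a₂] using h) (by simp [a₁, a₂]) ?_ (by simp [a₂])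
      (by simp [a₁, a₂]) (by simp [a₁]) (by simp [a₂]) (fun z => Iff.rfl)
    intro x y hxy; simp [a₁, hxy]
  unfold Entails
  convert Pr.weak (Set.range a₂) ?_ hB hA ?_ ?_ ?_ using 1
  · ext z
    obtain ⟨z, rfl⟩ | ⟨z, rfl⟩ := impl.cases z
    · obtain ⟨z, rfl⟩ | ⟨z, rfl⟩ := tensor.cases z <;> simp [a₁, a₂, b₁, b₂]
    · obtain ⟨z, rfl⟩ | ⟨z, rfl⟩ := plug.cases z <;> simp [a₁, a₂, b₁, b₂]
  · rw [Set.disjoint_left]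
    rintro _ (⟨x, rfl⟩ | ⟨x, rfl⟩) (⟨y, h⟩ | ⟨y, h⟩) <;> simp [a₁, a₂, b₁, b₂] at h
  · rintro _ (⟨x, rfl⟩ | ⟨x, rfl⟩) _ (⟨y, rfl⟩ | ⟨y, rfl⟩) <;> simp [a₁, a₂, b₁, b₂]
  · rintro _ (⟨x, rfl⟩ | ⟨x, rfl⟩) _ - _ - ⟨y, rfl⟩ ⟨z, rfl⟩ <;> simp [a₂, b₁, b₂]
  · rintro _ - _ (⟨z, rfl⟩ | ⟨z, rfl⟩) ⟨y, rfl⟩ <;> simp [a₁, a₂]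

theorem entails_of_pDown {G H : LGraph V} (h : Rule.PDown G H) : Entails G H := by
  obtain ⟨P, -, -, M, N, -⟩ := h
  rename_i ι _
  let F : ι → LGraph V := fun i => (M i).par (N i)
  change Entails (comp ⊤ F) ((comp Pᶜ M).par (comp P N))
  refine Pr.functor (ι := ι) (P := P)
    (π := impl.elim _ _ (comp.idx ⊤ F) (par.elim _ _ (comp.idx Pᶜ M) (comp.idx P N)))
    (k := impl.elim _ _ (fun _ => none) (par.elim _ _ (fun _ => some false) fun _ => some true))
    ⟨?_, ?_, ?_⟩ fun i => ?_
  · intro x _ y _ h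
    obtain ⟨x, rfl⟩ | ⟨x, rfl⟩ := impl.cases x <;> obtain ⟨y, rfl⟩ | ⟨y, rfl⟩ := impl.cases y
    · simp at h
    · simp
    · simp
    · obtain ⟨x, rfl⟩ | ⟨x, rfl⟩ := par.cases x <;> obtain ⟨y, rfl⟩ | ⟨y, rfl⟩ := par.cases y <;>
        simp_all
  · intro x _ y _ h hx hy
    obtain ⟨x, rfl⟩ | ⟨x, rfl⟩ := impl.cases x
    · obtain ⟨y, rfl⟩ | ⟨y, rfl⟩ := impl.cases y
      · obtain ⟨i, x, rfl⟩ := comp.cases x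
        obtain ⟨j, y, rfl⟩ := comp.cases y
        have hij : i ≠ j := by simpa using h
        simp [comp.adj_of_ne hij, hij]
      · simp
    · obtain ⟨x, rfl⟩ | ⟨x, rfl⟩ := par.cases x <;> simp at hx
  · intro x _ y _ b h hx hy
    obtain ⟨x, rfl⟩ | ⟨x, rfl⟩ := impl.cases x
    · simp at hx
    obtain ⟨y, rfl⟩ | ⟨y, rfl⟩ := impl.cases y
    · simp at hy
    obtain ⟨x, rfl⟩ | ⟨x, rfl⟩ := par.cases x <;> obtain ⟨y, rfl⟩ | ⟨y, rfl⟩ := par.cases y <;>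
      obtain ⟨i, x, rfl⟩ := comp.cases x <;> obtain ⟨j, y, rfl⟩ := comp.cases y <;>
      simp only [impl.elim_inr, par.elim_inl, par.elim_inr, comp.idx_mk] at h hx hy <;>
      cases hx <;> cases hy
    · simp [comp.adj_of_ne h, h]
    · simp [comp.adj_of_ne h]
  · refine (entails_refl (F i)).embed (fun x => impl.inl _ _ (comp.mk ⊤ F i x))
      (fun x => impl.inr _ _ (par.elim (M i) (N i) (fun x => par.inl _ _ (comp.mk Pᶜ M i x))
        (fun x => par.inr _ _ (comp.mk P N i x)) x)) (fun x y h => by simpa using h) ?_ (by simp)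
      ?_ ?_ (by simp) (by simp) ?_ ?_
    · intro x y h
      simp only [impl.inr_inj] at h
      exact par.elim_injective (fun x y h => by simpa using h) (fun x y h => by simpa using h)
        (by simp) h
    · intro x y hxy; simp [hxy]
    · intro x y
      obtain ⟨x, rfl⟩ | ⟨x, rfl⟩ := par.cases x <;> obtain ⟨y, rfl⟩ | ⟨y, rfl⟩ := par.cases y <;>
        simp [F]
    · intro x
      obtain ⟨x, rfl⟩ | ⟨x, rfl⟩ := par.cases x <;> simp [F]
    · intro z
      obtain ⟨z, rfl⟩ | ⟨z, rfl⟩ := impl.cases z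
      · obtain ⟨j, z, rfl⟩ := comp.cases z
        constructor
        · rintro ⟨-, h⟩
          obtain rfl : j = i := by simpa using h
          exact Or.inl ⟨z, rfl⟩
        · rintro (⟨x, hx⟩ | ⟨x, hx⟩)
          · exact ⟨trivial, by rw [← hx]; simp⟩
          · simp at hx
      · constructor
        · rintro ⟨-, h⟩
          obtain ⟨z, rfl⟩ | ⟨z, rfl⟩ := par.cases z <;> obtain ⟨j, z, rfl⟩ := comp.cases z
          · obtain rfl : j = i := by simpa using h
            exact Or.inr ⟨par.inl _ _ z, by simp⟩
          · obtain rfl : j = i := by simpa using h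
            exact Or.inr ⟨par.inr _ _ z, by simp⟩
        · rintro (⟨x, hx⟩ | ⟨x, hx⟩)
          · simp at hx
          · refine ⟨trivial, ?_⟩
            rw [← hx]
            obtain ⟨x, rfl⟩ | ⟨x, rfl⟩ := par.cases x <;> simp

theorem entails_of_pUp {G H : LGraph V} (h : Rule.PUp G H) : Entails G H := by
  obtain ⟨P, -, -, M, N, -⟩ := h
  rename_i ι _
  let F : ι → LGraph V := fun i => (M i).tensor (N i)
  change Entails ((comp P M).tensor (comp Pᶜ N)) (comp ⊥ F)
  refine Pr.functor (ι := ι) (P := P)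
    (π := impl.elim _ _ (tensor.elim _ _ (comp.idx P M) (comp.idx Pᶜ N)) (comp.idx ⊥ F))
    (k := impl.elim _ _ (tensor.elim _ _ (fun _ => some false) fun _ => some true)
      (fun _ => none)) ⟨?_, ?_, ?_⟩ fun i => ?_
  · intro x _ y _ h
    obtain ⟨x, rfl⟩ | ⟨x, rfl⟩ := impl.cases x <;> obtain ⟨y, rfl⟩ | ⟨y, rfl⟩ := impl.cases y
    · obtain ⟨x, rfl⟩ | ⟨x, rfl⟩ := tensor.cases x <;>
        obtain ⟨y, rfl⟩ | ⟨y, rfl⟩ := tensor.cases y <;> simp_all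
    · simp
    · simp
    · simp at h
  · intro x _ y _ h hx hy
    obtain ⟨x, rfl⟩ | ⟨x, rfl⟩ := impl.cases x
    · obtain ⟨x, rfl⟩ | ⟨x, rfl⟩ := tensor.cases x <;> simp at hx
    · obtain ⟨y, rfl⟩ | ⟨y, rfl⟩ := impl.cases y
      · simp
      · obtain ⟨i, x, rfl⟩ := comp.cases x
        obtain ⟨j, y, rfl⟩ := comp.cases y
        have hij : i ≠ j := by simpa using h
        simp [comp.adj_of_ne hij]
  · intro x _ y _ b h hx hy
    obtain ⟨x, rfl⟩ | ⟨x, rfl⟩ := impl.cases x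
    swap
    · simp at hx
    obtain ⟨y, rfl⟩ | ⟨y, rfl⟩ := impl.cases y
    swap
    · simp at hy
    obtain ⟨x, rfl⟩ | ⟨x, rfl⟩ := tensor.cases x <;>
      obtain ⟨y, rfl⟩ | ⟨y, rfl⟩ := tensor.cases y <;>
      obtain ⟨i, x, rfl⟩ := comp.cases x <;> obtain ⟨j, y, rfl⟩ := comp.cases y <;>
      simp only [impl.elim_inl, tensor.elim_inl, tensor.elim_inr, comp.idx_mk] at h hx hy <;>
      cases hx <;> cases hy
    · simp [comp.adj_of_ne h, comp.mk_ne h]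
    · simp [comp.adj_of_ne h, comp.mk_ne h, h]
  · refine (entails_refl (F i)).embed
      (fun x => impl.inl _ _ (tensor.elim (M i) (N i) (fun x => tensor.inl _ _ (comp.mk P M i x))
        (fun x => tensor.inr _ _ (comp.mk Pᶜ N i x)) x))
      (fun x => impl.inr _ _ (comp.mk ⊥ F i x)) ?_ (fun x y h => by simpa using h) (by simp)
      ?_ (by simp) (by simp) ?_ (by simp) ?_
    · intro x y h
      simp only [impl.inl_inj] at h
      exact tensor.elim_injective (fun x y h => by simpa using h) (fun x y h => by simpa using h)
        (by simp) h
    · intro x y hxy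
      obtain ⟨x, rfl⟩ | ⟨x, rfl⟩ := tensor.cases x <;>
        obtain ⟨y, rfl⟩ | ⟨y, rfl⟩ := tensor.cases y <;> simp_all [F]
    · intro x
      obtain ⟨x, rfl⟩ | ⟨x, rfl⟩ := tensor.cases x <;> simp [F]
    · intro z
      obtain ⟨z, rfl⟩ | ⟨z, rfl⟩ := impl.cases z
      · constructor
        · rintro ⟨-, h⟩
          obtain ⟨z, rfl⟩ | ⟨z, rfl⟩ := tensor.cases z <;> obtain ⟨j, z, rfl⟩ := comp.cases z
          · obtain rfl : j = i := by simpa using h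
            exact Or.inl ⟨tensor.inl _ _ z, by simp⟩
          · obtain rfl : j = i := by simpa using h
            exact Or.inl ⟨tensor.inr _ _ z, by simp⟩
        · rintro (⟨x, hx⟩ | ⟨x, hx⟩)
          · refine ⟨trivial, ?_⟩
            rw [← hx]
            obtain ⟨x, rfl⟩ | ⟨x, rfl⟩ := tensor.cases x <;> simp
          · simp at hx
      · obtain ⟨j, z, rfl⟩ := comp.cases z
        constructor
        · rintro ⟨-, h⟩
          obtain rfl : j = i := by simpa using h
          exact Or.inr ⟨z, rfl⟩
        · rintro (⟨x, hx⟩ | ⟨x, hx⟩)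
          · simp at hx
          · exact ⟨trivial, by rw [← hx]; simp⟩

theorem entails_of_derives {G H : LGraph V} (h : Derives (SGS V) G H) : Entails G H := by
  induction h with
  | refl G => exact entails_refl G
  | comp P G H h ih => exact entails_comp P G H ih
  | rule r hr h₁ h h₂ ih₁ ih₂ =>
    refine (ih₁.trans ?_).trans ih₂
    rcases hr with rfl | rfl | rfl | rfl | rfl | rfl
    exacts [entails_of_aiDown h, entails_of_ssDown h, entails_of_pDown h, entails_of_pUp h,
      entails_of_ssUp h, entails_of_aiUp h]
  | iso h₁ h h₂ ih₁ ih₂ => exact (ih₁.trans (entails_of_iso h)).trans ih₂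

end LGraph

namespace LGraph

variable {V : Type u} {𝒮 : Set (Rule V)}

theorem iso_refl (G : LGraph V) : G.Iso G := ⟨SimpleGraph.Iso.refl, fun _ => rfl⟩

theorem provable_empty : Provable 𝒮 (empty : LGraph V) := Derives.refl _

theorem _root_.Provable.iso {G H : LGraph V} (hG : Provable 𝒮 G) (h : G.Iso H) : Provable 𝒮 H :=
  Derives.iso hG h (Derives.refl H)

theorem _root_.Provable.rule {G H : LGraph V} (hG : Provable 𝒮 G) {r : Rule V} (hr : r ∈ 𝒮)
    (h : r G H) : Provable 𝒮 H :=
  Derives.rule r hr hG h (Derives.refl H)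

theorem _root_.Provable.derives {G H : LGraph V} (hG : Provable 𝒮 G) (h : Derives 𝒮 G H) :
    Provable 𝒮 H :=
  Derives.iso hG (iso_refl G) h

theorem provable_comp {ι : Type} [Finite ι] (P : SimpleGraph ι) {G : ι → LGraph V}
    (h : ∀ i, Provable 𝒮 (G i)) : Provable 𝒮 (comp P G) := by
  have : IsEmpty (comp P fun _ : ι => (empty : LGraph V)).Vert := ⟨fun z => by
    obtain ⟨i, x, rfl⟩ := comp.cases z
    exact isEmptyElim x⟩
  exact (provable_empty.iso (iso_of_bijective isEmptyElim
    ⟨fun x => isEmptyElim x, fun x => isEmptyElim x⟩ (fun x => isEmptyElim x)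
    (fun x => isEmptyElim x))).derives (Derives.comp P _ G h)

theorem provable_plug {C M : LGraph V} (R : Set C.Vert) (hC : Provable 𝒮 C)
    (hM : Provable 𝒮 M) : Provable 𝒮 (C.plug R M) := by
  have hC' : Provable 𝒮 (C.plug R empty) := by
    refine hC.iso (iso_of_bijective (plug.inl C R empty)
      ⟨fun x y h => plug.inl_inj.1 h, fun z => ?_⟩ (by simp) (by simp))
    obtain ⟨x, rfl⟩ | ⟨x, rfl⟩ := plug.cases z
    · exact ⟨x, rfl⟩
    · exact isEmptyElim x
  refine ((hC'.iso (plug_iso_comp C R empty)).derives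
    (Derives.comp _ _ (contextFamily C M) ?_)).iso (plug_iso_comp C R M).symm
  rintro (_ | v)
  · exact hM
  · exact Derives.refl _

/-- The induced subgraph on a set of vertices. -/
def sub (G : LGraph V) (S : Set G.Vert) : LGraph V where
  Vert := S
  finite := inferInstance
  graph := G.graph.comap Subtype.val
  label x := G.label x

/-- The vertex of `G.sub S` given by an element of `S`. -/
def sub.mk (G : LGraph V) {S : Set G.Vert} (x : G.Vert) (hx : x ∈ S) : (G.sub S).Vert := ⟨x, hx⟩

/-- The inclusion of `G.sub S` into `G`. -/
def sub.val (G : LGraph V) {S : Set G.Vert} (x : (G.sub S).Vert) : G.Vert := Subtype.val x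

section

variable {G : LGraph V} {S : Set G.Vert}

theorem sub.val_mem (x : (G.sub S).Vert) : sub.val G x ∈ S := Subtype.property x

theorem sub.val_injective : Function.Injective (sub.val G : (G.sub S).Vert → G.Vert) :=
  Subtype.val_injective

theorem sub.cases (x : (G.sub S).Vert) : ∃ y, ∃ h : y ∈ S, sub.mk G y h = x :=
  ⟨x.1, x.2, rfl⟩

@[simp]
theorem sub.val_mk {x : G.Vert} {hx : x ∈ S} : sub.val G (sub.mk G x hx) = x := rfl

@[simp]
theorem sub.mk_inj {x y : G.Vert} {hx : x ∈ S} {hy : y ∈ S} :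
    sub.mk G x hx = sub.mk G y hy ↔ x = y := Subtype.mk_eq_mk

@[simp]
theorem sub.adj {x y : (G.sub S).Vert} :
    (G.sub S).graph.Adj x y ↔ G.graph.Adj (sub.val G x) (sub.val G y) := Iff.rfl

@[simp]
theorem sub.label {x : (G.sub S).Vert} : (G.sub S).label x = G.label (sub.val G x) := rfl

end

theorem provable_of_delete_cross {G H : LGraph V} (hG : Provable (GS V) G) (f : G.Vert → H.Vert)
    (hf : Function.Bijective f) (hlab : ∀ x, H.label (f x) = G.label x) (A : Set G.Vert)
    (hA : ∀ x ∉ A, ∀ y ∈ A, ∀ z ∈ A, G.graph.Adj x y → G.graph.Adj x z)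
    (hadj : ∀ x y, H.graph.Adj (f x) (f y) ↔ G.graph.Adj x y ∧ (x ∈ A ↔ y ∈ A)) :
    Provable (GS V) H := by
  by_cases hc : ∃ x ∉ A, ∃ y ∈ A, G.graph.Adj x y
  · obtain ⟨x₀, hx₀, y₀, hy₀, h₀⟩ := hc
    let R : Set (G.sub Aᶜ).Vert := {x | ∃ y ∈ A, G.graph.Adj (sub.val G x) y}
    have hdisj : ∀ (x : (G.sub Aᶜ).Vert) (y : (G.sub A).Vert), sub.val G x ≠ sub.val G y :=
      fun x y h => sub.val_mem x (h ▸ sub.val_mem y)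
    have hsurj : ∀ z, (∃ x : (G.sub Aᶜ).Vert, sub.val G x = z) ∨
        ∃ x : (G.sub A).Vert, sub.val G x = z := by
      intro z
      by_cases hz : z ∈ A
      exacts [Or.inr ⟨sub.mk G z hz, rfl⟩, Or.inl ⟨sub.mk G z hz, rfl⟩]
    have i₁ : ((G.sub Aᶜ).plug R (G.sub A)).Iso G := by
      refine iso_of_bijective (plug.elim _ _ _ (sub.val G) (sub.val G))
        ⟨plug.elim_injective sub.val_injective sub.val_injective hdisj, fun z => ?_⟩ ?_ ?_
      · obtain ⟨x, rfl⟩ | ⟨x, rfl⟩ := hsurj z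
        exacts [⟨plug.inl _ _ _ x, rfl⟩, ⟨plug.inr _ _ _ x, rfl⟩]
      · have key : ∀ (x : (G.sub Aᶜ).Vert) (y : (G.sub A).Vert),
            G.graph.Adj (sub.val G x) (sub.val G y) ↔ x ∈ R := fun x y =>
          ⟨fun h => ⟨_, sub.val_mem y, h⟩,
            fun ⟨z, hz, h⟩ => hA _ (sub.val_mem x) z hz _ (sub.val_mem y) h⟩
        intro x y
        obtain ⟨x, rfl⟩ | ⟨x, rfl⟩ := plug.cases x <;>
          obtain ⟨y, rfl⟩ | ⟨y, rfl⟩ := plug.cases y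
        · simp
        · simpa using key x y
        · simpa [G.graph.adj_comm] using key y x
        · simp
      · intro x
        obtain ⟨x, rfl⟩ | ⟨x, rfl⟩ := plug.cases x <;> simp
    have i₂ : ((G.sub Aᶜ).par (G.sub A)).Iso H := by
      refine iso_of_bijective (par.elim _ _ (f ∘ sub.val G) (f ∘ sub.val G))
        ⟨par.elim_injective (hf.1.comp sub.val_injective) (hf.1.comp sub.val_injective)
          fun x y h => hdisj x y (hf.1 h), fun z => ?_⟩ ?_ ?_
      · obtain ⟨z, rfl⟩ := hf.2 z
        obtain ⟨x, rfl⟩ | ⟨x, rfl⟩ := hsurj z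
        exacts [⟨par.inl _ _ x, rfl⟩, ⟨par.inr _ _ x, rfl⟩]
      · intro x y
        obtain ⟨x, rfl⟩ | ⟨x, rfl⟩ := par.cases x <;>
          obtain ⟨y, rfl⟩ | ⟨y, rfl⟩ := par.cases y <;>
          have hx := sub.val_mem x <;> have hy := sub.val_mem y <;>
          simp_all
      · intro x
        obtain ⟨x, rfl⟩ | ⟨x, rfl⟩ := par.cases x <;> simp [hlab]
    refine ((hG.iso i₁.symm).rule (r := Rule.SsDown) (by simp [GS])
      (Rule.SsDown.mk _ _ R ?_ ⟨sub.mk G y₀ hy₀⟩)).iso i₂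
    exact Set.nonempty_iff_ne_empty.1 ⟨sub.mk G x₀ hx₀, y₀, hy₀, h₀⟩
  · push Not at hc
    refine hG.iso (iso_of_bijective f hf (fun x y => ?_) hlab)
    rw [hadj, and_iff_left_iff_imp]
    intro h
    by_contra hne
    by_cases hx : x ∈ A <;> by_cases hy : y ∈ A
    · exact hne (iff_of_true hx hy)
    · exact hc y hy x hx h.symm
    · exact hc x hx y hy h
    · exact hne (iff_of_false hx hy)

/-- The kind of a vertex in a layered graph in which the side vertices over `J` stay on the side
and the other ones are moved to the `P`-part. -/
noncomputable def layeredKind {G : LGraph V} {ι : Type} (π : G.Vert → ι)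
    (k : G.Vert → Option Bool) (J : Set ι) (x : G.Vert) : Option Bool :=
  open Classical in if k x = none ∧ π x ∉ J then some true else k x

/-- Adjacency in `layeredGraph`. -/
def LayeredAdj (G : LGraph V) {ι : Type} (P : SimpleGraph ι) (π : G.Vert → ι)
    (k : G.Vert → Option Bool) (J : Set ι) (x y : G.Vert) : Prop :=
  (π x = π y ∧ G.graph.Adj x y) ∨ (π x ≠ π y ∧ ∃ b, layeredKind π k J x = some b ∧
    layeredKind π k J y = some b ∧ (P.Adj (π x) (π y) ↔ b = true))

/-- The graph on `S` with the edges of `G` in the layers, and the edges given by `P` and the kind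
of vertices between different layers. -/
def layeredGraph (G : LGraph V) (S : Set G.Vert) {ι : Type} (P : SimpleGraph ι) (π : G.Vert → ι)
    (k : G.Vert → Option Bool) (J : Set ι) : LGraph V where
  Vert := S
  finite := inferInstance
  graph :=
    { Adj := fun x y => LayeredAdj G P π k J x.1 y.1
      symm := by
        constructor
        rintro x y (⟨h, h'⟩ | ⟨h, b, h₁, h₂, h₃⟩)
        · exact Or.inl ⟨h.symm, h'.symm⟩
        · exact Or.inr ⟨h.symm, b, h₂, h₁, by rwa [P.adj_comm]⟩
      loopless := by
        constructor
        rintro x (⟨h, h'⟩ | ⟨h, -⟩)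
        · exact G.graph.irrefl h'
        · exact h rfl }
  label x := G.label x.1

section Layered

variable {G : LGraph V} {S : Set G.Vert} {ι : Type} {P : SimpleGraph ι}
  {π : G.Vert → ι} {k : G.Vert → Option Bool} {J : Set ι}

theorem Layered.provable_insert (h : Layered G S P π k) (i : ι)
    (hJ : Provable (GS V) (layeredGraph G S P π k J)) :
    Provable (GS V) (layeredGraph G S P π k (insert i J)) := by
  refine provable_of_delete_cross hJ id Function.bijective_id (fun _ => rfl)
    {x : S | π x.1 = i ∧ k x.1 = none ∧ π x.1 ∉ J} ?_ ?_
  · rintro x hx y ⟨hy, hky, hyJ⟩ z ⟨hz, hkz, hzJ⟩ hadj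
    have hkind := h.kind x.1 x.2 y.1 y.2
    change LayeredAdj G P π k J x.1 y.1 at hadj
    change LayeredAdj G P π k J x.1 z.1
    simp only [LayeredAdj, layeredKind] at *
    grind
  · intro x y
    have hkind := h.kind x.1 x.2 y.1 y.2
    change LayeredAdj G P π k (insert i J) x.1 y.1 ↔ LayeredAdj G P π k J x.1 y.1 ∧ _
    simp only [LayeredAdj, layeredKind, Set.mem_insert_iff] at *
    by_cases hxy : π x.1 = π y.1
    · grind
    · grind

theorem Layered.provable_sub [Finite ι] (h : Layered G S P π k)
    (h₀ : Provable (GS V) (layeredGraph G S P π k ∅)) : Provable (GS V) (G.sub S) := by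
  have hu : Provable (GS V) (layeredGraph G S P π k Set.univ) :=
    Set.Finite.induction_on (motive := fun J _ => Provable (GS V) (layeredGraph G S P π k J)) _
      Set.finite_univ h₀ fun _ _ => h.provable_insert _
  refine hu.iso (iso_of_bijective id Function.bijective_id (fun x y => ?_) fun _ => rfl)
  have h₁ := h.kind x.1 x.2 y.1 y.2
  have h₂ := h.side x.1 x.2 y.1 y.2
  have h₃ := h.adj x.1 x.2 y.1 y.2
  change G.graph.Adj x.1 y.1 ↔ LayeredAdj G P π k Set.univ x.1 y.1
  simp only [LayeredAdj, layeredKind, Set.mem_univ, not_true, and_false, if_false]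
  by_cases hxy : π x.1 = π y.1
  · simp [hxy]
  · cases hx : k x.1 <;> cases hy : k y.1 <;> (simp_all; try grind)

theorem Layered.provable_base [Finite ι] (hP : IsPrimeGraph P) (hcard : 4 ≤ Nat.card ι)
    (h : Layered G S P π k) (hne : ∀ i b, ∃ x ∈ S, π x = i ∧ k x = some b)
    (hS : ∀ i, Provable (GS V) (G.sub {x ∈ S | π x = i})) :
    Provable (GS V) (layeredGraph G S P π k ∅) := by
  let M : ι → LGraph V := fun i => G.sub {x ∈ S | π x = i ∧ k x = some false}
  let N : ι → LGraph V := fun i => G.sub {x ∈ S | π x = i ∧ k x ≠ some false}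
  have hMN : ∀ i, Provable (GS V) ((M i).par (N i)) := by
    intro i
    refine (hS i).iso (Iso.symm (iso_of_bijective
      (par.elim (M i) (N i)
        (fun x => sub.mk G (sub.val G x) ⟨(sub.val_mem x).1, (sub.val_mem x).2.1⟩)
        (fun x => sub.mk G (sub.val G x) ⟨(sub.val_mem x).1, (sub.val_mem x).2.1⟩))
      ⟨par.elim_injective ?_ ?_ ?_, ?_⟩ ?_ ?_))
    · exact fun x y h => sub.val_injective (sub.mk_inj.1 h)
    · exact fun x y h => sub.val_injective (sub.mk_inj.1 h)
    · exact fun x y h => (sub.val_mem y).2.2 (sub.mk_inj.1 h ▸ (sub.val_mem x).2.2)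
    · intro z
      obtain ⟨z, ⟨hz, hi⟩, rfl⟩ := sub.cases z
      by_cases hk : k z = some false
      · exact ⟨par.inl _ _ (sub.mk G z ⟨hz, hi, hk⟩), rfl⟩
      · exact ⟨par.inr _ _ (sub.mk G z ⟨hz, hi, hk⟩), rfl⟩
    · intro x y
      obtain ⟨x, rfl⟩ | ⟨x, rfl⟩ := par.cases x <;>
        obtain ⟨y, rfl⟩ | ⟨y, rfl⟩ := par.cases y <;>
        obtain ⟨x, hx, rfl⟩ := sub.cases x <;> obtain ⟨y, hy, rfl⟩ := sub.cases y <;>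
        have hk := h.kind x hx.1 y hy.1 <;>
        simp [M, N]
      · exact hk fun h => hy.2.2 (h ▸ hx.2.2)
      · exact hk fun h => hx.2.2 (h ▸ hy.2.2)
    · intro x
      obtain ⟨x, rfl⟩ | ⟨x, rfl⟩ := par.cases x <;> rfl
  have hpar := (provable_comp ⊤ hMN).rule (r := Rule.PDown) (by simp [GS])
    (Rule.PDown.mk P hP hcard M N fun i => by
      obtain ⟨x, hx, hi, hk⟩ := hne i false
      exact ⟨sub.mk G x ⟨hx, hi, hk⟩⟩)
  let m : (comp Pᶜ M).Vert → (layeredGraph G S P π k ∅).Vert :=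
    fun x => (⟨x.2.1, x.2.2.1⟩ : S)
  let n : (comp P N).Vert → (layeredGraph G S P π k ∅).Vert :=
    fun x => (⟨x.2.1, x.2.2.1⟩ : S)
  refine hpar.iso (iso_of_bijective (par.elim _ _ m n) ⟨par.elim_injective ?_ ?_ ?_, ?_⟩ ?_ ?_)
  · rintro ⟨i, x, hx, rfl, hk⟩ ⟨j, y, hy, rfl, hk'⟩ h
    obtain rfl : x = y := congrArg Subtype.val h
    rfl
  · rintro ⟨i, x, hx, rfl, hk⟩ ⟨j, y, hy, rfl, hk'⟩ h
    obtain rfl : x = y := congrArg Subtype.val h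
    rfl
  · rintro ⟨i, x, hx, rfl, hk⟩ ⟨j, y, hy, rfl, hk'⟩ h
    obtain rfl : x = y := congrArg Subtype.val h
    exact hk' hk
  · rintro ⟨z, hz⟩
    by_cases hk : k z = some false
    · exact ⟨par.inl _ _ (comp.mk _ M (π z) (sub.mk G z ⟨hz, rfl, hk⟩)), rfl⟩
    · exact ⟨par.inr _ _ (comp.mk _ N (π z) (sub.mk G z ⟨hz, rfl, hk⟩)), rfl⟩
  · have hM : ∀ x y : (comp Pᶜ M).Vert, (layeredGraph G S P π k ∅).graph.Adj (m x) (m y) ↔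
        (comp Pᶜ M).graph.Adj x y := by
      intro x y
      obtain ⟨i, x, rfl⟩ := comp.cases x
      obtain ⟨j, y, rfl⟩ := comp.cases y
      obtain ⟨x, ⟨hx, rfl, hkx⟩, rfl⟩ := sub.cases x
      obtain ⟨y, ⟨hy, hj, hky⟩, rfl⟩ := sub.cases y
      change LayeredAdj G P π k ∅ x y ↔ _
      unfold LayeredAdj
      by_cases hxy : π x = j
      · subst hxy
        simp [hj, M]
      · rw [comp.adj_of_ne hxy]
        subst hj
        simp [hxy, layeredKind, hkx, hky]
    have hN : ∀ x y : (comp P N).Vert, (layeredGraph G S P π k ∅).graph.Adj (n x) (n y) ↔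
        (comp P N).graph.Adj x y := by
      intro x y
      obtain ⟨i, x, rfl⟩ := comp.cases x
      obtain ⟨j, y, rfl⟩ := comp.cases y
      obtain ⟨x, ⟨hx, rfl, hkx⟩, rfl⟩ := sub.cases x
      obtain ⟨y, ⟨hy, hj, hky⟩, rfl⟩ := sub.cases y
      change LayeredAdj G P π k ∅ x y ↔ _
      unfold LayeredAdj
      have hk : ∀ x, k x ≠ some false → layeredKind π k ∅ x = some true := by
        intro x hx
        rcases hx' : k x with _ | _ | _ <;> simp_all [layeredKind]
      by_cases hxy : π x = j
      · subst hxy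
        simp [hj, N]
      · rw [comp.adj_of_ne hxy]
        subst hj
        simp [hxy, hk x hkx, hk y hky]
    have hMN : ∀ (x : (comp Pᶜ M).Vert) (y : (comp P N).Vert),
        ¬ (layeredGraph G S P π k ∅).graph.Adj (m x) (n y) := by
      rintro ⟨i, x, hx, hi, hkx⟩ ⟨j, y, hy, hj, hky⟩ (⟨-, hadj⟩ | ⟨-, b, h₁, h₂, -⟩)
      · exact h.kind x hx y hy (fun h => hky (h ▸ hkx)) hadj
      · simp only [m, n, layeredKind] at h₁ h₂
        grind
    intro x y
    obtain ⟨x, rfl⟩ | ⟨x, rfl⟩ := par.cases x <;> obtain ⟨y, rfl⟩ | ⟨y, rfl⟩ := par.cases y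
    · simpa using hM x y
    · simpa using hMN x y
    · simpa using fun h => hMN y x h.symm
    · simpa using hN x y
  · intro x
    obtain ⟨x, rfl⟩ | ⟨x, rfl⟩ := par.cases x <;> rfl

end Layered

theorem Pr.provable_sub {G : LGraph V} {S : Set G.Vert} (h : Pr G S) :
    Provable (GS V) (G.sub S) := by
  induction h with
  | nil =>
    have : IsEmpty (G.sub ∅).Vert := ⟨fun x => sub.val_mem x⟩
    exact provable_empty.iso (iso_of_bijective isEmptyElim
      ⟨fun x => isEmptyElim x, fun x => isEmptyElim x⟩ (fun x => isEmptyElim x)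
      (fun x => isEmptyElim x))
  | @ax x y hne hadj hl =>
    refine (provable_empty.rule (r := Rule.AiDown) (by simp [GS]) ⟨G.label x⟩).iso
      (iso_of_bijective (par.elim _ _ (fun _ => sub.mk G y (by simp))
        fun _ => sub.mk G x (by simp)) ⟨par.elim_injective ?_ ?_ ?_, ?_⟩ ?_ ?_)
    · exact fun _ _ _ => Subsingleton.elim _ _
    · exact fun _ _ _ => Subsingleton.elim _ _
    · simpa using hne.symm
    · intro z
      obtain ⟨z, rfl | rfl, rfl⟩ := sub.cases z
      · exact ⟨par.inr _ _ default, rfl⟩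
      · exact ⟨par.inl _ _ default, rfl⟩
    · have hadj' : ¬ G.graph.Adj y x := fun h => hadj h.symm
      intro a b
      obtain ⟨a, rfl⟩ | ⟨a, rfl⟩ := par.cases a <;> obtain ⟨b, rfl⟩ | ⟨b, rfl⟩ := par.cases b <;>
        simp [hadj, hadj', Unique.eq_default a, Unique.eq_default b]
    · intro a
      obtain ⟨a, rfl⟩ | ⟨a, rfl⟩ := par.cases a <;> simp [hl]
  | @weak D E M hDE hD hE hside hmod hM ihD ihE =>
    let T : Set (G.sub D).Vert := {x | ∃ y ∈ E, y ∈ M ∧ G.graph.Adj (sub.val G x) y}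
    refine provable_of_delete_cross (provable_plug T ihD ihE)
      (plug.elim _ _ _
        (fun x => sub.mk G (S := D ∪ E) (sub.val G x) (Set.mem_union_left _ (sub.val_mem x)))
        fun x => sub.mk G (S := D ∪ E) (sub.val G x) (Set.mem_union_right _ (sub.val_mem x)))
      ⟨plug.elim_injective ?_ ?_ ?_, ?_⟩ ?_
      {z | ∃ y, plug.inr _ _ _ y = z ∧ sub.val G y ∉ M} ?_ ?_
    · exact fun x y h => sub.val_injective (sub.mk_inj.1 h)
    · exact fun x y h => sub.val_injective (sub.mk_inj.1 h)
    · exact fun x y h => Set.disjoint_left.1 hDE (sub.val_mem x)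
        (sub.mk_inj.1 h ▸ sub.val_mem y)
    · intro z
      obtain ⟨z, hz | hz, rfl⟩ := sub.cases z
      · exact ⟨plug.inl _ _ _ (sub.mk G z hz), rfl⟩
      · exact ⟨plug.inr _ _ _ (sub.mk G z hz), rfl⟩
    · intro x
      obtain ⟨x, rfl⟩ | ⟨x, rfl⟩ := plug.cases x <;> rfl
    · rintro x hx _ ⟨y, rfl, hy⟩ _ ⟨z, rfl, hz⟩ hadj
      obtain ⟨x, rfl⟩ | ⟨x, rfl⟩ := plug.cases x
      · simpa using hadj
      · have hx : sub.val G x ∈ M := by simpa using hx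
        exact absurd (by simpa using hadj) (hM _ (sub.val_mem x) _ (sub.val_mem y) hx hy)
    · have key : ∀ (x : (G.sub D).Vert) (y : (G.sub E).Vert),
          G.graph.Adj (sub.val G x) (sub.val G y) ↔ x ∈ T ∧ sub.val G y ∈ M := by
        intro x y
        have hx := sub.val_mem x
        have hy := sub.val_mem y
        constructor
        · intro h
          have hm : sub.val G y ∈ M := by_contra fun hm => hside _ hx _ hy hm h
          exact ⟨⟨_, hy, hm, h⟩, hm⟩
        · rintro ⟨⟨z, hz, hzM, h⟩, hm⟩
          exact hmod _ hx z hz _ hy hzM hm h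
      intro x y
      obtain ⟨x, rfl⟩ | ⟨x, rfl⟩ := plug.cases x <;>
        obtain ⟨y, rfl⟩ | ⟨y, rfl⟩ := plug.cases y
      · simp
      · simpa using key x y
      · simpa [G.graph.adj_comm] using key y x
      · have h₁ := hM _ (sub.val_mem x) _ (sub.val_mem y)
        have h₂ := hM _ (sub.val_mem y) _ (sub.val_mem x)
        rw [G.graph.adj_comm] at h₂
        simp
        tauto
  | prime P hP hcard S π k h hne hS ih =>
    exact h.provable_sub (h.provable_base hP hcard hne ih)

theorem Pr.provable {G : LGraph V} (h : Pr G Set.univ) : Provable (GS V) G :=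
  h.provable_sub.iso (iso_of_bijective (sub.val G)
    ⟨sub.val_injective, fun x => ⟨sub.mk G x trivial, rfl⟩⟩ (by simp) (by simp))

theorem _root_.Derives.mono {𝒮 𝒯 : Set (Rule V)} (h𝒮 : 𝒮 ⊆ 𝒯) {G H : LGraph V}
    (h : Derives 𝒮 G H) : Derives 𝒯 G H := by
  induction h with
  | refl G => exact Derives.refl G
  | comp P G H h ih => exact Derives.comp P G H ih
  | rule r hr h₁ h h₂ ih₁ ih₂ => exact Derives.rule r (h𝒮 hr) ih₁ h ih₂
  | iso h₁ h h₂ ih₁ ih₂ => exact Derives.iso ih₁ h ih₂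

theorem gs_subset_sgs : GS V ⊆ SGS V := by
  rintro r (rfl | rfl | rfl) <;> simp [SGS]

theorem provable_gs_iff {G : LGraph V} : Provable (GS V) G ↔ Pr G Set.univ :=
  ⟨fun h => entails_empty_left.1 (entails_of_derives (h.mono gs_subset_sgs)), Pr.provable⟩

theorem provable_sgs_iff {G : LGraph V} : Provable (SGS V) G ↔ Provable (GS V) G :=
  ⟨fun h => (entails_empty_left.1 (entails_of_derives h)).provable,
    fun h => h.mono gs_subset_sgs⟩

theorem admissible_of_entails {r : Rule V} (hr : ∀ G H, r G H → Entails G H) :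
    Admissible (GS V) r := by
  rintro _ _ ⟨C, R, G, H, h⟩ hG
  rw [provable_gs_iff, ← entails_empty_left] at hG ⊢
  exact hG.trans (entails_plug C R (hr G H h))

end LGraph

open LGraph in
theorem theorem5 (V : Type*) :
    Admissible (GS V) Rule.IUp ∧
      (Admissible (GS V) Rule.AiUp ∧ Admissible (GS V) Rule.SsUp ∧ Admissible (GS V) Rule.PUp) ∧
      (∀ G : LGraph V, Provable (SGS V) G ↔ Provable (GS V) G) ∧
      (∀ G H K : LGraph V, Provable (GS V) (G.impl H) → Provable (GS V) (H.impl K) →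
        Provable (GS V) (G.impl K)) := by
  refine ⟨admissible_of_entails fun _ _ => entails_of_iUp,
    ⟨admissible_of_entails fun _ _ => entails_of_aiUp,
      admissible_of_entails fun _ _ => entails_of_ssUp,
      admissible_of_entails fun _ _ => entails_of_pUp⟩,
    fun G => provable_sgs_iff, fun G H K h₁ h₂ => ?_⟩
  rw [provable_gs_iff] at h₁ h₂ ⊢
  exact Entails.trans h₁ h₂
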